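/- **Setting.** Let $d\ge 1$, $\mathbb T=\mathbb R/2\pi\mathbb Z$, $s_0=[\frac{d+1}2]+1$, $\mathrm m>0$, $\tau_0>d$, $\tau>0$, $\mathrm a=6\tau+4$, $b=\mathrm a+1$, $\mathrm s=s-\tau_0-11>s_0+b$, $C_0\in\mathbb R$. Write $|\ell|$ for the Euclidean norm, $\langle x\rangle=\max\{1,|x|\}$, $\langle \ell,x\rangle=\max\{1,|x|,|\ell|\}$; for a function $f$ of $\omega\in S\subseteq\mathbb R^d$ with values in a normed space let $\|f\|^{\gamma,S}=\sup_{S}\|f\|+\gamma\sup_{\omega_1\ne\omega_2}\|f(\omega_1)-f(\omega_2)\|/|\omega_1-\omega_2|$. *Norms.* A $\theta$-dependent operator $\mathcal A(\theta)=\sum_{\ell\in\mathbb Z^d}\hat{\mathcal A}(\ell)e^{i\ell\cdot\theta}$, $\theta\in\mathbb T^d$, on functions of $x\in\mathbb T$ is identified with the matrices of the $\hat{\mathcal A}(\ell)$ in the basis $e^{ijx}$; $[\hat{\mathcal A}(\ell)]_\alpha^\beta$ is its block from $\mathbb E_\alpha=\mathrm{span}\{e^{ijx}:|j|=\alpha\}$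 to $\mathbb E_\beta$, and $$|\mathcal A|_s=\sup_{\alpha\in\mathbb N}\Big(\sum_{\ell\in\mathbb Z^d,\beta\in\mathbb N}\langle\ell,\beta-\alpha\rangle^{2s}\|[\hat{\mathcal A}(\ell)]_\alpha^\beta\|^2\Big)^{1/2}.$$ Let $\overline{\mathcal A}u=\overline{\mathcal A\bar u}$ and $\langle D\rangle^\sigma e^{ijx}=\langle j\rangle^\sigma e^{ijx}$. A $2\times2$ operator matrix is *Hamiltonian* if $$\mathbf A=\begin{pmatrix}\mathcal A^d&\mathcal A^a\\-\overline{\mathcal A^a}&-\overline{\mathcal A^d}\end{pmatrix},\qquad(\mathcal A^d)^*=\mathcal A^d,\quad(\mathcal A^a)^*=\overline{\mathcal A^a},$$ and $\interleave\mathbf A\interleave_{s,\rho,o}=|\langle D\rangle^\rho\mathcal A^d|_s+|\mathcal A^d\langle D\rangle^\rho|_s+|\langle D\rangle^o\mathcal A^a|_s+|\mathcal A^a\langle D\rangle^o|_s+\sum_{\sigma\in\{0,\pm\rho\},\,\delta\in\{d,a\}}|\langle D\rangle^\sigma\mathcal A^\delta\langle D\rangle^{-\sigma}|_s$. *Data.*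 For $\gamma\in(0,1)$ let $$\mathcal O_\gamma=\{\omega\in[1,2]^d:\ |\omega\cdot\ell+j|\ge\gamma\langle\ell\rangle^{-\tau_0}\ \ \forall(\ell,j)\in\mathbb Z^{d+1}\setminus\{0\}\}.$$ Consider $i\partial_t\mathbf v=(\mathbf H_0^0+\mathbf P^0(\omega t,\omega))\mathbf v$ with $\mathbf H_0^0=\mathrm{diag}(\mathcal H_0,-\overline{\mathcal H_0})$, $\mathcal H_0e^{ijx}=(\sqrt{j^2+\mathrm m}+\kappa(j,\omega))e^{ijx}$, $\kappa$ real. Assume that $\mathbf P^0(\omega)$ is Hamiltonian for $\omega\in\mathcal O_\gamma$, and that for some $\varepsilon>0$, $\interleave\mathbf P^0\interleave^{\gamma,\mathcal O_\gamma}_{\mathrm s,1,0}\le\varepsilon$ and $|\kappa(j,\cdot)|^{\gamma,\mathcal O_\gamma}\le C_0\varepsilon$ for all $j\in\mathbb Z$. *Iteration.* Let $N_n=N_0^{(3/2)^n}$. Let $\Pi_N$ keep the Fourier modes $|\ell|<N$, and $\lfloor\mathbf P\rfloor=\mathrm{diag}(\lfloor\mathcal P^d\rfloor,-\overline{\lfloor\mathcal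 P^d\rfloor})$, where $\lfloor\mathcal P^d\rfloor$ is the block-diagonal operator with blocks $[\hat{\mathcal P}^d(0)]_j^j$. Put $\mathcal O^0_\gamma=\mathcal O_\gamma$. Given $\mathbf H_0^n,\mathbf P^n$, let $\lambda^n_{j,\mathfrak a}$ be the eigenvalues of the block $\mathbf h_j^n$ on $\mathbb E_j$ of the upper left entry of $\mathbf H_0^n$; let $\mathcal O^{n+1}_\gamma$ be the set of $\omega\in\mathcal O^n_\gamma$ with $$|\omega\cdot\ell+\lambda^n_{i,\mathfrak a}-\lambda^n_{j,\mathfrak a'}|\ge\gamma\langle i-j\rangle N_n^{-\tau},\qquad|\omega\cdot\ell+\lambda^n_{i,\mathfrak a}+\lambda^n_{j,\mathfrak a'}|\ge\gamma\langle i+j\rangle N_n^{-\tau}$$ for all $\mathfrak a,\mathfrak a'$ and all $(\ell,i,j)\in\mathbb Z^d\times\mathbb N\times\mathbb N$ with $|\ell|\le N_n$, $(\ell,i,j)\ne(0,j,j)$. Let $\mathbf U^{n+1}$ be the Hamiltonian solution, with Fourier modes $|\ell|<N_n$ and $[\hat{\mathcal U}^d(0)]_j^j=0$ for all $j$, of $$\omega\cdot\partial_\theta\mathbf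 U^{n+1}=i[\mathbf U^{n+1},\mathbf H_0^n]+\Pi_{N_n}\mathbf P^n-\lfloor\mathbf P^n\rfloor,$$ and let $\mathbf H_0^{n+1}=\mathbf H_0^n+\lfloor\mathbf P^n\rfloor$ and, with $\mathbf U=\mathbf U^{n+1}$, $$\mathbf H_0^{n+1}+\mathbf P^{n+1}=e^{i\mathbf U}(\mathbf H_0^n+\mathbf P^n)e^{-i\mathbf U}-\int_0^1e^{it\mathbf U}(\omega\cdot\partial_\theta\mathbf U)e^{-it\mathbf U}\,dt.$$ **Corollary 5.1.** For every large enough $N_0\in\mathbb N$ there are $\delta_0\in(0,1)$ and $C>0$, depending only on $d,s,\tau_0,\tau,\mathrm m,C_0,N_0$ (and the threshold for $N_0$ only on $d,s,\tau_0,\tau,\mathrm m,C_0$), such that for all $\gamma\in(0,1)$, $\varepsilon>0$ with $\varepsilon\gamma^{-1}\le\delta_0$ and all data as above the following holds. Let $S=\bigcap_{n\ge0}\mathcal O^n_\gamma$. For $\omega\in S$ all $\mathbf U^n(\theta,\omega)$, $n\ge1$, exist and are bounded operators on $L^2(\mathbb T)\times L^2(\mathbb T)$. Let $$\widetilde\Phi_n(\theta,\omega)=\Phi_n\cdots\Phi_2\Phi_1,\qquad\Phi_n=e^{-i\mathbf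 U^n(\theta,\omega)}.$$ There are invertible operators $\widetilde\Phi_\infty(\theta,\omega)$, $\theta\in\mathbb T^d$, $\omega\in S$, such that for every $r\in[0,\mathrm s-b-s_0]$, with $H^r=H^r(\mathbb T)$ the Sobolev space with norm $(\sum_j\langle j\rangle^{2r}|\hat u_j|^2)^{1/2}$: each $\sup_\theta\|\widetilde\Phi_n(\theta)\|^{\gamma,S}_{\mathcal B(H^r\times H^r)}$ is finite, $$\sup_{\theta\in\mathbb T^d}\|\widetilde\Phi_n(\theta)-\widetilde\Phi_\infty(\theta)\|^{\gamma,S}_{\mathcal B(H^r\times H^r)}\to0\quad(n\to\infty),\qquad\sup_{\theta\in\mathbb T^d}\|\widetilde\Phi_\infty^{\pm1}(\theta)-\mathrm{Id}\|^{\gamma,S}_{\mathcal B(H^r\times H^r)}\le C\varepsilon\gamma^{-1}.$$ -/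

import Mathlib

open scoped ENNReal

namespace WaveKAM

noncomputable section

/-! ### Brackets, frequencies -/

/-- `|ℓ|` for `ℓ ∈ ℤ^d`. -/
def freqNorm {d : ℕ} (l : Fin d → ℤ) : ℝ := Real.sqrt (∑ i, (l i : ℝ) ^ 2)

/-- `⟨x⟩ = max {1, |x|}`. -/
def jap (x : ℝ) : ℝ := max 1 |x|

/-- `⟨ℓ, x⟩ = max {1, |x|, |ℓ|}`. -/
def japPair {d : ℕ} (l : Fin d → ℤ) (x : ℝ) : ℝ := max 1 (max |x| (freqNorm l))

/-- `ω · ℓ`. -/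
def freqDot {d : ℕ} (ω : EuclideanSpace ℝ (Fin d)) (l : Fin d → ℤ) : ℝ := ∑ i, ω i * (l i : ℝ)

/-- `s₀ = [(d+1)/2] + 1` (integer part). -/
def sZero (d : ℕ) : ℝ := (((d + 1) / 2 + 1 : ℕ) : ℝ)

/-- The Lipschitz norm `sup_S N(f) + γ sup N(f ω₁ - f ω₂) / |ω₁ - ω₂|` of a function of the
frequency, for an extended norm `N` on the target. -/
def lipNorm {d : ℕ} {E : Type*} [Sub E] (γ : ℝ) (S : Set (EuclideanSpace ℝ (Fin d)))
    (N : E → ℝ≥0∞) (f : EuclideanSpace ℝ (Fin d) → E) : ℝ≥0∞ :=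
  (⨆ ω ∈ S, N (f ω)) +
    ENNReal.ofReal γ *
      ⨆ (ω₁ ∈ S) (ω₂ ∈ S) (_ : ω₁ ≠ ω₂), N (f ω₁ - f ω₂) / ENNReal.ofReal ‖ω₁ - ω₂‖

/-! ### Operators depending on `θ ∈ 𝕋^d`, through their matrices -/

/-- A `θ`-dependent operator `A(θ) = ∑_ℓ Â(ℓ) e^{iℓ·θ}`, given by the matrices of its Fourier
coefficients: `A ℓ k j` is the coefficient of the basis vector `k` in the image of the basis
vector `j` under `Â(ℓ)`. The index set is `ℤ` for operators on `L²(𝕋)` (basis `e^{ijx}`) and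
`ℤ ⊕ ℤ` for operators on `L²(𝕋) × L²(𝕋)`. -/
abbrev OpArr (d : ℕ) (ι : Type) : Type := (Fin d → ℤ) → Matrix ι ι ℂ

/-- Composition: matrix product in the space indices, convolution in the Fourier index. -/
def arrMul {d : ℕ} {ι : Type} (A B : OpArr d ι) : OpArr d ι := fun l =>
  Matrix.of fun k j => ∑' p : (Fin d → ℤ) × ι, A (l - p.1) k p.2 * B p.1 p.2 j

def arrOne (d : ℕ) (ι : Type) [DecidableEq ι] : OpArr d ι := fun l => if l = 0 then 1 else 0

def arrPow {d : ℕ} {ι : Type} [DecidableEq ι] (A : OpArr d ι) : ℕ → OpArr d ι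
  | 0 => arrOne d ι
  | n + 1 => arrMul A (arrPow A n)

/-- The exponential `∑ Aⁿ / n!`. -/
def arrExp {d : ℕ} {ι : Type} [DecidableEq ι] (A : OpArr d ι) : OpArr d ι := fun l =>
  Matrix.of fun k j => ∑' n : ℕ, ((n.factorial : ℂ))⁻¹ * arrPow A n l k j

/-- The conjugate operator `Ā u = conj (A (conj u))`. -/
def arrConj {d : ℕ} (A : OpArr d ℤ) : OpArr d ℤ := fun l =>
  Matrix.of fun k j => star (A (-l) (-k) (-j))

/-- The adjoint operator. -/
def arrAdj {d : ℕ} (A : OpArr d ℤ) : OpArr d ℤ := fun l =>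
  Matrix.of fun k j => star (A (-l) j k)

/-- `⟨D⟩^σ A ⟨D⟩^σ'`. -/
def arrWeight {d : ℕ} (σ σ' : ℝ) (A : OpArr d ℤ) : OpArr d ℤ := fun l =>
  Matrix.of fun k j =>
    ((jap (k : ℝ) ^ σ : ℝ) : ℂ) * A l k j * ((jap (j : ℝ) ^ σ' : ℝ) : ℂ)

/-- `ω · ∂_θ A`. -/
def arrDeriv {d : ℕ} {ι : Type} (ω : EuclideanSpace ℝ (Fin d)) (A : OpArr d ι) : OpArr d ι :=
  fun l => (Complex.I * (freqDot ω l : ℂ)) • A l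

open Classical in
/-- The truncation `Π_N A` to the Fourier modes `|ℓ| < N`. -/
def arrCut {d : ℕ} {ι : Type} (N : ℝ) (A : OpArr d ι) : OpArr d ι :=
  fun l => if freqNorm l < N then A l else 0

/-! ### Blocks and the block decay norm -/

/-- The indices `j ∈ ℤ` with `|j| = α`. -/
def blockIdx (α : ℕ) : Finset ℤ := {(α : ℤ), -(α : ℤ)}

/-- The block `[M]_α^β : 𝔼_α → 𝔼_β`, where `𝔼_α = span {e^{ijx} : |j| = α}`. -/
def block (M : Matrix ℤ ℤ ℂ) (β α : ℕ) : Matrix (blockIdx β) (blockIdx α) ℂ :=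
  M.submatrix Subtype.val Subtype.val

open scoped Matrix.Norms.L2Operator in
/-- The `L²` operator norm of a block. -/
def blockNorm (M : Matrix ℤ ℤ ℂ) (β α : ℕ) : ℝ := ‖block M β α‖

/-- The block decay norm `|A|_s` (with value `∞` outside `𝓜_s`). -/
def decayNorm {d : ℕ} (s : ℝ) (A : OpArr d ℤ) : ℝ≥0∞ :=
  ⨆ α : ℕ, (∑' p : (Fin d → ℤ) × ℕ,
    ENNReal.ofReal (japPair p.1 ((p.2 : ℝ) - (α : ℝ)) ^ (2 * s) *
      blockNorm (A p.1) p.2 α ^ 2)) ^ (1 / 2 : ℝ)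

/-! ### `2 × 2` operator matrices -/

/-- The operator matrix `[[a, b], [-b̄, -ā]]`. -/
def opMatrix {d : ℕ} (a b : OpArr d ℤ) : OpArr d (ℤ ⊕ ℤ) := fun l =>
  Matrix.fromBlocks (a l) (b l) (-arrConj b l) (-arrConj a l)

/-- The diagonal entry `A^d`. -/
def diagPart {d : ℕ} (A : OpArr d (ℤ ⊕ ℤ)) : OpArr d ℤ := fun l => (A l).toBlocks₁₁

/-- The anti-diagonal entry `A^a`. -/
def antiPart {d : ℕ} (A : OpArr d (ℤ ⊕ ℤ)) : OpArr d ℤ := fun l => (A l).toBlocks₁₂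

/-- The algebraic structure required in the spaces `𝓝_s(ρ, o)`: the form
`[[A^d, A^a], [-conj A^a, -conj A^d]]` with `(A^d)^* = A^d` and `(A^a)^* = conj A^a`. -/
def HasHamForm {d : ℕ} (A : OpArr d (ℤ ⊕ ℤ)) : Prop :=
  A = opMatrix (diagPart A) (antiPart A) ∧
    arrAdj (diagPart A) = diagPart A ∧ arrAdj (antiPart A) = arrConj (antiPart A)

/-- The norm of `𝓝_s(ρ, o)`. -/
def hamNorm {d : ℕ} (s ρ o : ℝ) (A : OpArr d (ℤ ⊕ ℤ)) : ℝ≥0∞ :=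
  decayNorm s (arrWeight ρ 0 (diagPart A)) + decayNorm s (arrWeight 0 ρ (diagPart A)) +
    decayNorm s (arrWeight o 0 (antiPart A)) + decayNorm s (arrWeight 0 o (antiPart A)) +
    (decayNorm s (arrWeight ρ (-ρ) (diagPart A)) + decayNorm s (diagPart A) +
      decayNorm s (arrWeight (-ρ) ρ (diagPart A))) +
    (decayNorm s (arrWeight ρ (-ρ) (antiPart A)) + decayNorm s (antiPart A) +
      decayNorm s (arrWeight (-ρ) ρ (antiPart A)))

/-- `⌊P⌋`: the blocks `[P̂^d(0)]_j^j` on the diagonal, and minus their conjugates. -/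
def arrAvg {d : ℕ} (P : OpArr d (ℤ ⊕ ℤ)) : OpArr d (ℤ ⊕ ℤ) :=
  opMatrix
    (fun l => Matrix.of fun k j => if l = 0 ∧ |k| = |j| then diagPart P l k j else 0) 0

/-- The unperturbed operator `diag (𝓗₀, -conj 𝓗₀)` with `𝓗₀ e^{ijx} = (√(j²+m) + κ(j)) e^{ijx}`. -/
def initialH (d : ℕ) (m : ℝ) (κ : ℤ → ℝ) : OpArr d (ℤ ⊕ ℤ) :=
  opMatrix
    (fun l => if l = 0 then
      Matrix.diagonal fun j : ℤ => ((Real.sqrt ((j : ℝ) ^ 2 + m) + κ j : ℝ) : ℂ) else 0) 0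

/-! ### One step of the iteration, at a fixed frequency -/

/-- `U` is the solution of the homological equation
`ω · ∂_θ U = i [U, H] + Π_N P - ⌊P⌋` in Hamiltonian form, with Fourier modes `|ℓ| < N` and with
vanishing blocks `[Û^d(0)]_j^j` (the blocks that the equation leaves undetermined). -/
def IsHomSol {d : ℕ} (ω : EuclideanSpace ℝ (Fin d)) (N : ℝ) (H P U : OpArr d (ℤ ⊕ ℤ)) : Prop :=
  HasHamForm U ∧ (∀ l, N ≤ freqNorm l → U l = 0) ∧
    (∀ k j : ℤ, |k| = |j| → diagPart U 0 k j = 0) ∧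
    arrDeriv ω U = Complex.I • (arrMul U H - arrMul H U) + arrCut N P - arrAvg P

open Classical in
def homSol {d : ℕ} (ω : EuclideanSpace ℝ (Fin d)) (N : ℝ) (H P : OpArr d (ℤ ⊕ ℤ)) :
    OpArr d (ℤ ⊕ ℤ) :=
  if h : ∃ U, IsHomSol ω N H P U then h.choose else 0

/-- `e^{iU} A e^{-iU}`. -/
def arrConjugate {d : ℕ} (U A : OpArr d (ℤ ⊕ ℤ)) : OpArr d (ℤ ⊕ ℤ) :=
  arrMul (arrMul (arrExp (Complex.I • U)) A) (arrExp (-Complex.I • U))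

/-- The Hamiltonian `e^{iU} K e^{-iU} - ∫₀¹ e^{itU} (ω·∂_θ U) e^{-itU} dt` to which the change of
variables `v = e^{-iU(ωt)} v⁺` conjugates `i ∂_t v = K(ωt) v`. -/
def pushHam {d : ℕ} (ω : EuclideanSpace ℝ (Fin d)) (U K : OpArr d (ℤ ⊕ ℤ)) :
    OpArr d (ℤ ⊕ ℤ) :=
  arrConjugate U K - fun l => Matrix.of fun k j =>
    ∫ t in (0 : ℝ)..1, arrConjugate ((t : ℂ) • U) (arrDeriv ω U) l k j

/-- `N_n = N₀^((3/2)^n)`. -/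
def scaleN (N₀ : ℕ) (n : ℕ) : ℝ := (N₀ : ℝ) ^ ((3 / 2 : ℝ) ^ n)

/-- The pair `(H₀ⁿ, Pⁿ)` at the frequency `ω`, from `(H₀⁰, P⁰) = (H, P)`:
`H₀ⁿ⁺¹ = H₀ⁿ + ⌊Pⁿ⌋`, and `H₀ⁿ⁺¹ + Pⁿ⁺¹` is the conjugate of `H₀ⁿ + Pⁿ` by `e^{-iUⁿ⁺¹}`. -/
def kamState {d : ℕ} (N₀ : ℕ) (ω : EuclideanSpace ℝ (Fin d)) (H P : OpArr d (ℤ ⊕ ℤ)) :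
    ℕ → OpArr d (ℤ ⊕ ℤ) × OpArr d (ℤ ⊕ ℤ)
  | 0 => (H, P)
  | n + 1 =>
    let Hn := (kamState N₀ ω H P n).1
    let Pn := (kamState N₀ ω H P n).2
    (Hn + arrAvg Pn, pushHam ω (homSol ω (scaleN N₀ n) Hn Pn) (Hn + Pn) - (Hn + arrAvg Pn))

/-- `kamU N₀ ω H P n` is `Uⁿ⁺¹`. -/
def kamU {d : ℕ} (N₀ : ℕ) (ω : EuclideanSpace ℝ (Fin d)) (H P : OpArr d (ℤ ⊕ ℤ)) (n : ℕ) :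
    OpArr d (ℤ ⊕ ℤ) :=
  homSol ω (scaleN N₀ n) (kamState N₀ ω H P n).1 (kamState N₀ ω H P n).2

/-! ### Non-resonant frequencies -/

/-- `𝒪_γ ⊆ [1,2]^d`. -/
def diophSet (d : ℕ) (γ τ₀ : ℝ) : Set (EuclideanSpace ℝ (Fin d)) :=
  {ω | (∀ i, ω i ∈ Set.Icc (1 : ℝ) 2) ∧
    ∀ (l : Fin d → ℤ) (j : ℤ), (l, j) ≠ 0 →
      γ / japPair l 0 ^ τ₀ ≤ |freqDot ω l + (j : ℝ)|}

/-- The (real) eigenvalues `λ_{j,𝔞}` of the self-adjoint block `h_j` of `H`. -/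
def blockEigs {d : ℕ} (H : OpArr d (ℤ ⊕ ℤ)) (j : ℕ) : Set ℝ :=
  spectrum ℝ (block (diagPart H 0) j j)

/-- The sets `𝒪_γⁿ`. -/
def kamSet {d : ℕ} (γ τ₀ τ : ℝ) (N₀ : ℕ)
    (H P : EuclideanSpace ℝ (Fin d) → OpArr d (ℤ ⊕ ℤ)) : ℕ → Set (EuclideanSpace ℝ (Fin d))
  | 0 => diophSet d γ τ₀
  | n + 1 =>
    {ω | ω ∈ kamSet γ τ₀ τ N₀ H P n ∧
      ∀ (l : Fin d → ℤ) (i j : ℕ), freqNorm l ≤ scaleN N₀ n → ¬(l = 0 ∧ i = j) →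
        ∀ μ ∈ blockEigs (kamState N₀ ω (H ω) (P ω) n).1 i,
        ∀ ν ∈ blockEigs (kamState N₀ ω (H ω) (P ω) n).1 j,
          γ * jap ((i : ℝ) - (j : ℝ)) / scaleN N₀ n ^ τ ≤ |freqDot ω l + μ - ν| ∧
          γ * jap ((i : ℝ) + (j : ℝ)) / scaleN N₀ n ^ τ ≤ |freqDot ω l + μ + ν|}

/-! ### Operators on `L²(𝕋) × L²(𝕋)` and on `H^r × H^r` -/

instance factTwoPi : Fact (0 < 2 * Real.pi) := ⟨Real.two_pi_pos⟩

/-- The circle `𝕋 = ℝ / 2πℤ`. -/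
abbrev Circ : Type := AddCircle (2 * Real.pi)

abbrev L2 : Type := MeasureTheory.Lp ℂ 2 (AddCircle.haarAddCircle (T := 2 * Real.pi))

/-- Bounded operators on `L²(𝕋) × L²(𝕋)`. -/
abbrev BPair : Type := (L2 × L2) →L[ℂ] (L2 × L2)

def pairBasis : ℤ ⊕ ℤ → L2 × L2
  | Sum.inl j => (fourierLp 2 j, 0)
  | Sum.inr j => (0, fourierLp 2 j)

def pairCoeff (w : L2 × L2) : ℤ ⊕ ℤ → ℂ
  | Sum.inl k => fourierCoeff (T := 2 * Real.pi) (w.1 : Circ → ℂ) k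
  | Sum.inr k => fourierCoeff (T := 2 * Real.pi) (w.2 : Circ → ℂ) k

/-- `M` is the matrix of `T` in the exponential basis. -/
def HasMatrix (T : BPair) (M : Matrix (ℤ ⊕ ℤ) (ℤ ⊕ ℤ) ℂ) : Prop :=
  ∀ k j, pairCoeff (T (pairBasis j)) k = M k j

open Classical in
/-- The bounded operator with matrix `M`. -/
def toOp (M : Matrix (ℤ ⊕ ℤ) (ℤ ⊕ ℤ) ℂ) : BPair :=
  if h : ∃ T, HasMatrix T M then h.choose else 0

/-- The matrix of `A(θ) = ∑_ℓ Â(ℓ) e^{iℓ·θ}`. -/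
def evalAt {d : ℕ} (A : OpArr d (ℤ ⊕ ℤ)) (θ : Fin d → Circ) : Matrix (ℤ ⊕ ℤ) (ℤ ⊕ ℤ) ℂ :=
  Matrix.of fun k j => ∑' l : Fin d → ℤ, (∏ i, fourier (l i) (θ i)) * A l k j

/-- The norm of `H^r(𝕋)`, with value `∞` outside `H^r(𝕋)`. -/
def sobNorm (r : ℝ) (u : L2) : ℝ≥0∞ :=
  (∑' j : ℤ, ENNReal.ofReal (jap (j : ℝ) ^ (2 * r) *
    ‖fourierCoeff (T := 2 * Real.pi) (u : Circ → ℂ) j‖ ^ 2)) ^ (1 / 2 : ℝ)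

/-- The norm of `H^r(𝕋) × H^r(𝕋)`. -/
def pairNorm (r : ℝ) (w : L2 × L2) : ℝ≥0∞ :=
  (sobNorm r w.1 ^ 2 + sobNorm r w.2 ^ 2) ^ (1 / 2 : ℝ)

/-- The norm in `𝓑(H^r × H^r)`, finite iff the operator maps `H^r × H^r` boundedly to itself. -/
def opNorm (r : ℝ) (T : BPair) : ℝ≥0∞ :=
  ⨆ (w : L2 × L2) (_ : pairNorm r w ≤ 1), pairNorm r (T w)

/-- `kamOpU N₀ H P n ω θ` is the operator `Uⁿ⁺¹(θ, ω)`. -/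
def kamOpU {d : ℕ} (N₀ : ℕ) (H P : EuclideanSpace ℝ (Fin d) → OpArr d (ℤ ⊕ ℤ)) (n : ℕ)
    (ω : EuclideanSpace ℝ (Fin d)) (θ : Fin d → Circ) : BPair :=
  toOp (evalAt (kamU N₀ ω (H ω) (P ω) n) θ)

/-- `Φ̃_n(θ, ω) = Φ_n ⋯ Φ_1` with `Φ_n = e^{-i Uⁿ(θ, ω)}`. -/
def kamPhi {d : ℕ} (N₀ : ℕ) (H P : EuclideanSpace ℝ (Fin d) → OpArr d (ℤ ⊕ ℤ)) :
    ℕ → EuclideanSpace ℝ (Fin d) → (Fin d → Circ) → BPair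
  | 0 => fun _ _ => 1
  | n + 1 => fun ω θ =>
    NormedSpace.exp (-Complex.I • kamOpU N₀ H P n ω θ) * kamPhi N₀ H P n ω θ

end

end WaveKAM

open WaveKAM

namespace WaveKAM

/-! ### Extended `ℓ²` norms -/

/-! The proof is a KAM reducibility scheme carried out among bounded operators on `ℓ²`. An array `A`
is read as the block Toeplitz matrix with entries `A (ℓ - ℓ') x y` over `ℤ^d × (ℤ ⊕ ℤ)` (`toep`,
`IsOpOf`). Convolution of arrays becomes composition, `arrExp` becomes the operator exponential, and
the decay norm is replaced by the weighted column norm `colNorm`. Since the weight of order `-s₀` is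
square summable (`exists_ell2_wt_le`), products obey a tame estimate (`colNorm_mul_le`). It passes
to Lipschitz families, exponentials and conjugations by the abstract calculus of `IsTame`.

One step. Put `b = ⌊P⌋ - Π_N P`. The homological equation says that the commutator of `iU` with the
unbounded `H` is the bounded operator `ω·∂_θ U + b`. Duhamel's formula (`expCorner_mul_exp_neg`,
`toep_arrConjugate`) then gives `e^{iU} H e^{-iU} = H + ∫₀¹ e^{itU} (ω·∂_θ U + b) e^{-itU} dt`. The
integral subtracted in `pushHam` removes the derivative. What remains is two conjugation
differences, quadratic in the size of the data, plus the Fourier modes `|ℓ| ≥ N` of `P`, which are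
small in a weaker norm (`isOpOf_pushHam_sub`, `kam_step`).

Homological equation. It splits into Sylvester equations between blocks of size at most two with
self-adjoint coefficients. In eigenbases these are divisions by `ω·ℓ + μ - ν` or `ω·ℓ + μ + ν`, so
the Melnikov conditions control them (`sylvester_bound`, `exists_isHomSol`). The one sum that the
conditions leave out, `ℓ = 0` and `i = j`, is bounded below by positivity of the eigenvalues
(`nonRes_of_mem_kamSet`). Subtracting two such equations gives the dependence on `ω`
(`IsHomSol.entry_bound_sub`). The Hamiltonian form, needed to have self-adjoint blocks at every
step, survives because it amounts to two symmetries compatible with products (`hasHamForm_iff`,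
`hasHamForm_stepOp`).

Convergence. With `M` the previous scale and `N = M^{3/2}`, the norm of `P` of order `s - b` stays
below `e M^{-(6τ+4)}` while the norm of order `s` may grow like `e M` (`KamBound.step`,
`kamBound_all`). Hence the generators decrease geometrically, with total size of order `ε / γ`.
Evaluation at `θ` bounds operators on `H^r × H^r` at the cost of `s₀` orders of decay
(`opNorm_toOp_le`), so the products of the `e^{-iUⁿ}` form a telescoping series with geometric
terms. Its sum is close to the identity and is inverted by a Neumann series (`exists_kamPhi_limit`).
-/

noncomputable def ell2 {J : Type*} (f : J → ℝ≥0∞) : ℝ≥0∞ := (∑' i, f i ^ 2) ^ (1 / 2 : ℝ)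

section ell2
variable {J : Type*}

theorem ennreal_sq_rpow_half (x : ℝ≥0∞) : (x ^ 2) ^ (1 / 2 : ℝ) = x := by
  rw [← ENNReal.rpow_natCast, ← ENNReal.rpow_mul]; norm_num

theorem ennreal_rpow_half_sq (x : ℝ≥0∞) : (x ^ (1 / 2 : ℝ)) ^ 2 = x := by
  rw [← ENNReal.rpow_natCast, ← ENNReal.rpow_mul]; norm_num

theorem ell2_sq (f : J → ℝ≥0∞) : ell2 f ^ 2 = ∑' i, f i ^ 2 := ennreal_rpow_half_sq _

theorem ennreal_le_of_sq_le {x y : ℝ≥0∞} (h : x ^ 2 ≤ y ^ 2) : x ≤ y := by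
  rw [← ennreal_sq_rpow_half x, ← ennreal_sq_rpow_half y]
  exact ENNReal.rpow_le_rpow h (by norm_num)

theorem ell2_le_iff {f : J → ℝ≥0∞} {c : ℝ≥0∞} : ell2 f ≤ c ↔ ∑' i, f i ^ 2 ≤ c ^ 2 := by
  rw [← ell2_sq]
  exact ⟨fun h => by gcongr, ennreal_le_of_sq_le⟩

theorem ell2_mono {f g : J → ℝ≥0∞} (h : ∀ i, f i ≤ g i) : ell2 f ≤ ell2 g :=
  ENNReal.rpow_le_rpow (ENNReal.tsum_le_tsum fun i => by gcongr; exact h i) (by norm_num)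

theorem le_ell2 (f : J → ℝ≥0∞) (i : J) : f i ≤ ell2 f := by
  apply ennreal_le_of_sq_le
  rw [ell2_sq]; exact ENNReal.le_tsum i

theorem ell2_const_mul (c : ℝ≥0∞) (f : J → ℝ≥0∞) : ell2 (fun i => c * f i) = c * ell2 f := by
  simp only [ell2, mul_pow, ENNReal.tsum_mul_left]
  rw [ENNReal.mul_rpow_of_nonneg _ _ (by norm_num), ennreal_sq_rpow_half]

theorem ell2_add_le (f g : J → ℝ≥0∞) : ell2 (fun i => f i + g i) ≤ ell2 f + ell2 g := by
  let _ : MeasurableSpace J := ⊤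
  have h := ENNReal.lintegral_Lp_add_le (μ := MeasureTheory.Measure.count) (p := 2)
    (f := f) (g := g) (measurable_from_top).aemeasurable (measurable_from_top).aemeasurable
    (by norm_num)
  rw [MeasureTheory.lintegral_count' measurable_from_top,
    MeasureTheory.lintegral_count' measurable_from_top,
    MeasureTheory.lintegral_count' measurable_from_top] at h
  simpa [ell2] using h

theorem ell2_cauchy (f g : J → ℝ≥0∞) : ∑' i, f i * g i ≤ ell2 f * ell2 g := by
  let _ : MeasurableSpace J := ⊤
  have h := ENNReal.lintegral_mul_le_Lp_mul_Lq (MeasureTheory.Measure.count (α := J))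
    Real.HolderConjugate.two_two (f := f) (g := g)
    (measurable_from_top).aemeasurable (measurable_from_top).aemeasurable
  rw [MeasureTheory.lintegral_count' measurable_from_top,
    MeasureTheory.lintegral_count' measurable_from_top,
    MeasureTheory.lintegral_count' measurable_from_top] at h
  simpa [ell2] using h

theorem ell2_equiv {J' : Type*} (e : J' ≃ J) (f : J → ℝ≥0∞) :
    ell2 (fun i => f (e i)) = ell2 f := by
  rw [ell2, ell2, ← Equiv.tsum_eq e]

theorem ell2_enorm_add_le (w : J → ℝ≥0∞) (f g : J → ℂ) :
    ell2 (fun i => w i * ‖f i + g i‖ₑ) ≤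
      ell2 (fun i => w i * ‖f i‖ₑ) + ell2 (fun i => w i * ‖g i‖ₑ) := by
  refine le_trans (ell2_mono fun i => ?_) (ell2_add_le _ _)
  rw [← mul_add]; gcongr; exact enorm_add_le (f i) (g i)

/-- Schur-type estimate: a kernel times a square-summable weight. -/
theorem ell2_kernel_le {J' : Type*} (a v : J → J' → ℝ≥0∞) (ζ : ℝ≥0∞)
    (hv : ∀ p, ell2 (v p) ≤ ζ) :
    ell2 (fun p => ∑' r, a p r * v p r) ≤ ζ * (∑' r, ∑' p, a p r ^ 2) ^ (1 / 2 : ℝ) := by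
  rw [ell2_le_iff, mul_pow, ennreal_rpow_half_sq, ENNReal.tsum_comm, ← ENNReal.tsum_mul_left]
  refine ENNReal.tsum_le_tsum fun p => ?_
  calc (∑' r, a p r * v p r) ^ 2 ≤ (ell2 (a p) * ell2 (v p)) ^ 2 := by
        gcongr; exact ell2_cauchy _ _
    _ = ell2 (v p) ^ 2 * ell2 (a p) ^ 2 := by ring
    _ ≤ ζ ^ 2 * ∑' r, a p r ^ 2 := by
        rw [ell2_sq (a p)]; gcongr; exact hv p

/-- The bound is a family of bounds on finite partial sums, each a closed condition. This lower
semicontinuity is what lets estimates pass to series and integrals that converge only in a weaker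
topology. -/
theorem isClosed_ell2_le {X : Type*} [TopologicalSpace X] (F : X → J → ℝ≥0∞)
    (hF : ∀ i, Continuous fun x => F x i) (c : ℝ≥0∞) : IsClosed {x | ell2 (F x) ≤ c} := by
  have : {x | ell2 (F x) ≤ c} = ⋂ s : Finset J, {x | ∑ i ∈ s, F x i ^ 2 ≤ c ^ 2} := by
    ext x
    simp only [Set.mem_ofPred_eq, Set.mem_iInter, ell2_le_iff, ENNReal.tsum_eq_iSup_sum, iSup_le_iff]
  rw [this]
  refine isClosed_iInter fun s => isClosed_le ?_ continuous_const
  exact continuous_finsetSum _ fun i _ => (ENNReal.continuous_pow 2).comp (hF i)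

end ell2

/-! ### Weights -/

section weights
variable {d : ℕ}

theorem freqNorm_eq (l : Fin d → ℤ) :
    freqNorm l = ‖(WithLp.toLp 2 (fun i => (l i : ℝ)) : EuclideanSpace ℝ (Fin d))‖ := by
  rw [EuclideanSpace.norm_eq]; simp [freqNorm]

theorem freqNorm_nonneg (l : Fin d → ℤ) : 0 ≤ freqNorm l := Real.sqrt_nonneg _

theorem freqNorm_neg (l : Fin d → ℤ) : freqNorm (-l) = freqNorm l := by simp [freqNorm]

@[simp] theorem freqNorm_zero : freqNorm (0 : Fin d → ℤ) = 0 := by simp [freqNorm]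

theorem freqNorm_add_le (l k : Fin d → ℤ) : freqNorm (l + k) ≤ freqNorm l + freqNorm k := by
  simp only [freqNorm_eq]
  refine le_trans (le_of_eq ?_) (norm_add_le _ _)
  congr 1; ext i; simp

theorem abs_le_freqNorm (l : Fin d → ℤ) (i : Fin d) : |(l i : ℝ)| ≤ freqNorm l := by
  rw [freqNorm_eq]
  exact PiLp.norm_apply_le (WithLp.toLp 2 (fun i => (l i : ℝ)) : EuclideanSpace ℝ (Fin d)) i

theorem abs_freqDot_le (ω : EuclideanSpace ℝ (Fin d)) (l : Fin d → ℤ) :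
    |freqDot ω l| ≤ ‖ω‖ * freqNorm l := by
  have h := abs_real_inner_le_norm ω
    (WithLp.toLp 2 (fun i => (l i : ℝ)) : EuclideanSpace ℝ (Fin d))
  rw [← freqNorm_eq] at h
  refine le_trans (le_of_eq ?_) h
  congr 1
  simp [freqDot, PiLp.inner_apply, mul_comm]

theorem one_le_jap (x : ℝ) : 1 ≤ jap x := le_max_left _ _

theorem one_le_japPair (l : Fin d → ℤ) (x : ℝ) : 1 ≤ japPair l x := le_max_left _ _

theorem japPair_add_le (l k : Fin d → ℤ) (x y : ℝ) :
    japPair (l + k) (x + y) ≤ japPair l x + japPair k y := by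
  have h1 := one_le_japPair l x
  have h2 := one_le_japPair k y
  have h3 : |x| ≤ japPair l x := (le_max_left _ _).trans (le_max_right _ _)
  have h4 : |y| ≤ japPair k y := (le_max_left _ _).trans (le_max_right _ _)
  have h5 : freqNorm l ≤ japPair l x := (le_max_right _ _).trans (le_max_right _ _)
  have h6 : freqNorm k ≤ japPair k y := (le_max_right _ _).trans (le_max_right _ _)
  have := abs_add_le x y
  have := freqNorm_add_le l k
  exact max_le (by linarith) (max_le (by linarith) (by linarith))

theorem japPair_neg (l : Fin d → ℤ) (x : ℝ) : japPair (-l) (-x) = japPair l x := by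
  simp [japPair, freqNorm_neg]

theorem japPair_neg_left (l : Fin d → ℤ) (x : ℝ) : japPair (-l) x = japPair l x := by
  simp [japPair, freqNorm_neg]

theorem freqNorm_le_japPair (l : Fin d → ℤ) (x : ℝ) : freqNorm l ≤ japPair l x :=
  (le_max_right _ _).trans (le_max_right _ _)

theorem jap_le_japPair (l : Fin d → ℤ) (x : ℝ) : jap x ≤ japPair l x :=
  max_le_max le_rfl (le_max_left _ _)

theorem jap_le_japPair' (l : Fin d → ℤ) (x : ℝ) (i : Fin d) : jap (l i) ≤ japPair l x :=
  max_le_max le_rfl ((abs_le_freqNorm l i).trans (le_max_right _ _))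

/-- The indices of the matrix of an operator on functions of `(θ, x)` with two components. -/
abbrev Idx (d : ℕ) : Type := (Fin d → ℤ) × (ℤ ⊕ ℤ)

/-- `|j|` for both copies of `ℤ`. -/
def mag : ℤ ⊕ ℤ → ℝ := Sum.elim (fun j => |(j : ℝ)|) (fun j => |(j : ℝ)|)

/-- The distance-like weight on indices. -/
noncomputable def idxDist (p q : Idx d) : ℝ := japPair (p.1 - q.1) (mag p.2 - mag q.2)

theorem one_le_idxDist (p q : Idx d) : 1 ≤ idxDist p q := one_le_japPair _ _

theorem idxDist_pos (p q : Idx d) : 0 < idxDist p q := zero_lt_one.trans_le (one_le_idxDist p q)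

theorem idxDist_comm (p q : Idx d) : idxDist p q = idxDist q p := by
  rw [idxDist, ← japPair_neg, neg_sub, neg_sub, idxDist]

theorem idxDist_triangle (p r q : Idx d) : idxDist p q ≤ idxDist p r + idxDist r q := by
  have := japPair_add_le (p.1 - r.1) (r.1 - q.1) (mag p.2 - mag r.2) (mag r.2 - mag q.2)
  simpa [idxDist] using this

/-- The weight `⟨ℓ - ℓ', |x| - |y|⟩^s`. -/
noncomputable def wt (s : ℝ) (p q : Idx d) : ℝ≥0∞ := ENNReal.ofReal (idxDist p q ^ s)

theorem wt_comm (s : ℝ) (p q : Idx d) : wt s p q = wt s q p := by rw [wt, idxDist_comm, wt]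

theorem wt_ne_top (s : ℝ) (p q : Idx d) : wt s p q ≠ ⊤ := ENNReal.ofReal_ne_top

theorem wt_mono {s t : ℝ} (h : s ≤ t) (p q : Idx d) : wt s p q ≤ wt t p q :=
  ENNReal.ofReal_le_ofReal (Real.rpow_le_rpow_of_exponent_le (one_le_idxDist p q) h)

theorem one_le_wt {s : ℝ} (h : 0 ≤ s) (p q : Idx d) : 1 ≤ wt s p q := by
  rw [wt, ← ENNReal.ofReal_one]
  exact ENNReal.ofReal_le_ofReal (Real.one_le_rpow (one_le_idxDist p q) h)

theorem wt_mul (s t : ℝ) (p q : Idx d) : wt s p q * wt t p q = wt (s + t) p q := by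
  rw [wt, wt, wt, Real.rpow_add (idxDist_pos p q), ENNReal.ofReal_mul
    (Real.rpow_nonneg (idxDist_pos p q).le _)]

@[simp] theorem wt_zero (p q : Idx d) : wt 0 p q = 1 := by simp [wt]

theorem rpow_add_le_two_rpow {s x y : ℝ} (hs : 0 ≤ s) (hx : 0 ≤ x) (hy : 0 ≤ y) :
    (x + y) ^ s ≤ 2 ^ s * (x ^ s + y ^ s) := by
  have h : x + y ≤ 2 * max x y := by
    have := le_max_left x y; have := le_max_right x y; linarith
  calc (x + y) ^ s ≤ (2 * max x y) ^ s := Real.rpow_le_rpow (by positivity) h hs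
    _ = 2 ^ s * (max x y) ^ s := Real.mul_rpow (by norm_num) (le_max_of_le_left hx)
    _ ≤ _ := by
      gcongr
      rcases max_choice x y with h | h <;> rw [h]
      · have := Real.rpow_nonneg hy s; linarith
      · have := Real.rpow_nonneg hx s; linarith

theorem wt_triangle {s : ℝ} (hs : 0 ≤ s) (p r q : Idx d) :
    wt s p q ≤ ENNReal.ofReal (2 ^ s) * (wt s p r + wt s r q) := by
  rw [wt, wt, wt, ← ENNReal.ofReal_add (Real.rpow_nonneg (idxDist_pos _ _).le _)
    (Real.rpow_nonneg (idxDist_pos _ _).le _), ← ENNReal.ofReal_mul (by positivity)]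
  refine ENNReal.ofReal_le_ofReal (le_trans ?_ (rpow_add_le_two_rpow hs (idxDist_pos p r).le
    (idxDist_pos r q).le))
  exact Real.rpow_le_rpow (idxDist_pos _ _).le (idxDist_triangle p r q) hs

/-! ### Summability of the inverse weights -/

theorem tsum_pi_prod (g : ℤ → ℝ≥0∞) (d : ℕ) :
    ∑' l : Fin d → ℤ, ∏ i, g (l i) = (∑' n, g n) ^ d := by
  induction d with
  | zero => simp
  | succ d ih =>
    rw [← (Fin.consEquiv fun _ : Fin (d + 1) => ℤ).tsum_eq, ENNReal.tsum_prod', pow_succ', ← ih,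
      ← ENNReal.tsum_mul_right]
    refine tsum_congr fun n => ?_
    rw [← ENNReal.tsum_mul_left]
    refine tsum_congr fun l => ?_
    simp [Fin.consEquiv, Fin.prod_univ_succ]

theorem tsum_jap_rpow_lt_top {ρ : ℝ} (hρ : 1 < ρ) :
    ∑' n : ℤ, ENNReal.ofReal (jap (n : ℝ) ^ (-ρ)) < ⊤ := by
  have h1 := Real.summable_abs_int_rpow hρ
  have h2 : Summable fun n : ℤ => if n = 0 then (1 : ℝ) else 0 :=
    summable_of_hasFiniteSupport (Set.Finite.subset (Set.finite_singleton 0) fun n hn => by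
      by_contra h; simp_all)
  have h3 : Summable fun n : ℤ => jap (n : ℝ) ^ (-ρ) := by
    refine Summable.of_nonneg_of_le (fun n => Real.rpow_nonneg (zero_le_one.trans (one_le_jap _)) _)
      (fun n => ?_) (h1.add h2)
    by_cases hn : n = 0
    · subst hn
      simp [jap, Real.zero_rpow (by linarith : -ρ ≠ 0)]
    · have : (1 : ℝ) ≤ |(n : ℝ)| := by exact_mod_cast Int.one_le_abs hn
      simp [hn, jap, this]
  exact h3.tsum_ofReal_lt_top

/-- The joint bracket dominates each of the `d + 1` one-dimensional ones, so a negative power of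
order `ρ (d + 1)` splits into `d + 1` factors of order `ρ`, each summable when `ρ > 1`. -/
theorem japPair_rpow_le {ρ : ℝ} (hρ : 0 ≤ ρ) (l : Fin d → ℤ) (x : ℝ) :
    ENNReal.ofReal (japPair l x ^ (-(ρ * (d + 1)))) ≤
      (∏ i, ENNReal.ofReal (jap (l i : ℝ) ^ (-ρ))) * ENNReal.ofReal (jap x ^ (-ρ)) := by
  have h0 : 0 < japPair l x := zero_lt_one.trans_le (one_le_japPair l x)
  rw [← ENNReal.ofReal_prod_of_nonneg fun i _ =>
    Real.rpow_nonneg (zero_le_one.trans (one_le_jap _)) _,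
    ← ENNReal.ofReal_mul (Finset.prod_nonneg fun i _ =>
    Real.rpow_nonneg (zero_le_one.trans (one_le_jap _)) _)]
  apply ENNReal.ofReal_le_ofReal
  have h1 : ∏ _i : Fin d, japPair l x ^ (-ρ) ≤ ∏ i, jap (l i : ℝ) ^ (-ρ) :=
    Finset.prod_le_prod (fun i _ => Real.rpow_nonneg h0.le _) fun i _ =>
      Real.rpow_le_rpow_of_nonpos (zero_lt_one.trans_le (one_le_jap _))
        (jap_le_japPair' l x i) (by linarith)
  have h2 : japPair l x ^ (-ρ) ≤ jap x ^ (-ρ) :=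
    Real.rpow_le_rpow_of_nonpos (zero_lt_one.trans_le (one_le_jap _)) (jap_le_japPair l x)
      (by linarith)
  have h3 : japPair l x ^ (-(ρ * (d + 1))) =
      (∏ _i : Fin d, japPair l x ^ (-ρ)) * japPair l x ^ (-ρ) := by
    rw [Finset.prod_const, Finset.card_univ, Fintype.card_fin, ← pow_succ, ← Real.rpow_natCast,
      ← Real.rpow_mul h0.le]
    congr 1; push_cast; ring
  rw [h3]
  exact mul_le_mul h1 h2 (Real.rpow_nonneg h0.le _) (Finset.prod_nonneg fun i _ =>
    Real.rpow_nonneg (zero_le_one.trans (one_le_jap _)) _)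

/-- The factor 4 counts two signs and two copies of `ℤ`. The shift is an integer so that it can be
absorbed by translation. -/
theorem tsum_mag_le (g : ℝ → ℝ≥0∞) (α : ℤ) :
    ∑' x : ℤ ⊕ ℤ, g (mag x - α) ≤ 4 * ∑' n : ℤ, g n := by
  have h1 : ∑' n : ℤ, g (|(n : ℝ)| - α) ≤ 2 * ∑' n : ℤ, g n := by
    have h2 : ∑' n : ℤ, g ((n : ℝ) - α) = ∑' n : ℤ, g n := by
      rw [← (Equiv.subRight α).tsum_eq (fun n : ℤ => g n)]
      simp
    have h3 : ∑' n : ℤ, g (-(n : ℝ) - α) = ∑' n : ℤ, g n := by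
      rw [← ((Equiv.neg ℤ).trans (Equiv.subRight α)).tsum_eq (fun n : ℤ => g n)]
      simp
    calc ∑' n : ℤ, g (|(n : ℝ)| - α) ≤ ∑' n : ℤ, (g ((n : ℝ) - α) + g (-(n : ℝ) - α)) := by
          refine ENNReal.tsum_le_tsum fun n => ?_
          rcases abs_choice (n : ℝ) with h | h <;> rw [h]
          · exact le_self_add
          · exact le_add_self
      _ = _ := by rw [ENNReal.tsum_add, h2, h3, two_mul]
  rw [ENNReal.summable.tsum_sum ENNReal.summable]
  calc _ ≤ 2 * ∑' n : ℤ, g n + 2 * ∑' n : ℤ, g n := add_le_add h1 h1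
    _ = _ := by ring

theorem mag_eq_intCast (x : ℤ ⊕ ℤ) : ∃ α : ℤ, mag x = α := by
  rcases x with x | x <;> exact ⟨|x|, by simp [mag]⟩

/-- Square summability of a bracket of order `-s₀` in `d + 1` variables needs `2 s₀ > d + 1`; the
integer part leaves room for one more unit. -/
theorem two_sZero (d : ℕ) : (d : ℝ) + 2 ≤ 2 * sZero d := by
  unfold sZero
  have : d + 2 ≤ 2 * ((d + 1) / 2 + 1) := by omega
  exact_mod_cast this

theorem sZero_pos (d : ℕ) : 0 < sZero d := by
  unfold sZero; positivity

/-- A bound for the `ℓ²` norm of the inverse weights of order `sZero d`. -/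
theorem exists_ell2_wt_le (d : ℕ) :
    ∃ ζ : ℝ, 1 ≤ ζ ∧ ∀ p : Idx d, ell2 (fun r => wt (-sZero d) p r) ≤ ENNReal.ofReal ζ := by
  -- After squaring, the total exponent `2 s₀` is shared equally by the `d + 1` one-dimensional
  -- brackets.
  set ρ : ℝ := 2 * sZero d / (d + 1) with hρdef
  have hd : (0 : ℝ) < d + 1 := by positivity
  have hρ : 1 < ρ := by
    rw [hρdef, lt_div_iff₀ hd]; have := two_sZero d; linarith
  set Z : ℝ≥0∞ := (∑' n : ℤ, ENNReal.ofReal (jap (n : ℝ) ^ (-ρ))) with hZ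
  have hZt : Z < ⊤ := tsum_jap_rpow_lt_top hρ
  have key : ∀ p : Idx d, ell2 (fun r => wt (-sZero d) p r) ^ 2 ≤ Z ^ d * (4 * Z) := by
    intro p
    rw [ell2_sq]
    obtain ⟨α, hα⟩ := mag_eq_intCast p.2
    calc ∑' r, wt (-sZero d) p r ^ 2
        ≤ ∑' r : Idx d, (∏ i, ENNReal.ofReal (jap ((r.1 - p.1) i : ℝ) ^ (-ρ))) *
          ENNReal.ofReal (jap (mag r.2 - α) ^ (-ρ)) := by
          refine ENNReal.tsum_le_tsum fun r => ?_
          rw [wt_comm, sq, wt_mul, wt, idxDist, hα]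
          have := japPair_rpow_le (by linarith : 0 ≤ ρ) (r.1 - p.1) (mag r.2 - α)
          have e : -(ρ * (d + 1)) = -sZero d + -sZero d := by
            rw [hρdef]; field_simp; ring
          rw [e] at this
          simpa using this
      _ = (∑' l : Fin d → ℤ, ∏ i, ENNReal.ofReal (jap (l i : ℝ) ^ (-ρ))) *
          ∑' x : ℤ ⊕ ℤ, ENNReal.ofReal (jap (mag x - α) ^ (-ρ)) := by
          rw [ENNReal.tsum_prod', ← (Equiv.subRight p.1).tsum_eq
            (fun l : Fin d → ℤ => ∏ i, ENNReal.ofReal (jap (l i : ℝ) ^ (-ρ))),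
            ← ENNReal.tsum_mul_right]
          refine tsum_congr fun l => ?_
          simp only [ENNReal.tsum_mul_left, Equiv.subRight_apply]
      _ ≤ _ := by
          rw [tsum_pi_prod (fun n => ENNReal.ofReal (jap (n : ℝ) ^ (-ρ)))]
          gcongr
          exact tsum_mag_le (fun x => ENNReal.ofReal (jap x ^ (-ρ))) α
  have hfin : (Z ^ d * (4 * Z)) ≠ ⊤ :=
    ENNReal.mul_ne_top (ENNReal.pow_ne_top hZt.ne) (ENNReal.mul_ne_top (by norm_num) hZt.ne)
  refine ⟨1 + ((Z ^ d * (4 * Z)) ^ (1 / 2 : ℝ)).toReal, by simp, fun p => ?_⟩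
  have h1 : ell2 (fun r => wt (-sZero d) p r) ≤ (Z ^ d * (4 * Z)) ^ (1 / 2 : ℝ) := by
    apply ennreal_le_of_sq_le
    rw [ennreal_rpow_half_sq]; exact key p
  refine h1.trans ?_
  rw [ENNReal.ofReal_add zero_le_one ENNReal.toReal_nonneg, ENNReal.ofReal_toReal
    (ENNReal.rpow_ne_top_of_nonneg (by norm_num) hfin)]
  exact le_add_self

end weights

/-! ### Weighted column norms of infinite matrices -/

section colNorm
variable {d : ℕ}

/-- The decay norm `sup_q ‖⟨p - q⟩^s a p q‖_{ℓ²(p)}` of an infinite matrix. -/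
noncomputable def colNorm (s : ℝ) (a : Idx d → Idx d → ℂ) : ℝ≥0∞ :=
  ⨆ q, ell2 fun p => wt s p q * ‖a p q‖ₑ

theorem le_colNorm (s : ℝ) (a : Idx d → Idx d → ℂ) (q : Idx d) :
    ell2 (fun p => wt s p q * ‖a p q‖ₑ) ≤ colNorm s a :=
  le_iSup (fun q => ell2 fun p => wt s p q * ‖a p q‖ₑ) q

theorem enorm_le_colNorm {s : ℝ} (hs : 0 ≤ s) (a : Idx d → Idx d → ℂ) (p q : Idx d) :
    ‖a p q‖ₑ ≤ colNorm s a :=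
  calc ‖a p q‖ₑ ≤ wt s p q * ‖a p q‖ₑ := le_mul_of_one_le_left' (one_le_wt hs p q)
    _ ≤ _ := (le_ell2 (fun p => wt s p q * ‖a p q‖ₑ) p).trans (le_colNorm s a q)

theorem colNorm_mono {s t : ℝ} (h : s ≤ t) (a : Idx d → Idx d → ℂ) :
    colNorm s a ≤ colNorm t a :=
  iSup_mono fun q => ell2_mono fun p => by gcongr; exact wt_mono h p q

theorem colNorm_le_of_enorm_le {s : ℝ} {a b : Idx d → Idx d → ℂ} (h : ∀ p q, ‖a p q‖ₑ ≤ ‖b p q‖ₑ) :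
    colNorm s a ≤ colNorm s b :=
  iSup_mono fun q => ell2_mono fun p => by gcongr; exact h p q

theorem colNorm_add_le (s : ℝ) (a b : Idx d → Idx d → ℂ) :
    colNorm s (a + b) ≤ colNorm s a + colNorm s b :=
  iSup_le fun q => (ell2_enorm_add_le (fun p => wt s p q) (fun p => a p q) fun p => b p q).trans
    (add_le_add (le_colNorm s a q) (le_colNorm s b q))

theorem colNorm_smul (s : ℝ) (c : ℂ) (a : Idx d → Idx d → ℂ) :
    colNorm s (c • a) = ‖c‖ₑ * colNorm s a := by
  rw [colNorm, colNorm, ENNReal.mul_iSup]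
  congr 1; ext q
  rw [← ell2_const_mul]
  congr 1; ext p
  simp only [Pi.smul_apply, smul_eq_mul, enorm_mul]; ring

/-- The tame product estimate. -/
theorem colNorm_mul_le {ζ : ℝ≥0∞} (hζ : ∀ p : Idx d, ell2 (fun r => wt (-sZero d) p r) ≤ ζ)
    {s t : ℝ} (hs : 0 ≤ s) (ht : sZero d ≤ t) {a b c : Idx d → Idx d → ℂ}
    (hc : ∀ p q, ‖c p q‖ₑ ≤ ∑' r, ‖a p r‖ₑ * ‖b r q‖ₑ) :
    colNorm s c ≤ ENNReal.ofReal (2 ^ s) * ζ *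
      (colNorm s a * colNorm t b + colNorm t a * colNorm s b) := by
  have hw : ∀ p q : Idx d, wt t p q * wt (-sZero d) p q ≥ 1 := fun p q => by
    rw [wt_mul]; exact one_le_wt (by linarith) p q
  refine iSup_le fun q => ?_
  -- The triangle inequality puts the weight of order `s` on one of the two factors. The other
  -- factor receives the weight of order `t ≥ s₀`, paid for by a weight of order `-s₀` on the same
  -- pair of indices; the latter is the square-summable kernel for `ell2_kernel_le`, at `q` in the
  -- first sum and at `p` in the second.
  have h1 : ∀ p, wt s p q * ‖c p q‖ₑ ≤ ENNReal.ofReal (2 ^ s) *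
      ((∑' r, (wt s p r * ‖a p r‖ₑ * (wt t r q * ‖b r q‖ₑ)) * wt (-sZero d) q r) +
       ∑' r, (wt t p r * ‖a p r‖ₑ * (wt s r q * ‖b r q‖ₑ)) * wt (-sZero d) p r) := by
    intro p
    rw [← ENNReal.tsum_add, ← ENNReal.tsum_mul_left]
    refine le_trans (mul_le_mul_right (hc p q) _) ?_
    rw [← ENNReal.tsum_mul_left]
    refine ENNReal.tsum_le_tsum fun r => ?_
    calc wt s p q * (‖a p r‖ₑ * ‖b r q‖ₑ)
        ≤ ENNReal.ofReal (2 ^ s) * (wt s p r + wt s r q) * (‖a p r‖ₑ * ‖b r q‖ₑ) := by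
          gcongr; exact wt_triangle hs p r q
      _ = ENNReal.ofReal (2 ^ s) * (wt s p r * ‖a p r‖ₑ * ‖b r q‖ₑ * 1 +
            ‖a p r‖ₑ * (wt s r q * ‖b r q‖ₑ) * 1) := by ring
      _ ≤ ENNReal.ofReal (2 ^ s) * (wt s p r * ‖a p r‖ₑ * ‖b r q‖ₑ *
            (wt t r q * wt (-sZero d) r q) +
            ‖a p r‖ₑ * (wt s r q * ‖b r q‖ₑ) * (wt t p r * wt (-sZero d) p r)) := by
          gcongr <;> exact hw _ _
      _ = _ := by rw [wt_comm (-sZero d) r q]; ring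
  refine (ell2_mono h1).trans ?_
  rw [ell2_const_mul, mul_assoc]
  gcongr
  refine (ell2_add_le _ _).trans ?_
  rw [mul_add]
  have hroot : ∀ x y : ℝ≥0∞, (x ^ 2 * y ^ 2) ^ (1 / 2 : ℝ) = x * y := fun x y => by
    rw [← mul_pow, ennreal_sq_rpow_half]
  have bound : ∀ s₁ s₂ : ℝ, (∑' r, ∑' p, (wt s₁ p r * ‖a p r‖ₑ * (wt s₂ r q * ‖b r q‖ₑ)) ^ 2) ^
      (1 / 2 : ℝ) ≤ colNorm s₁ a * colNorm s₂ b := by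
    intro s₁ s₂
    rw [← hroot]
    refine ENNReal.rpow_le_rpow ?_ (by norm_num)
    calc _ = ∑' r, ell2 (fun p => wt s₁ p r * ‖a p r‖ₑ) ^ 2 * (wt s₂ r q * ‖b r q‖ₑ) ^ 2 := by
          refine tsum_congr fun r => ?_
          rw [ell2_sq, ← ENNReal.tsum_mul_right]
          exact tsum_congr fun p => by ring
      _ ≤ ∑' r, colNorm s₁ a ^ 2 * (wt s₂ r q * ‖b r q‖ₑ) ^ 2 := by
          gcongr with r; exact le_colNorm s₁ a r
      _ = colNorm s₁ a ^ 2 * ell2 (fun r => wt s₂ r q * ‖b r q‖ₑ) ^ 2 := by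
          rw [ell2_sq, ENNReal.tsum_mul_left]
      _ ≤ _ := by gcongr; exact le_colNorm s₂ b q
  refine add_le_add ?_ ?_
  · refine (ell2_kernel_le _ _ ζ fun p => hζ q).trans ?_
    gcongr; exact bound s t
  · refine (ell2_kernel_le _ _ ζ fun p => hζ p).trans ?_
    gcongr; exact bound t s

end colNorm

end WaveKAM

namespace WaveKAM

/-! ### Bounded operators on `ℓ²` and their matrices -/

section lp2
variable {J : Type*}

abbrev Lp2 (J : Type*) : Type _ := lp (fun _ : J => ℂ) 2

theorem tsum_enorm_sq (f : J → ℂ) :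
    ∑' i, ‖f i‖ₑ ^ 2 = ∑' i, ENNReal.ofReal (‖f i‖ ^ (2 : ℝ≥0∞).toReal) := by
  refine tsum_congr fun i => ?_
  rw [← ofReal_norm, ← ENNReal.ofReal_pow (norm_nonneg _)]
  norm_num

theorem memLp2_of_ell2 {f : J → ℂ} (h : ell2 (fun i => ‖f i‖ₑ) < ⊤) :
    Memℓp f 2 := by
  apply memℓp_gen
  have h1 : ∑' i, ‖f i‖ₑ ^ 2 < ⊤ := by rw [← ell2_sq]; exact ENNReal.pow_lt_top h
  rw [tsum_enorm_sq] at h1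
  have := ENNReal.summable_toReal h1.ne
  refine this.congr fun i => ?_
  rw [ENNReal.toReal_ofReal (by positivity)]

theorem enorm_eq_ell2 (f : Lp2 J) : ‖f‖ₑ = ell2 (fun i => ‖f i‖ₑ) := by
  have h := lp.hasSum_norm (p := 2) (by norm_num) f
  rw [ell2, tsum_enorm_sq, ← ENNReal.ofReal_tsum_of_nonneg (fun i => by positivity) h.summable,
    h.tsum_eq, ← ofReal_norm, ENNReal.ofReal_rpow_of_nonneg (by positivity) (by norm_num)]
  congr 1
  rw [← Real.rpow_mul (norm_nonneg _)]; norm_num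

/-- An operator with a given kernel. -/
theorem exists_clm_of_kernel (a : J → J → ℂ) (C : ℝ≥0∞) (hC : C < ⊤)
    (h : ∀ f : J → ℝ≥0∞, ell2 (fun p => ∑' q, ‖a p q‖ₑ * f q) ≤ C * ell2 f) :
    ∃ T : Lp2 J →L[ℂ] Lp2 J, ∀ f p, HasSum (fun q => a p q * f q) (T f p) := by
  have hfin : ∀ f : Lp2 J, ell2 (fun p => ∑' q, ‖a p q‖ₑ * ‖f q‖ₑ) ≤ C * ‖f‖ₑ := fun f => by
    rw [enorm_eq_ell2]; exact h _
  have hfin' : ∀ f : Lp2 J, ell2 (fun p => ∑' q, ‖a p q‖ₑ * ‖f q‖ₑ) < ⊤ := fun f =>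
    (hfin f).trans_lt (ENNReal.mul_lt_top hC enorm_lt_top)
  have hs : ∀ (f : Lp2 J) p, Summable fun q => a p q * f q := fun f p => by
    refine Summable.of_norm ?_
    have h1 : ∑' q, ‖a p q * f q‖ₑ < ⊤ := by
      simp only [enorm_mul]
      exact (le_ell2 (fun p => ∑' q, ‖a p q‖ₑ * ‖f q‖ₑ) p).trans_lt (hfin' f)
    exact (ENNReal.summable_toReal h1.ne).congr fun q => by simp
  have hb : ∀ f : Lp2 J, ell2 (fun p => ‖∑' q, a p q * f q‖ₑ) ≤
      ell2 (fun p => ∑' q, ‖a p q‖ₑ * ‖f q‖ₑ) := fun f => ell2_mono fun p => by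
    refine enorm_tsum_le_tsum_enorm.trans (le_of_eq ?_)
    simp only [enorm_mul]
  let L : Lp2 J →ₗ[ℂ] Lp2 J :=
    { toFun := fun f => ⟨fun p => ∑' q, a p q * f q, memLp2_of_ell2 ((hb f).trans_lt (hfin' f))⟩
      map_add' := fun f g => by
        ext p
        change ∑' q, a p q * (f + g) q = ∑' q, a p q * f q + ∑' q, a p q * g q
        rw [← (hs f p).tsum_add (hs g p)]
        exact tsum_congr fun q => by simp [mul_add]
      map_smul' := fun c f => by
        ext p
        change ∑' q, a p q * (c • f) q = c * ∑' q, a p q * f q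
        rw [← tsum_mul_left]
        exact tsum_congr fun q => by simp; ring }
  refine ⟨L.mkContinuous C.toReal fun f => ?_, fun f p => (hs f p).hasSum⟩
  have h1 : ‖L f‖ₑ ≤ C * ‖f‖ₑ := by
    rw [enorm_eq_ell2]; exact (hb f).trans (hfin f)
  rw [← toReal_enorm, ← toReal_enorm, ← ENNReal.toReal_mul]
  exact ENNReal.toReal_mono (ENNReal.mul_lt_top hC enorm_lt_top).ne h1

noncomputable def evalCLM (p : J) : Lp2 J →L[ℂ] ℂ := lp.evalCLM ℂ (fun _ : J => ℂ) 2 p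

@[simp] theorem evalCLM_apply (p : J) (f : Lp2 J) : evalCLM p f = f p := rfl

variable [DecidableEq J]

/-- The matrix entries of a bounded operator. -/
noncomputable def ent (T : Lp2 J →L[ℂ] Lp2 J) (p q : J) : ℂ := T (lp.single 2 q 1) p

noncomputable def entCLM (p q : J) : (Lp2 J →L[ℂ] Lp2 J) →L[ℂ] ℂ :=
  (evalCLM p).comp (ContinuousLinearMap.apply ℂ (Lp2 J) (lp.single 2 q (1 : ℂ)))

@[simp] theorem entCLM_apply (p q : J) (T : Lp2 J →L[ℂ] Lp2 J) : entCLM p q T = ent T p q := rfl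

theorem ent_add (T S : Lp2 J →L[ℂ] Lp2 J) : ent (T + S) = ent T + ent S := rfl
theorem ent_sub (T S : Lp2 J →L[ℂ] Lp2 J) : ent (T - S) = ent T - ent S := rfl
theorem ent_neg (T : Lp2 J →L[ℂ] Lp2 J) : ent (-T) = -ent T := rfl
theorem ent_zero : ent (0 : Lp2 J →L[ℂ] Lp2 J) = 0 := rfl
theorem ent_smul (c : ℂ) (T : Lp2 J →L[ℂ] Lp2 J) : ent (c • T) = c • ent T := rfl

theorem continuous_ent (p q : J) : Continuous fun T : Lp2 J →L[ℂ] Lp2 J => ent T p q :=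
  (entCLM p q).continuous

theorem hasSum_single_expansion (f : Lp2 J) :
    HasSum (fun q => f q • (lp.single 2 q (1 : ℂ) : Lp2 J)) f := by
  refine (lp.hasSum_single (p := 2) (by norm_num) f).congr_fun fun q => ?_
  rw [← lp.single_smul]; simp

theorem hasSum_ent_mul (T : Lp2 J →L[ℂ] Lp2 J) (f : Lp2 J) (p : J) :
    HasSum (fun q => ent T p q * f q) (T f p) := by
  have h := (hasSum_single_expansion f).mapL ((evalCLM p).comp T)
  refine h.congr_fun fun q => ?_
  simp [ent, mul_comm]

theorem hasSum_ent_comp (T S : Lp2 J →L[ℂ] Lp2 J) (p q : J) :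
    HasSum (fun r => ent T p r * ent S r q) (ent (T * S) p q) :=
  hasSum_ent_mul T _ p

theorem ent_one (p q : J) : ent (1 : Lp2 J →L[ℂ] Lp2 J) p q = if p = q then 1 else 0 := by
  by_cases h : p = q
  · subst h; simp [ent]
  · simp [ent, h]

theorem enorm_ent_comp_le (T S : Lp2 J →L[ℂ] Lp2 J) (p q : J) :
    ‖ent (T * S) p q‖ₑ ≤ ∑' r, ‖ent T p r‖ₑ * ‖ent S r q‖ₑ := by
  rw [← (hasSum_ent_comp T S p q).tsum_eq]
  refine enorm_tsum_le_tsum_enorm.trans (le_of_eq ?_)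
  simp only [enorm_mul]

end lp2

/-! ### Arrays as bounded operators -/

section toeplitz
variable {d : ℕ}

abbrev BOp (d : ℕ) : Type := Lp2 (Idx d) →L[ℂ] Lp2 (Idx d)

theorem isClosed_colNorm_le (s : ℝ) (c : ℝ≥0∞) : IsClosed {T : BOp d | colNorm s (ent T) ≤ c} := by
  simp only [colNorm, iSup_le_iff, Set.ofPred_forall]
  refine isClosed_iInter fun q => isClosed_ell2_le _ (fun p => ?_) c
  exact (ENNReal.continuous_const_mul (wt_ne_top s p q)).comp (continuous_ent p q).enorm

/-- Cauchy–Schwarz against the square-summable weight of order `-s₀` shows that `s₀` orders of decay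
in the columns suffice for boundedness on `ℓ²`. -/
theorem exists_op_of_colNorm {a : Idx d → Idx d → ℂ} (h : colNorm (sZero d) a < ⊤) :
    ∃ T : BOp d, ent T = a := by
  obtain ⟨ζ, -, hζ⟩ := exists_ell2_wt_le d
  obtain ⟨T, hT⟩ := exists_clm_of_kernel a (ENNReal.ofReal ζ * colNorm (sZero d) a)
    (ENNReal.mul_lt_top ENNReal.ofReal_lt_top h) fun f => by
      have h1 : ∀ p, ∑' q, ‖a p q‖ₑ * f q =
          ∑' q, (wt (sZero d) p q * ‖a p q‖ₑ * f q) * wt (-sZero d) p q := fun p =>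
        tsum_congr fun q => by
          calc ‖a p q‖ₑ * f q = (wt (sZero d) p q * wt (-sZero d) p q) * (‖a p q‖ₑ * f q) := by
                rw [wt_mul]; simp
            _ = _ := by ring
      simp only [h1]
      refine (ell2_kernel_le _ _ _ hζ).trans ?_
      rw [mul_assoc]
      gcongr
      rw [← ennreal_sq_rpow_half (colNorm (sZero d) a * ell2 f)]
      refine ENNReal.rpow_le_rpow ?_ (by norm_num)
      rw [mul_pow, ell2_sq, ← ENNReal.tsum_mul_left]
      refine ENNReal.tsum_le_tsum fun q => ?_
      calc ∑' p, (wt (sZero d) p q * ‖a p q‖ₑ * f q) ^ 2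
          = ell2 (fun p => wt (sZero d) p q * ‖a p q‖ₑ) ^ 2 * f q ^ 2 := by
            rw [ell2_sq, ← ENNReal.tsum_mul_right]
            exact tsum_congr fun p => by ring
        _ ≤ _ := by gcongr; exact le_colNorm _ a q
  refine ⟨T, ?_⟩
  ext p q
  have h1 := hT (lp.single 2 q 1) p
  have h2 := hasSum_single (f := fun r => a p r * (lp.single 2 q (1 : ℂ) : Lp2 (Idx d)) r) q
    (fun r hr => by simp [Pi.single_eq_of_ne hr])
  rw [ent, h1.unique h2]; simp

/-- The block Toeplitz matrix of an array. -/
def toep (A : OpArr d (ℤ ⊕ ℤ)) (p q : Idx d) : ℂ := A (p.1 - q.1) p.2 q.2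

theorem toep_add (A B : OpArr d (ℤ ⊕ ℤ)) : toep (A + B) = toep A + toep B := rfl
theorem toep_sub (A B : OpArr d (ℤ ⊕ ℤ)) : toep (A - B) = toep A - toep B := rfl
theorem toep_neg (A : OpArr d (ℤ ⊕ ℤ)) : toep (-A) = -toep A := rfl
theorem toep_smul (c : ℂ) (A : OpArr d (ℤ ⊕ ℤ)) : toep (c • A) = c • toep A := rfl
theorem toep_zero : toep (0 : OpArr d (ℤ ⊕ ℤ)) = 0 := rfl

theorem toep_injective : Function.Injective (toep (d := d)) := by
  intro A B h
  ext l k j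
  simpa [toep] using congrFun (congrFun h (l, k)) (0, j)

/-- `T` is the operator on `ℓ²` given by the array `A`. -/
def IsOpOf (T : BOp d) (A : OpArr d (ℤ ⊕ ℤ)) : Prop := ent T = toep A

theorem IsOpOf.add {T S : BOp d} {A B : OpArr d (ℤ ⊕ ℤ)} (hT : IsOpOf T A) (hS : IsOpOf S B) :
    IsOpOf (T + S) (A + B) := by
  rw [IsOpOf, ent_add, toep_add, hT, hS]

theorem IsOpOf.sub {T S : BOp d} {A B : OpArr d (ℤ ⊕ ℤ)} (hT : IsOpOf T A) (hS : IsOpOf S B) :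
    IsOpOf (T - S) (A - B) := by
  rw [IsOpOf, ent_sub, toep_sub, hT, hS]

theorem IsOpOf.smul {T : BOp d} {A : OpArr d (ℤ ⊕ ℤ)} (c : ℂ) (hT : IsOpOf T A) :
    IsOpOf (c • T) (c • A) := by
  rw [IsOpOf, ent_smul, toep_smul, hT]

theorem IsOpOf.neg {T : BOp d} {A : OpArr d (ℤ ⊕ ℤ)} (hT : IsOpOf T A) : IsOpOf (-T) (-A) := by
  rw [IsOpOf, ent_neg, toep_neg, hT]

theorem IsOpOf.apply {T : BOp d} {A : OpArr d (ℤ ⊕ ℤ)} (hT : IsOpOf T A) (p q : Idx d) :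
    ent T p q = A (p.1 - q.1) p.2 q.2 := congrFun (congrFun hT p) q

/-- Translating the summation variable by the Fourier index of `q` turns the convolution into a
matrix product. No convergence is needed, so this also applies to unbounded block diagonal arrays.
-/
theorem toep_arrMul (A B : OpArr d (ℤ ⊕ ℤ)) (p q : Idx d) :
    toep (arrMul A B) p q = ∑' r, toep A p r * toep B r q := by
  rw [← ((Equiv.addRight q.1).prodCongr (Equiv.refl (ℤ ⊕ ℤ))).tsum_eq]
  simp only [toep, arrMul, Matrix.of_apply]
  refine tsum_congr fun r => ?_
  simp [sub_sub, add_comm]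

theorem IsOpOf.mul {T S : BOp d} {A B : OpArr d (ℤ ⊕ ℤ)} (hT : IsOpOf T A) (hS : IsOpOf S B) :
    IsOpOf (T * S) (arrMul A B) := by
  ext p q
  rw [toep_arrMul, ← (hasSum_ent_comp T S p q).tsum_eq, hT, hS]

theorem isOpOf_one : IsOpOf (1 : BOp d) (arrOne d (ℤ ⊕ ℤ)) := by
  ext p q
  rw [ent_one, toep, arrOne]
  by_cases h : p.1 = q.1
  · simp [h, Matrix.one_apply, Prod.ext_iff]
  · simp [h, sub_eq_zero, Prod.ext_iff]

theorem IsOpOf.pow {T : BOp d} {A : OpArr d (ℤ ⊕ ℤ)} (hT : IsOpOf T A) (n : ℕ) :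
    IsOpOf (T ^ n) (arrPow A n) := by
  induction n with
  | zero => exact isOpOf_one
  | succ n ih => rw [pow_succ']; exact hT.mul ih

/-- Matrix entries are continuous functionals, so the norm-convergent exponential series gives the
entrywise series that defines `arrExp`. -/
theorem IsOpOf.exp {T : BOp d} {A : OpArr d (ℤ ⊕ ℤ)} (hT : IsOpOf T A) :
    IsOpOf (NormedSpace.exp T) (arrExp A) := by
  ext p q
  have h := (NormedSpace.exp_series_hasSum_exp' (𝕂 := ℂ) T).mapL (entCLM p q)
  rw [entCLM_apply] at h
  rw [← h.tsum_eq, toep, arrExp, Matrix.of_apply]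
  refine tsum_congr fun n => ?_
  rw [map_smul, entCLM_apply, (hT.pow n).apply, smul_eq_mul]

theorem exists_isOpOf {A : OpArr d (ℤ ⊕ ℤ)} (h : colNorm (sZero d) (toep A) < ⊤) :
    ∃ T : BOp d, IsOpOf T A := exists_op_of_colNorm h

end toeplitz

end WaveKAM

namespace WaveKAM

/-! ### Lipschitz norms -/

section lip
variable {d : ℕ} {E : Type*}

/-- The Lipschitz seminorm. -/
noncomputable def lipSemi [Sub E] (S : Set (EuclideanSpace ℝ (Fin d)))
    (N : E → ℝ≥0∞) (f : EuclideanSpace ℝ (Fin d) → E) : ℝ≥0∞ :=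
  ⨆ (ω₁ ∈ S) (ω₂ ∈ S) (_ : ω₁ ≠ ω₂), N (f ω₁ - f ω₂) / ENNReal.ofReal ‖ω₁ - ω₂‖

noncomputable def supSemi (S : Set (EuclideanSpace ℝ (Fin d)))
    (N : E → ℝ≥0∞) (f : EuclideanSpace ℝ (Fin d) → E) : ℝ≥0∞ := ⨆ ω ∈ S, N (f ω)

theorem lipNorm_eq [Sub E] (γ : ℝ) (S : Set (EuclideanSpace ℝ (Fin d))) (N : E → ℝ≥0∞)
    (f : EuclideanSpace ℝ (Fin d) → E) :
    lipNorm γ S N f = supSemi S N f + ENNReal.ofReal γ * lipSemi S N f := rfl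

variable {γ : ℝ} {S : Set (EuclideanSpace ℝ (Fin d))}

theorem le_supSemi {N : E → ℝ≥0∞} (f : EuclideanSpace ℝ (Fin d) → E) {ω} (h : ω ∈ S) :
    N (f ω) ≤ supSemi S N f := le_iSup₂ (f := fun ω (_ : ω ∈ S) => N (f ω)) ω h

theorem supSemi_le {N : E → ℝ≥0∞} {f : EuclideanSpace ℝ (Fin d) → E} {c : ℝ≥0∞}
    (h : ∀ ω ∈ S, N (f ω) ≤ c) : supSemi S N f ≤ c := iSup₂_le h

theorem ofReal_norm_sub_ne_zero {ω₁ ω₂ : EuclideanSpace ℝ (Fin d)} (h : ω₁ ≠ ω₂) :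
    ENNReal.ofReal ‖ω₁ - ω₂‖ ≠ 0 := by
  simpa [sub_eq_zero] using h

theorem lipSemi_le [Sub E] {N : E → ℝ≥0∞} {f : EuclideanSpace ℝ (Fin d) → E} {c : ℝ≥0∞}
    (h : ∀ ω₁ ∈ S, ∀ ω₂ ∈ S, ω₁ ≠ ω₂ → N (f ω₁ - f ω₂) ≤ c * ENNReal.ofReal ‖ω₁ - ω₂‖) :
    lipSemi S N f ≤ c :=
  iSup₂_le fun ω₁ h₁ => iSup₂_le fun ω₂ h₂ => iSup_le fun hne =>
    ENNReal.div_le_of_le_mul (h ω₁ h₁ ω₂ h₂ hne)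

theorem le_lipSemi [Sub E] {N : E → ℝ≥0∞} (f : EuclideanSpace ℝ (Fin d) → E) {ω₁ ω₂}
    (h₁ : ω₁ ∈ S) (h₂ : ω₂ ∈ S) (hne : ω₁ ≠ ω₂) :
    N (f ω₁ - f ω₂) ≤ lipSemi S N f * ENNReal.ofReal ‖ω₁ - ω₂‖ := by
  rw [← ENNReal.div_le_iff (ofReal_norm_sub_ne_zero hne) ENNReal.ofReal_ne_top]
  exact le_iSup₂_of_le ω₁ h₁ (le_iSup₂_of_le ω₂ h₂ (le_iSup_of_le hne le_rfl))

theorem supSemi_le_lipNorm [Sub E] {N : E → ℝ≥0∞} (f : EuclideanSpace ℝ (Fin d) → E) :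
    supSemi S N f ≤ lipNorm γ S N f := le_self_add

theorem le_lipNorm [Sub E] {N : E → ℝ≥0∞} (f : EuclideanSpace ℝ (Fin d) → E) {ω} (h : ω ∈ S) :
    N (f ω) ≤ lipNorm γ S N f := (le_supSemi f h).trans (supSemi_le_lipNorm f)

theorem lipSemi_le_lipNorm [Sub E] {N : E → ℝ≥0∞} (f : EuclideanSpace ℝ (Fin d) → E) :
    ENNReal.ofReal γ * lipSemi S N f ≤ lipNorm γ S N f := le_add_self

theorem lipNorm_mono_set [Sub E] {N : E → ℝ≥0∞} {f : EuclideanSpace ℝ (Fin d) → E}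
    {S' : Set (EuclideanSpace ℝ (Fin d))} (h : S ⊆ S') : lipNorm γ S N f ≤ lipNorm γ S' N f := by
  rw [lipNorm_eq, lipNorm_eq]
  gcongr
  · exact supSemi_le fun ω hω => le_supSemi f (h hω)
  · exact lipSemi_le fun ω₁ h₁ ω₂ h₂ hne => le_lipSemi f (h h₁) (h h₂) hne

/-- A pointwise linear domination passes to the Lipschitz norms. -/
theorem lipNorm_le_mul [Sub E] {F : Type*} [Sub F] {N : E → ℝ≥0∞} {M : F → ℝ≥0∞}
    {f : EuclideanSpace ℝ (Fin d) → E} {g : EuclideanSpace ℝ (Fin d) → F} {C : ℝ≥0∞}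
    (h₁ : ∀ ω ∈ S, N (f ω) ≤ C * M (g ω))
    (h₂ : ∀ ω₁ ∈ S, ∀ ω₂ ∈ S, N (f ω₁ - f ω₂) ≤ C * M (g ω₁ - g ω₂)) :
    lipNorm γ S N f ≤ C * lipNorm γ S M g := by
  rw [lipNorm_eq, lipNorm_eq, mul_add, mul_left_comm]
  gcongr
  · exact supSemi_le fun ω hω => (h₁ ω hω).trans (by gcongr; exact le_supSemi g hω)
  · refine lipSemi_le fun ω₁ hω₁ ω₂ hω₂ hne => (h₂ ω₁ hω₁ ω₂ hω₂).trans ?_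
    rw [mul_assoc]; gcongr; exact le_lipSemi g hω₁ hω₂ hne

end lip

/-! ### Extended norms on Banach algebras -/

/-- An extended seminorm with closed sublevel sets. -/
structure IsExtNorm {R : Type*} [NormedAddCommGroup R] [NormedSpace ℂ R] (N : R → ℝ≥0∞) :
    Prop where
  add_le : ∀ x y, N (x + y) ≤ N x + N y
  smul_le : ∀ (c : ℂ) x, N (c • x) ≤ ‖c‖ₑ * N x
  closed : ∀ c, IsClosed {x | N x ≤ c}

/-- A pair of extended norms with tame product estimates. -/
structure IsTame {R : Type*} [NormedRing R] [NormedAlgebra ℂ R] (K : ℝ≥0∞) (hi lo : R → ℝ≥0∞) :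
    Prop where
  hi_norm : IsExtNorm hi
  lo_norm : IsExtNorm lo
  hi_mul : ∀ x y, hi (x * y) ≤ K * (hi x * lo y + lo x * hi y)
  lo_mul : ∀ x y, lo (x * y) ≤ K * (lo x * lo y + lo x * lo y)

section extNorm
variable {d : ℕ} {R : Type*} [NormedAddCommGroup R] [NormedSpace ℂ R] {N : R → ℝ≥0∞}
  {γ : ℝ} {S : Set (EuclideanSpace ℝ (Fin d))}

theorem IsExtNorm.zero (hN : IsExtNorm N) : N 0 = 0 := by
  have := hN.smul_le 0 0
  simpa using this

theorem IsExtNorm.sum_le (hN : IsExtNorm N) {ι : Type*} (s : Finset ι) (x : ι → R) :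
    N (∑ i ∈ s, x i) ≤ ∑ i ∈ s, N (x i) := by
  classical
  induction s using Finset.induction_on with
  | empty => simp [hN.zero]
  | insert a s ha ih =>
    rw [Finset.sum_insert ha, Finset.sum_insert ha]
    exact (hN.add_le _ _).trans (by gcongr)

theorem IsExtNorm.hasSum_le (hN : IsExtNorm N) {x : ℕ → R} {y : R} (h : HasSum x y) :
    N y ≤ ∑' i, N (x i) :=
  (hN.closed _).mem_of_tendsto h.tendsto_sum_nat
    (Filter.Eventually.of_forall fun _ => (hN.sum_le _ _).trans (ENNReal.sum_le_tsum _))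

theorem IsExtNorm.convex (hN : IsExtNorm N) (c : ℝ≥0∞) : Convex ℝ {x | N x ≤ c} := by
  intro x hx y hy a b ha hb hab
  have e : ∀ (a : ℝ), 0 ≤ a → ∀ x, N (a • x) ≤ ENNReal.ofReal a * N x := fun a ha x => by
    have := hN.smul_le (a : ℂ) x
    rw [← ofReal_norm, Complex.norm_real, Real.norm_of_nonneg ha] at this
    simpa using this
  calc N (a • x + b • y) ≤ ENNReal.ofReal a * N x + ENNReal.ofReal b * N y :=
        (hN.add_le _ _).trans (add_le_add (e a ha x) (e b hb y))
    _ ≤ ENNReal.ofReal a * c + ENNReal.ofReal b * c := by gcongr <;> assumption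
    _ = c := by rw [← add_mul, ← ENNReal.ofReal_add ha hb, hab]; simp

/-- Sublevel sets are closed and convex, hence contain the mean of a continuous curve under the
probability measure on the unit interval. -/
theorem IsExtNorm.integral_le [CompleteSpace R] (hN : IsExtNorm N) {f : ℝ → R} {c : ℝ≥0∞}
    (hf : Continuous f) (h : ∀ t ∈ Set.Icc (0 : ℝ) 1, N (f t) ≤ c) :
    N (∫ t in (0 : ℝ)..1, f t) ≤ c := by
  rw [intervalIntegral.integral_of_le zero_le_one]
  have : MeasureTheory.IsProbabilityMeasure
      (MeasureTheory.volume.restrict (Set.Ioc (0 : ℝ) 1)) := ⟨by simp⟩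
  refine (hN.convex c).integral_mem (hN.closed c) ?_ ?_
  · refine MeasureTheory.ae_restrict_of_forall_mem measurableSet_Ioc fun t ht => ?_
    exact h t ⟨ht.1.le, ht.2⟩
  · exact (hf.integrableOn_Icc (a := 0) (b := 1)).mono_set Set.Ioc_subset_Icc_self

theorem lipNorm_add_le (hN : IsExtNorm N) (f g : EuclideanSpace ℝ (Fin d) → R) :
    lipNorm γ S N (fun ω => f ω + g ω) ≤ lipNorm γ S N f + lipNorm γ S N g := by
  simp only [lipNorm_eq]
  calc _ ≤ (supSemi S N f + supSemi S N g) +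
        ENNReal.ofReal γ * (lipSemi S N f + lipSemi S N g) := by
        gcongr
        · exact supSemi_le fun ω h => (hN.add_le _ _).trans
            (add_le_add (le_supSemi f h) (le_supSemi g h))
        · refine lipSemi_le fun ω₁ h₁ ω₂ h₂ hne => ?_
          rw [add_sub_add_comm, add_mul]
          exact (hN.add_le _ _).trans (add_le_add (le_lipSemi f h₁ h₂ hne) (le_lipSemi g h₁ h₂ hne))
    _ = _ := by ring

theorem lipNorm_smul_le (hN : IsExtNorm N) (c : ℂ) (f : EuclideanSpace ℝ (Fin d) → R) :
    lipNorm γ S N (fun ω => c • f ω) ≤ ‖c‖ₑ * lipNorm γ S N f :=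
  lipNorm_le_mul (fun ω _ => hN.smul_le _ _) fun ω₁ _ ω₂ _ => by
    rw [← smul_sub]; exact hN.smul_le _ _

theorem lipNorm_hasSum_le (hN : IsExtNorm N) {F : ℕ → EuclideanSpace ℝ (Fin d) → R}
    {f : EuclideanSpace ℝ (Fin d) → R} (h : ∀ ω ∈ S, HasSum (fun i => F i ω) (f ω)) :
    lipNorm γ S N f ≤ ∑' i, lipNorm γ S N (F i) := by
  simp only [lipNorm_eq]
  rw [ENNReal.tsum_add, ENNReal.tsum_mul_left]
  gcongr
  · exact supSemi_le fun ω hω => (hN.hasSum_le (h ω hω)).trans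
      (ENNReal.tsum_le_tsum fun i => le_supSemi (F i) hω)
  · refine lipSemi_le fun ω₁ h₁ ω₂ h₂ hne => (hN.hasSum_le ((h ω₁ h₁).sub (h ω₂ h₂))).trans ?_
    rw [← ENNReal.tsum_mul_right]
    exact ENNReal.tsum_le_tsum fun i => le_lipSemi (F i) h₁ h₂ hne

/-- The supremum and the weighted seminorm are each bounded by `c` separately, whence the factor 2.
-/
theorem lipNorm_integral_le [CompleteSpace R] (hN : IsExtNorm N)
    {F : ℝ → EuclideanSpace ℝ (Fin d) → R}
    {c : ℝ≥0∞} (hF : ∀ ω, Continuous fun t => F t ω)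
    (h : ∀ t ∈ Set.Icc (0 : ℝ) 1, lipNorm γ S N (F t) ≤ c) (hγ : 0 < γ) :
    lipNorm γ S N (fun ω => ∫ t in (0 : ℝ)..1, F t ω) ≤ 2 * c := by
  have hγ0 : ENNReal.ofReal γ ≠ 0 := by simpa using hγ
  rw [lipNorm_eq, two_mul]
  gcongr
  · exact supSemi_le fun ω hω => hN.integral_le (hF ω) fun t ht =>
      (le_lipNorm (F t) hω).trans (h t ht)
  · rw [mul_comm, ← ENNReal.le_div_iff_mul_le (Or.inl hγ0) (Or.inl ENNReal.ofReal_ne_top)]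
    refine lipSemi_le fun ω₁ h₁ ω₂ h₂ hne => ?_
    rw [← intervalIntegral.integral_sub ((hF ω₁).intervalIntegrable _ _)
      ((hF ω₂).intervalIntegrable _ _)]
    refine hN.integral_le ((hF ω₁).sub (hF ω₂)) fun t ht => ?_
    refine (le_lipSemi (F t) h₁ h₂ hne).trans ?_
    gcongr
    rw [ENNReal.le_div_iff_mul_le (Or.inl hγ0) (Or.inl ENNReal.ofReal_ne_top), mul_comm]
    exact (lipSemi_le_lipNorm (F t)).trans (h t ht)

end extNorm

/-! ### Tame calculus for Lipschitz families: products, powers, exponentials, conjugations -/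

section tame
variable {d : ℕ} {R : Type*} [NormedRing R] [NormedAlgebra ℂ R] {K : ℝ≥0∞} {hi lo : R → ℝ≥0∞}
  {γ : ℝ} {S : Set (EuclideanSpace ℝ (Fin d))}

theorem IsTame.low (h : IsTame K hi lo) : IsTame K lo lo := ⟨h.lo_norm, h.lo_norm, h.lo_mul, h.lo_mul⟩

theorem IsTame.lip_mul (h : IsTame K hi lo) (f g : EuclideanSpace ℝ (Fin d) → R) :
    lipNorm γ S hi (fun ω => f ω * g ω) ≤
      K * (lipNorm γ S hi f * lipNorm γ S lo g + lipNorm γ S lo f * lipNorm γ S hi g) := by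
  simp only [lipNorm_eq]
  set hf := supSemi S hi f
  set lf := supSemi S lo f
  set hg := supSemi S hi g
  set lg := supSemi S lo g
  set hf' := lipSemi S hi f
  set lf' := lipSemi S lo f
  set hg' := lipSemi S hi g
  set lg' := lipSemi S lo g
  calc _ ≤ K * (hf * lg + lf * hg) + ENNReal.ofReal γ *
        (K * (hf' * lg + lf' * hg) + K * (hf * lg' + lf * hg')) := by
        gcongr
        · refine supSemi_le fun ω hω => (h.hi_mul _ _).trans ?_
          gcongr <;> exact le_supSemi _ hω
        · refine lipSemi_le fun ω₁ h₁ ω₂ h₂ hne => ?_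
          have e : f ω₁ * g ω₁ - f ω₂ * g ω₂ = (f ω₁ - f ω₂) * g ω₁ + f ω₂ * (g ω₁ - g ω₂) := by
            noncomm_ring
          rw [e]
          refine (h.hi_norm.add_le _ _).trans ((add_le_add (h.hi_mul _ _) (h.hi_mul _ _)).trans ?_)
          calc _ ≤ K * (hf' * ENNReal.ofReal ‖ω₁ - ω₂‖ * lg + lf' * ENNReal.ofReal ‖ω₁ - ω₂‖ * hg) +
                K * (hf * (lg' * ENNReal.ofReal ‖ω₁ - ω₂‖) +
                  lf * (hg' * ENNReal.ofReal ‖ω₁ - ω₂‖)) := by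
                gcongr <;> first
                  | exact le_lipSemi _ h₁ h₂ hne | exact le_supSemi _ h₁ | exact le_supSemi _ h₂
            _ = _ := by ring
    -- The discarded terms, quadratic in the seminorms, complete the product of the two full
    -- Lipschitz norms.
    _ ≤ K * (hf * lg + lf * hg) + ENNReal.ofReal γ *
        (K * (hf' * lg + lf' * hg) + K * (hf * lg' + lf * hg')) +
        K * (ENNReal.ofReal γ * ENNReal.ofReal γ * (hf' * lg' + lf' * hg')) := le_self_add
    _ = _ := by ring

/-- Each extra factor costs `2 K lo ≤ 1/2` in the low norm. In the high norm the linear factor `n +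
1` counts the places where the high norm can fall. -/
theorem IsTame.lip_pow (h : IsTame K hi lo) {f : EuclideanSpace ℝ (Fin d) → R}
    (hf : 2 * K * lipNorm γ S lo f ≤ 2⁻¹) (n : ℕ) :
    lipNorm γ S lo (fun ω => f ω ^ (n + 1)) ≤ 2⁻¹ ^ n * lipNorm γ S lo f ∧
    lipNorm γ S hi (fun ω => f ω ^ (n + 1)) ≤ (n + 1) * 2⁻¹ ^ n * lipNorm γ S hi f := by
  set L := lipNorm γ S lo f
  set H := lipNorm γ S hi f
  have hK : K * L ≤ 2⁻¹ := le_trans (by rw [mul_assoc]; exact le_mul_of_one_le_left' one_le_two) hf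
  induction n with
  | zero => simp [L, H]
  | succ n ih =>
    obtain ⟨h1, h2⟩ := ih
    simp only [pow_succ _ (n + 1)]
    constructor
    · refine (h.low.lip_mul _ _).trans ?_
      calc _ ≤ K * (2⁻¹ ^ n * L * L + 2⁻¹ ^ n * L * L) := by gcongr
        _ = (2 * K * L) * 2⁻¹ ^ n * L := by ring
        _ ≤ 2⁻¹ * 2⁻¹ ^ n * L := by gcongr
        _ = _ := by ring
    · refine (h.lip_mul _ _).trans ?_
      calc _ ≤ K * ((n + 1) * 2⁻¹ ^ n * H * L + 2⁻¹ ^ n * L * H) := by gcongr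
        _ = (K * L) * ((n + 1 + 1) * 2⁻¹ ^ n * H) := by ring
        _ ≤ 2⁻¹ * ((n + 1 + 1) * 2⁻¹ ^ n * H) := by gcongr
        _ = _ := by push_cast; ring

theorem ennreal_tsum_geometric_two : ∑' i : ℕ, (2⁻¹ : ℝ≥0∞) ^ i = 2 := by
  rw [ENNReal.tsum_geometric, ENNReal.one_sub_inv_two, inv_inv]

/-- The linear growth in `lip_pow` is absorbed by the factorial, and the remaining geometric series
sums to 2. -/
theorem IsTame.lip_exp_sub_one [CompleteSpace R] (h : IsTame K hi lo)
    {f : EuclideanSpace ℝ (Fin d) → R}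
    (hf : 2 * K * lipNorm γ S lo f ≤ 2⁻¹) :
    lipNorm γ S hi (fun ω => NormedSpace.exp (f ω) - 1) ≤ 2 * lipNorm γ S hi f := by
  have hs : ∀ ω ∈ S, HasSum (fun n : ℕ => (((n + 1).factorial : ℂ)⁻¹) • f ω ^ (n + 1))
      (NormedSpace.exp (f ω) - 1) := fun ω _ => by
    have := NormedSpace.exp_series_hasSum_exp' (𝕂 := ℂ) (f ω)
    rw [← hasSum_nat_add_iff' 1] at this
    simpa using this
  refine (lipNorm_hasSum_le h.hi_norm hs).trans ?_
  rw [← ennreal_tsum_geometric_two, ← ENNReal.tsum_mul_right]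
  refine ENNReal.tsum_le_tsum fun n => (lipNorm_smul_le h.hi_norm _ _).trans ?_
  refine (mul_le_mul_right (h.lip_pow hf n).2 _).trans ?_
  have h1 : ‖(((n + 1).factorial : ℂ)⁻¹)‖ₑ * ((n : ℝ≥0∞) + 1) ≤ 1 := by
    rw [enorm_inv (by exact_mod_cast Nat.factorial_ne_zero _), mul_comm, ← div_eq_mul_inv]
    refine ENNReal.div_le_of_le_mul ?_
    rw [one_mul, ← ofReal_norm, Complex.norm_natCast, ENNReal.ofReal_natCast]
    exact_mod_cast Nat.self_le_factorial (n + 1)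
  calc _ = (‖(((n + 1).factorial : ℂ)⁻¹)‖ₑ * ((n : ℝ≥0∞) + 1)) *
        (2⁻¹ ^ n * lipNorm γ S hi f) := by ring
    _ ≤ 1 * (2⁻¹ ^ n * lipNorm γ S hi f) := by gcongr
    _ = _ := one_mul _

/-- Tame estimate for a conjugation minus the identity. -/
theorem IsTame.lip_conj_sub [CompleteSpace R] (h : IsTame K hi lo)
    {f a : EuclideanSpace ℝ (Fin d) → R} (hf : 2 * K * lipNorm γ S lo f ≤ 2⁻¹) :
    lipNorm γ S hi (fun ω => NormedSpace.exp (f ω) * a ω * NormedSpace.exp (-f ω) - a ω) ≤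
      8 * K * (lipNorm γ S hi f * lipNorm γ S lo a + lipNorm γ S lo f * lipNorm γ S hi a) := by
  set L := lipNorm γ S lo f with hL
  set H := lipNorm γ S hi f with hH
  set A := lipNorm γ S lo a
  set B := lipNorm γ S hi a
  have hK : 2 * (K * L) ≤ 2⁻¹ := by rwa [← mul_assoc]
  have hK1 : 2 * (K * L) ≤ 1 := hK.trans (by simp)
  have hK2 : K * L ≤ 1 := le_trans (le_mul_of_one_le_left' one_le_two) hK1
  have hneg : ∀ {M : R → ℝ≥0∞}, IsExtNorm M → lipNorm γ S M (fun ω => -f ω) ≤ lipNorm γ S M f :=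
    fun {M} hM => by simpa using lipNorm_smul_le (γ := γ) (S := S) hM (-1) f
  have hf' : 2 * K * lipNorm γ S lo (fun ω => -f ω) ≤ 2⁻¹ :=
    le_trans (by gcongr; exact hneg h.lo_norm) hf
  set Y : EuclideanSpace ℝ (Fin d) → R := fun ω => NormedSpace.exp (f ω) - 1
  set Z : EuclideanSpace ℝ (Fin d) → R := fun ω => NormedSpace.exp (-f ω) - 1
  have hYh : lipNorm γ S hi Y ≤ 2 * H := h.lip_exp_sub_one hf
  have hYl : lipNorm γ S lo Y ≤ 2 * L := h.low.lip_exp_sub_one hf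
  have hZh : lipNorm γ S hi Z ≤ 2 * H :=
    (h.lip_exp_sub_one hf').trans (by gcongr; exact hneg h.hi_norm)
  have hZl : lipNorm γ S lo Z ≤ 2 * L :=
    (h.low.lip_exp_sub_one hf').trans (by gcongr; exact hneg h.lo_norm)
  -- Expanding `(1 + Y) a (1 + Z) - a` leaves only terms containing `Y` or `Z`, both of the size of
  -- `f`.
  have e : (fun ω => NormedSpace.exp (f ω) * a ω * NormedSpace.exp (-f ω) - a ω) =
      fun ω => Y ω * a ω + (a ω * Z ω + Y ω * a ω * Z ω) := by
    funext ω; simp only [Y, Z]; noncomm_ring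
  rw [e]
  have h1 : lipNorm γ S hi (fun ω => Y ω * a ω) ≤ K * (2 * H * A + 2 * L * B) :=
    (h.lip_mul _ _).trans (by gcongr)
  have h2 : lipNorm γ S lo (fun ω => Y ω * a ω) ≤ K * (2 * L * A + 2 * L * A) :=
    (h.low.lip_mul _ _).trans (by gcongr)
  have h3 : lipNorm γ S hi (fun ω => a ω * Z ω) ≤ K * (B * (2 * L) + A * (2 * H)) :=
    (h.lip_mul _ _).trans (by gcongr)
  have h4 : lipNorm γ S hi (fun ω => Y ω * a ω * Z ω) ≤
      K * ((K * (2 * H * A + 2 * L * B)) * (2 * L) + (K * (2 * L * A + 2 * L * A)) * (2 * H)) :=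
    (h.lip_mul _ _).trans (by gcongr)
  refine (lipNorm_add_le h.hi_norm _ _).trans ((add_le_add h1
    ((lipNorm_add_le h.hi_norm _ _).trans (add_le_add h3 h4))).trans ?_)
  calc _ = 4 * K * (H * A + L * B) + (2 * (K * L)) * (2 * K * (H * A + L * B)) +
        (2 * (K * L)) * (4 * K * (H * A)) := by ring
    _ ≤ 4 * K * (H * A + L * B) + 2⁻¹ * (2 * K * (H * A + L * B)) +
        2⁻¹ * (4 * K * (H * A)) := by gcongr
    _ ≤ 4 * K * (H * A + L * B) + 2⁻¹ * (2 * K * (H * A + L * B)) +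
        2⁻¹ * (4 * K * (H * A + L * B)) := by gcongr; exact le_self_add
    _ = (4 + 2⁻¹ * 2 + 2⁻¹ * 2 * 2) * (K * (H * A + L * B)) := by ring
    _ = 7 * (K * (H * A + L * B)) := by
        rw [ENNReal.inv_mul_cancel (by norm_num) (by norm_num)]; norm_num
    _ ≤ 8 * (K * (H * A + L * B)) := by gcongr; norm_num
    _ = _ := by ring

end tame

/-! ### The column norms as tame norms on bounded operators -/

section tameBOp
variable {d : ℕ}

theorem isExtNorm_colNorm (s : ℝ) : IsExtNorm fun T : BOp d => colNorm s (ent T) where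
  add_le x y := by rw [ent_add]; exact colNorm_add_le s _ _
  smul_le c x := by rw [ent_smul, colNorm_smul]
  closed c := isClosed_colNorm_le s c

/-- The constant depends only on `d` and `s`, so the same one serves every admissible low order `t`.
The absolute value in its exponent ensures `1 ≤ K` whatever the sign of `s`. -/
theorem exists_isTame_colNorm (d : ℕ) {s : ℝ} : ∃ K : ℝ, 1 ≤ K ∧ ∀ t, sZero d ≤ t → t ≤ s →
    IsTame (ENNReal.ofReal K) (fun T : BOp d => colNorm s (ent T)) (fun T => colNorm t (ent T)) := by
  obtain ⟨ζ, hζ1, hζ⟩ := exists_ell2_wt_le d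
  refine ⟨2 ^ |s| * ζ, ?_, fun t ht hts => ?_⟩
  · exact one_le_mul_of_one_le_of_one_le (Real.one_le_rpow (by norm_num) (abs_nonneg s)) hζ1
  have h0 := sZero_pos d
  have key : ∀ s', sZero d ≤ s' → s' ≤ s → ∀ x y : BOp d, colNorm s' (ent (x * y)) ≤
      ENNReal.ofReal (2 ^ |s| * ζ) * (colNorm s' (ent x) * colNorm t (ent y) +
        colNorm t (ent x) * colNorm s' (ent y)) := fun s' h1 h2 x y => by
    refine (colNorm_mul_le hζ (by linarith) ht (enorm_ent_comp_le x y)).trans ?_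
    rw [ENNReal.ofReal_mul (by positivity)]
    gcongr
    · norm_num
    · exact h2.trans (le_abs_self s)
  exact ⟨isExtNorm_colNorm s, isExtNorm_colNorm t, key s (ht.trans hts) le_rfl, key t ht hts⟩

end tameBOp

end WaveKAM

namespace WaveKAM

theorem exp_mul_exp_neg {R : Type*} [NormedRing R] [NormedAlgebra ℂ R] [CompleteSpace R] (x : R) :
    NormedSpace.exp x * NormedSpace.exp (-x) = 1 := by
  let _ : NormedAlgebra ℚ R := NormedAlgebra.restrictScalars ℚ ℂ R
  have hcomm : Commute x (-x) := (Commute.refl x).neg_right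
  rw [← NormedSpace.exp_add_of_commute hcomm]; simp

/-! ### Upper triangular operator exponentials -/

section duhamel
variable {E : Type*} [NormedAddCommGroup E] [NormedSpace ℂ E] [CompleteSpace E]

/-- The block operator `[[X, W], [0, X]]` on `E × E`. -/
noncomputable def upTri (X W : E →L[ℂ] E) : (E × E) →L[ℂ] (E × E) :=
  (X.comp (ContinuousLinearMap.fst ℂ E E) + W.comp (ContinuousLinearMap.snd ℂ E E)).prod
    (X.comp (ContinuousLinearMap.snd ℂ E E))

/-- The coefficients `∑_{i+j=n-1} X^i W X^j`. -/
noncomputable def commPow (X W : E →L[ℂ] E) : ℕ → (E →L[ℂ] E)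
  | 0 => 0
  | n + 1 => W * X ^ n + X * commPow X W n

omit [CompleteSpace E] in
theorem upTri_pow (X W : E →L[ℂ] E) (n : ℕ) : upTri X W ^ n = upTri (X ^ n) (commPow X W n) := by
  induction n with
  | zero => ext v <;> simp [upTri, commPow]
  | succ n ih =>
    rw [pow_succ', ih]
    ext v <;> simp [upTri, commPow, pow_succ', add_comm]

omit [CompleteSpace E] in
theorem upTri_smul (c : ℂ) (X W : E →L[ℂ] E) : c • upTri X W = upTri (c • X) (c • W) := by
  ext v <;> simp [upTri]

noncomputable def corner (i : E →L[ℂ] E × E) (p : E × E →L[ℂ] E) :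
    ((E × E) →L[ℂ] (E × E)) →L[ℂ] (E →L[ℂ] E) :=
  (ContinuousLinearMap.compL ℂ E (E × E) E p).comp
    ((ContinuousLinearMap.compL ℂ E (E × E) (E × E)).flip i)

omit [CompleteSpace E] in
@[simp] theorem corner_apply (i : E →L[ℂ] E × E) (p : E × E →L[ℂ] E)
    (Z : (E × E) →L[ℂ] (E × E)) (v : E) : corner i p Z v = p (Z (i v)) := rfl

/-- The upper right corner of `exp (t [[X, W], [0, X]])`. -/
noncomputable def expCorner (X W : E →L[ℂ] E) (t : ℝ) : E →L[ℂ] E :=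
  corner (ContinuousLinearMap.inr ℂ E E) (ContinuousLinearMap.fst ℂ E E)
    (NormedSpace.exp (t • upTri X W))

/-- When `W` is the commutator of `X` with some operator, `commPow X W n` is the commutator of `X ^
n` with it (`IsComm.pow`). The corner at time 1 is therefore the commutator of `e^X`, expressed by
bounded operators only. -/
theorem hasSum_expCorner (X W : E →L[ℂ] E) :
    HasSum (fun n : ℕ => ((n.factorial : ℂ)⁻¹) • commPow X W n) (expCorner X W 1) := by
  have h := (NormedSpace.exp_series_hasSum_exp' (𝕂 := ℂ) (upTri X W)).mapL
    (corner (ContinuousLinearMap.inr ℂ E E) (ContinuousLinearMap.fst ℂ E E))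
  rw [expCorner, one_smul]
  refine h.congr_fun fun n => ?_
  rw [upTri_pow, map_smul]
  congr 1
  ext v; simp [upTri]

theorem corner_exp (X W : E →L[ℂ] E) (t : ℝ) :
    corner (ContinuousLinearMap.inl ℂ E E) (ContinuousLinearMap.fst ℂ E E)
      (NormedSpace.exp (t • upTri X W)) = NormedSpace.exp (t • X) := by
  have h := (NormedSpace.exp_series_hasSum_exp' (𝕂 := ℂ) (t • upTri X W)).mapL
    (corner (ContinuousLinearMap.inl ℂ E E) (ContinuousLinearMap.fst ℂ E E))
  refine h.unique ((NormedSpace.exp_series_hasSum_exp' (𝕂 := ℂ) (t • X)).congr_fun fun n => ?_)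
  rw [map_smul]
  congr 1
  rw [← Complex.coe_smul t (upTri X W), ← Complex.coe_smul t X, upTri_smul, upTri_pow]
  ext v; simp [upTri]

/-- This is the upper right corner of the derivative of `exp (tZ)`, namely `exp (tZ) * Z`, for the
triangular block operator `Z`. -/
theorem hasDerivAt_expCorner (X W : E →L[ℂ] E) (t : ℝ) :
    HasDerivAt (expCorner X W) (NormedSpace.exp (t • X) * W + expCorner X W t * X) t := by
  have h := hasDerivAt_exp_smul_const (𝕂 := ℝ) (upTri X W) t
  have h2 := ((corner (ContinuousLinearMap.inr ℂ E E)
    (ContinuousLinearMap.fst ℂ E E)).restrictScalars ℝ).hasFDerivAt.comp_hasDerivAt t h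
  refine h2.congr_deriv ?_
  rw [← corner_exp X W t, expCorner]
  ext v
  have e : ((W v, X v) : E × E) = (W v, 0) + (0, X v) := by simp
  simp only [ContinuousLinearMap.coe_restrictScalars', corner_apply, mul_apply_eq_comp,
    add_apply, ContinuousLinearMap.inr_apply, ContinuousLinearMap.inl_apply]
  have e2 : upTri X W (0, v) = (W v, 0) + (0, X v) := by simp [upTri]
  rw [e2, map_add, map_add]

omit [CompleteSpace E] in
theorem expCorner_zero (X W : E →L[ℂ] E) : expCorner X W 0 = 0 := by
  ext v; simp [expCorner]

/-- The average over `t ∈ [0, 1]` of `e^{tX} W e^{-tX}`. -/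
noncomputable def avgConj (X W : E →L[ℂ] E) : E →L[ℂ] E :=
  ∫ t in (0 : ℝ)..1, NormedSpace.exp ((t : ℂ) • X) * W * NormedSpace.exp (-((t : ℂ) • X))

theorem continuous_exp_smul_conj (X W : E →L[ℂ] E) :
    Continuous fun t : ℝ => NormedSpace.exp ((t : ℂ) • X) * W * NormedSpace.exp (-((t : ℂ) • X)) := by
  let _ : NormedAlgebra ℚ (E →L[ℂ] E) := NormedAlgebra.restrictScalars ℚ ℂ (E →L[ℂ] E)
  have h := NormedSpace.exp_continuous (𝔸 := E →L[ℂ] E)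
  fun_prop

theorem clm_avgConj (φ : (E →L[ℂ] E) →L[ℂ] ℂ) (X W : E →L[ℂ] E) :
    φ (avgConj X W) = ∫ t in (0 : ℝ)..1,
      φ (NormedSpace.exp ((t : ℂ) • X) * W * NormedSpace.exp (-((t : ℂ) • X))) :=
  ((φ.intervalIntegral_comp_comm
    ((continuous_exp_smul_conj X W).intervalIntegrable _ _))).symm

theorem avgConj_sub (X W Z : E →L[ℂ] E) : avgConj X (W - Z) = avgConj X W - avgConj X Z := by
  rw [avgConj, avgConj, avgConj, ← intervalIntegral.integral_sub
    ((continuous_exp_smul_conj X W).intervalIntegrable _ _)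
    ((continuous_exp_smul_conj X Z).intervalIntegrable _ _)]
  congr 1; funext t; noncomm_ring

theorem avgConj_sub_self (X W : E →L[ℂ] E) : avgConj X W - W = ∫ t in (0 : ℝ)..1,
    (NormedSpace.exp ((t : ℂ) • X) * W * NormedSpace.exp (-((t : ℂ) • X)) - W) := by
  rw [intervalIntegral.integral_sub
    ((continuous_exp_smul_conj X W).intervalIntegrable _ _) (by simp), avgConj]
  simp

/-- Duhamel's formula. -/
theorem expCorner_mul_exp_neg (X W : E →L[ℂ] E) :
    expCorner X W 1 * NormedSpace.exp (-X) = avgConj X W := by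
  have hd : ∀ t : ℝ, HasDerivAt (fun t : ℝ => expCorner X W t * NormedSpace.exp (t • (-X)))
      (NormedSpace.exp ((t : ℂ) • X) * W * NormedSpace.exp (-((t : ℂ) • X))) t := fun t => by
    have h := (hasDerivAt_expCorner X W t).mul (hasDerivAt_exp_smul_const' (𝕂 := ℝ) (-X) t)
    refine h.congr_deriv ?_
    simp only [smul_neg, Complex.coe_smul]
    noncomm_ring
  rw [avgConj, intervalIntegral.integral_eq_sub_of_hasDerivAt (fun t _ => hd t)
    ((continuous_exp_smul_conj X W).intervalIntegrable _ _)]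
  simp [expCorner_zero]

end duhamel

/-! ### Commutators with block diagonal arrays -/

section blockDiag
variable {d : ℕ}

/-- The sign change of the space index. -/
def flipX : ℤ ⊕ ℤ → ℤ ⊕ ℤ := Sum.map (fun j => -j) (fun j => -j)

@[simp] theorem flipX_flipX (x : ℤ ⊕ ℤ) : flipX (flipX x) = x := by
  rcases x with x | x <;> simp [flipX]

@[simp] theorem mag_flipX (x : ℤ ⊕ ℤ) : mag (flipX x) = mag x := by
  rcases x with x | x <;> simp [flipX, mag]

def flipIdx : Idx d ≃ Idx d :=
  Function.Involutive.toPerm (fun p => (p.1, flipX p.2)) fun p => by simp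

@[simp] theorem flipIdx_flipIdx (p : Idx d) : flipIdx (flipIdx p) = p :=
  Prod.ext rfl (flipX_flipX p.2)

/-- The indices coupled to `p` by a block diagonal operator. -/
def nbIdx (p : Idx d) : Finset (Idx d) := {p, flipIdx p}

theorem mem_nbIdx {p q : Idx d} : q ∈ nbIdx p ↔ q = p ∨ q = flipIdx p := by simp [nbIdx]

theorem mem_nbIdx_comm {p q : Idx d} : q ∈ nbIdx p ↔ p ∈ nbIdx q := by
  rw [mem_nbIdx, mem_nbIdx]
  constructor
  · rintro (h | h) <;> simp [h]
  · rintro (h | h) <;> simp [h]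

theorem nbIdx_flip (p : Idx d) : nbIdx (flipIdx p) = nbIdx p := by
  simp [nbIdx, Finset.pair_comm]

/-- Arrays that do not depend on `θ` and that preserve the spaces `𝔼_j` of each component. -/
def IsBlockDiag (H : OpArr d (ℤ ⊕ ℤ)) : Prop :=
  ∀ p q : Idx d, q ∉ nbIdx p → toep H p q = 0

theorem IsBlockDiag.tsum_left {H : OpArr d (ℤ ⊕ ℤ)} (hH : IsBlockDiag H) (f : Idx d → ℂ)
    (p : Idx d) : HasSum (fun r => toep H p r * f r) (∑ r ∈ nbIdx p, toep H p r * f r) :=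
  hasSum_sum_of_ne_finset_zero fun r hr => by rw [hH p r hr, zero_mul]

theorem IsBlockDiag.tsum_right {H : OpArr d (ℤ ⊕ ℤ)} (hH : IsBlockDiag H) (f : Idx d → ℂ)
    (q : Idx d) : HasSum (fun r => f r * toep H r q) (∑ r ∈ nbIdx q, f r * toep H r q) :=
  hasSum_sum_of_ne_finset_zero fun r hr => by
    rw [hH r q (fun h => hr (mem_nbIdx_comm.1 h)), mul_zero]

theorem sum_pair_or {M : Type*} [AddCommMonoid M] (p : Idx d) (f : Idx d → M)
    (h : flipIdx p ≠ p) : ∑ r ∈ nbIdx p, f r = f p + f (flipIdx p) :=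
  Finset.sum_pair (Ne.symm h)

/-- The commutator `T H - H T` is the bounded operator `V`. -/
def IsComm (H : OpArr d (ℤ ⊕ ℤ)) (T V : BOp d) : Prop :=
  ∀ p q, ∑ r ∈ nbIdx q, ent T p r * toep H r q - ∑ r ∈ nbIdx p, toep H p r * ent T r q = ent V p q

/-- Two series have equal sums once they agree after grouping each index with its reflection: each
sum is half of the sum of the symmetrised series. -/
theorem hasSum_eq_of_flip {φ ψ : Idx d → ℂ} {a b : ℂ} (hφ : HasSum φ a) (hψ : HasSum ψ b)
    (h : ∀ z, φ z + φ (flipIdx z) = ψ z + ψ (flipIdx z)) : a = b := by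
  have h1 := hφ.add ((flipIdx (d := d)).hasSum_iff.2 hφ)
  have h2 := hψ.add ((flipIdx (d := d)).hasSum_iff.2 hψ)
  have h3 : a + a = b + b := h1.unique (by simpa [Function.comp_def, h] using h2)
  linear_combination h3 / 2

/-- This is the Leibniz rule for commutators. With `H` unbounded, `(T H) S` and `T (H S)` cannot be
compared by exchanging double sums. Each converges because the hypotheses express it through bounded
products, and since `H` couples an index only to itself and its reflection, the two series agree on
every such pair. -/
theorem IsComm.mul {H : OpArr d (ℤ ⊕ ℤ)} {T V S V' : BOp d}
    (hT : IsComm H T V) (hS : IsComm H S V') : IsComm H (T * S) (V * S + T * V') := by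
  intro p q
  have h1 : HasSum (fun z => ent T p z * ∑ r ∈ nbIdx q, ent S z r * toep H r q)
      (∑ r ∈ nbIdx q, ent (T * S) p r * toep H r q) := by
    refine (hasSum_sum fun r _ => (hasSum_ent_comp T S p r).mul_right (toep H r q)).congr_fun
      fun z => ?_
    rw [Finset.mul_sum]
    exact Finset.sum_congr rfl fun r _ => by ring
  have h2 : HasSum (fun z => (∑ r ∈ nbIdx p, toep H p r * ent T r z) * ent S z q)
      (∑ r ∈ nbIdx p, toep H p r * ent (T * S) r q) := by
    refine (hasSum_sum fun r _ => (hasSum_ent_comp T S r q).mul_left (toep H p r)).congr_fun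
      fun z => ?_
    rw [Finset.sum_mul]
    exact Finset.sum_congr rfl fun r _ => by ring
  have h3 : HasSum (fun z => ent T p z * ∑ r ∈ nbIdx z, toep H z r * ent S r q)
      (∑ r ∈ nbIdx q, ent (T * S) p r * toep H r q - ent (T * V') p q) := by
    refine (h1.sub (hasSum_ent_comp T V' p q)).congr_fun fun z => ?_
    rw [← hS z q]; ring
  have h4 : HasSum (fun z => (∑ r ∈ nbIdx z, ent T p r * toep H r z) * ent S z q)
      (∑ r ∈ nbIdx p, toep H p r * ent (T * S) r q + ent (V * S) p q) := by
    refine (h2.add (hasSum_ent_comp V S p q)).congr_fun fun z => ?_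
    rw [← hT p z]; ring
  have h5 := hasSum_eq_of_flip h3 h4 fun z => by
    -- A space index equal to 0 is its own reflection, and its block is one-dimensional.
    by_cases hz : flipIdx z = z
    · have e : nbIdx z = {z} := by simp [nbIdx, hz]
      rw [hz, e]; simp; ring
    · rw [nbIdx_flip, sum_pair_or z _ hz, sum_pair_or z _ hz, sum_pair_or z _ hz,
        sum_pair_or z _ hz]
      ring
  rw [ent_add, Pi.add_apply, Pi.add_apply]
  linear_combination h5

theorem IsComm.pow {H : OpArr d (ℤ ⊕ ℤ)} {X W : BOp d} (hX : IsComm H X W)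
    (n : ℕ) : IsComm H (X ^ n) (commPow X W n) := by
  induction n with
  | zero =>
    intro p q
    simp only [pow_zero, ent_one, commPow, ent_zero, Pi.zero_apply, ite_mul, one_mul, zero_mul,
      mul_ite, mul_one, mul_zero, Finset.sum_ite_eq, Finset.sum_ite_eq']
    by_cases h : q ∈ nbIdx p
    · rw [if_pos h, if_pos (mem_nbIdx_comm.1 h), sub_self]
    · rw [if_neg h, if_neg fun h' => h (mem_nbIdx_comm.1 h'), sub_self]
  | succ n ih => rw [pow_succ']; exact hX.mul ih

theorem IsComm.exp {H : OpArr d (ℤ ⊕ ℤ)} {X W : BOp d} (hX : IsComm H X W) :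
    IsComm H (NormedSpace.exp X) (expCorner X W 1) := by
  intro p q
  have h1 : ∀ p q, HasSum (fun n : ℕ => ((n.factorial : ℂ)⁻¹) * ent (X ^ n) p q)
      (ent (NormedSpace.exp X) p q) := fun p q =>
    ((NormedSpace.exp_series_hasSum_exp' (𝕂 := ℂ) X).mapL (entCLM p q)).congr_fun fun n => by
      rw [map_smul]; rfl
  have h2 : HasSum (fun n : ℕ => ((n.factorial : ℂ)⁻¹) * ent (commPow X W n) p q)
      (ent (expCorner X W 1) p q) :=
    ((hasSum_expCorner X W).mapL (entCLM p q)).congr_fun fun n => by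
      rw [map_smul]; rfl
  have h3 := (hasSum_sum fun r (_ : r ∈ nbIdx q) => (h1 p r).mul_right (toep H r q)).sub
    (hasSum_sum fun r (_ : r ∈ nbIdx p) => (h1 r q).mul_left (toep H p r))
  refine h3.unique (h2.congr_fun fun n => ?_)
  rw [← hX.pow n p q, mul_sub, Finset.mul_sum, Finset.mul_sum]
  congr 1
  · exact Finset.sum_congr rfl fun r _ => by ring
  · exact Finset.sum_congr rfl fun r _ => by ring

theorem isComm_of_arr {H U : OpArr d (ℤ ⊕ ℤ)} (hH : IsBlockDiag H) {X W : BOp d}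
    (hX : IsOpOf X U) (hW : IsOpOf W (arrMul U H - arrMul H U)) : IsComm H X W := by
  intro p q
  rw [hW, toep_sub, Pi.sub_apply, Pi.sub_apply, toep_arrMul, toep_arrMul, hX,
    (hH.tsum_left _ p).tsum_eq, (hH.tsum_right _ q).tsum_eq]

/-- Conjugation of an unbounded block diagonal operator plus a bounded one. -/
theorem toep_arrConjugate {H P U : OpArr d (ℤ ⊕ ℤ)} (hH : IsBlockDiag H) {u w p : BOp d}
    (hu : IsOpOf u U)
    (hw : IsOpOf w (arrMul (Complex.I • U) H - arrMul H (Complex.I • U))) (hp : IsOpOf p P) :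
    toep (arrConjugate U (H + P)) = toep H + ent
      (avgConj (Complex.I • u) w +
      NormedSpace.exp (Complex.I • u) * p * NormedSpace.exp (-(Complex.I • u))) := by
  set X := Complex.I • u with hXdef
  have hX : IsOpOf X (Complex.I • U) := hu.smul _
  have hE := hX.exp
  have hE' : IsOpOf (NormedSpace.exp (-X)) (arrExp (-Complex.I • U)) := by
    have : IsOpOf (-X) (-Complex.I • U) := by rw [neg_smul]; exact hX.neg
    exact this.exp
  have hc : IsComm H (NormedSpace.exp X) (expCorner X w 1) := (isComm_of_arr hH hX hw).exp
  rw [← expCorner_mul_exp_neg]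
  set E := NormedSpace.exp X with hEdef
  set E' := NormedSpace.exp (-X) with hEdef'
  set V := expCorner X w 1 with hV
  have hEE : E * E' = 1 := exp_mul_exp_neg X
  ext a b
  rw [arrConjugate, toep_arrMul, ← hE']
  -- Moving `H` to the left of `E = e^{iU}` produces the bounded commutator `V`. The product with
  -- `E'` is then bounded apart from `H E E' = H`.
  have h1 : ∀ r, toep (arrMul (arrExp (Complex.I • U)) (H + P)) a r =
      ent (V + E * p) a r + ∑ z ∈ nbIdx a, toep H a z * ent E z r := by
    intro r
    have h2 := (hH.tsum_right (fun z => ent E a z) r).add (hasSum_ent_comp E p a r)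
    have h3 := hc a r
    rw [toep_arrMul, ← hE, toep_add, ← hp, ent_add, Pi.add_apply, Pi.add_apply]
    rw [(h2.congr_fun (g := fun z => ent E a z * (toep H + ent p) z r) fun z => by
      simp [mul_add]).tsum_eq]
    linear_combination h3
  simp only [h1, add_mul]
  have h4 : HasSum (fun r => (∑ z ∈ nbIdx a, toep H a z * ent E z r) * ent E' r b)
      (toep H a b) := by
    have h5 := hasSum_sum fun z (_ : z ∈ nbIdx a) =>
      (hasSum_ent_comp E E' z b).mul_left (toep H a z)
    have h6 : ∑ z ∈ nbIdx a, toep H a z * ent (E * E') z b = toep H a b := by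
      simp only [hEE, ent_one, mul_ite, mul_one, mul_zero, Finset.sum_ite_eq']
      by_cases h : b ∈ nbIdx a
      · rw [if_pos h]
      · rw [if_neg h, hH a b h]
    rw [h6] at h5
    refine h5.congr_fun fun r => ?_
    rw [Finset.sum_mul]
    exact Finset.sum_congr rfl fun z _ => by ring
  rw [((hasSum_ent_comp (V + E * p) E' a b).add h4).tsum_eq]
  simp only [add_mul, Pi.add_apply]
  ring

/-- The new perturbation after one step, as a bounded operator. -/
noncomputable def stepOp (u p b a : BOp d) : BOp d :=
  (avgConj (Complex.I • u) b - b) +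
    (NormedSpace.exp (Complex.I • u) * p * NormedSpace.exp (-(Complex.I • u)) - p) + (p + b - a)

/-- By `hw` the commutator with `H` is `D + b`. Its average under conjugation is additive, and the
part coming from `D = ω·∂_θ U` is exactly the integral subtracted in `pushHam`; only the average of
`b` survives. -/
theorem isOpOf_pushHam_sub {ω : EuclideanSpace ℝ (Fin d)} {H P U A : OpArr d (ℤ ⊕ ℤ)}
    (hH : IsBlockDiag H) {u p b a D : BOp d} (hu : IsOpOf u U) (hp : IsOpOf p P)
    (ha : IsOpOf a A) (hD : IsOpOf D (arrDeriv ω U))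
    (hw : IsOpOf (D + b) (arrMul (Complex.I • U) H - arrMul H (Complex.I • U))) :
    IsOpOf (stepOp u p b a) (pushHam ω U (H + P) - (H + A)) := by
  have h1 := toep_arrConjugate hH hu hw hp
  have h2 : ∀ (x y : Idx d), toep (fun l => Matrix.of fun k j =>
      ∫ t in (0 : ℝ)..1, arrConjugate ((t : ℂ) • U) (arrDeriv ω U) l k j) x y =
      ent (avgConj (Complex.I • u) D) x y := by
    intro x y
    rw [← entCLM_apply, clm_avgConj, toep, Matrix.of_apply]
    congr 1
    funext t
    have h3 : ∀ c : ℂ, IsOpOf (c • (t : ℂ) • u) (c • (t : ℂ) • U) := fun c => (hu.smul _).smul _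
    have h4 : IsOpOf (NormedSpace.exp (Complex.I • (t : ℂ) • u) * D *
        NormedSpace.exp (-Complex.I • (t : ℂ) • u)) (arrConjugate ((t : ℂ) • U) (arrDeriv ω U)) :=
      ((h3 Complex.I).exp.mul hD).mul (h3 (-Complex.I)).exp
    rw [← h4.apply x y, entCLM_apply, neg_smul, smul_comm]
  have h5 : avgConj (Complex.I • u) (D + b) = avgConj (Complex.I • u) b +
      avgConj (Complex.I • u) D := by
    rw [← sub_eq_iff_eq_add, ← avgConj_sub, add_sub_cancel_left] 
  ext x y
  rw [toep_sub, pushHam, toep_sub, h1, toep_add, ← ha, h5]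
  simp only [Pi.sub_apply, Pi.add_apply, h2, stepOp, ent_add, ent_sub]
  ring

end blockDiag

end WaveKAM

namespace WaveKAM

/-! ### The Hamiltonian structure as a pair of symmetries -/

section ham
variable {d : ℕ}

/-- Exchange of the two components and complex conjugation of the exponentials. -/
def swapX : ℤ ⊕ ℤ → ℤ ⊕ ℤ := Sum.elim (fun j => Sum.inr (-j)) (fun j => Sum.inl (-j))

@[simp] theorem swapX_swapX (x : ℤ ⊕ ℤ) : swapX (swapX x) = x := by
  rcases x with x | x <;> simp [swapX]

theorem swapX_inj {x y : ℤ ⊕ ℤ} : swapX x = swapX y ↔ x = y :=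
  (Function.Involutive.injective swapX_swapX).eq_iff

theorem swapX_flipX (x : ℤ ⊕ ℤ) : swapX (flipX x) = flipX (swapX x) := by
  rcases x with x | x <;> simp [swapX, flipX]

def swapEquiv : ℤ ⊕ ℤ ≃ ℤ ⊕ ℤ := Function.Involutive.toPerm swapX swapX_swapX

@[simp] theorem swapEquiv_apply (x : ℤ ⊕ ℤ) : swapEquiv x = swapX x := rfl

/-- The sign of the component. -/
def sgnX : ℤ ⊕ ℤ → ℂ := Sum.elim (fun _ => 1) (fun _ => -1)

@[simp] theorem sgnX_mul_self (x : ℤ ⊕ ℤ) : sgnX x * sgnX x = 1 := by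
  rcases x with x | x <;> simp [sgnX]

@[simp] theorem star_sgnX (x : ℤ ⊕ ℤ) : star (sgnX x) = sgnX x := by
  rcases x with x | x <;> simp [sgnX]

theorem sgnX_swapX (x : ℤ ⊕ ℤ) : sgnX (swapX x) = -sgnX x := by
  rcases x with x | x <;> simp [sgnX, swapX]

/-- The fixed points are the arrays that are imaginary for the conjugation exchanging the two
components; it encodes the shape of the lower row. -/
def hamConj (A : OpArr d (ℤ ⊕ ℤ)) : OpArr d (ℤ ⊕ ℤ) := fun l =>
  Matrix.of fun x y => -star (A (-l) (swapX x) (swapX y))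

/-- The adjoint for the indefinite form with signs `(1, -1)` on the two components. -/
def hamAdj (A : OpArr d (ℤ ⊕ ℤ)) : OpArr d (ℤ ⊕ ℤ) := fun l =>
  Matrix.of fun x y => sgnX x * sgnX y * star (A (-l) y x)

theorem hamConj_apply (A : OpArr d (ℤ ⊕ ℤ)) (l : Fin d → ℤ) (x y : ℤ ⊕ ℤ) :
    hamConj A l x y = -star (A (-l) (swapX x) (swapX y)) := rfl

theorem hamAdj_apply (A : OpArr d (ℤ ⊕ ℤ)) (l : Fin d → ℤ) (x y : ℤ ⊕ ℤ) :
    hamAdj A l x y = sgnX x * sgnX y * star (A (-l) y x) := rfl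

theorem eq_opMatrix_iff (A : OpArr d (ℤ ⊕ ℤ)) :
    A = opMatrix (diagPart A) (antiPart A) ↔ hamConj A = A := by
  constructor
  · intro h
    ext l x y
    rw [hamConj_apply, h]
    rcases x with x | x <;> rcases y with y | y <;>
      simp [opMatrix, swapX, diagPart, antiPart, arrConj, Matrix.toBlocks₁₁, Matrix.toBlocks₁₂]
  · intro h
    ext l x y
    rcases x with x | x <;> rcases y with y | y
    · rfl
    · rfl
    · nth_rw 1 [← h]; rfl
    · nth_rw 1 [← h]; rfl

/-- In this form the structure is easy to propagate: one symmetry is multiplicative up to sign, the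
other reverses products, so both behave well under commutators, exponentials and conjugations. -/
theorem hasHamForm_iff (A : OpArr d (ℤ ⊕ ℤ)) :
    HasHamForm A ↔ hamConj A = A ∧ hamAdj A = A := by
  rw [HasHamForm, eq_opMatrix_iff]
  refine and_congr_right fun hc => ?_
  have hc' : ∀ l x y, A l x y = -star (A (-l) (swapX x) (swapX y)) := fun l x y => by
    nth_rw 1 [← hc]; rfl
  constructor
  · rintro ⟨h1, h2⟩
    have h1' : ∀ l (k j : ℤ), star (A (-l) (Sum.inl j) (Sum.inl k)) = A l (Sum.inl k) (Sum.inl j) :=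
      fun l k j => congrFun (congrFun (congrFun h1 l) k) j
    have h2' : ∀ l (k j : ℤ), star (A (-l) (Sum.inl j) (Sum.inr k)) =
        star (A (-l) (Sum.inl (-k)) (Sum.inr (-j))) :=
      fun l k j => congrFun (congrFun (congrFun h2 l) k) j
    ext l x y
    rw [hamAdj_apply]
    rcases x with x | x <;> rcases y with y | y
    · rw [h1']; simp [sgnX]
    · rw [hc' (-l)]
      have := congrArg star (h2' (-l) (-x) (-y))
      simp only [neg_neg, star_star] at this
      simp [sgnX, swapX, this]
    · rw [h2', hc' l]; simp [sgnX, swapX]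
    · rw [hc' (-l), hc' l]
      have := congrArg star (h1' l (-y) (-x))
      simp only [star_star] at this
      simp [sgnX, swapX, this]
  · intro h
    have h' : ∀ l x y, sgnX x * sgnX y * star (A (-l) y x) = A l x y := fun l x y =>
      congrFun (congrFun (congrFun h l) x) y
    constructor
    · ext l k j
      have := h' l (Sum.inl k) (Sum.inl j)
      change star (A (-l) (Sum.inl j) (Sum.inl k)) = A l (Sum.inl k) (Sum.inl j)
      simpa [sgnX] using this
    · ext l k j
      have h3 := h' l (Sum.inr k) (Sum.inl j)
      have h4 := hc' l (Sum.inr k) (Sum.inl j)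
      rw [← h3] at h4
      change star (A (-l) (Sum.inl j) (Sum.inr k)) = star (A (-l) (Sum.inl (-k)) (Sum.inr (-j)))
      simpa [sgnX, swapX] using h4

theorem HasHamForm.conj {A : OpArr d (ℤ ⊕ ℤ)} (h : HasHamForm A) : hamConj A = A :=
  ((hasHamForm_iff A).1 h).1

theorem HasHamForm.adj {A : OpArr d (ℤ ⊕ ℤ)} (h : HasHamForm A) : hamAdj A = A :=
  ((hasHamForm_iff A).1 h).2

theorem HasHamForm.conj_apply {A : OpArr d (ℤ ⊕ ℤ)} (h : HasHamForm A) (l : Fin d → ℤ)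
    (x y : ℤ ⊕ ℤ) : A l x y = -star (A (-l) (swapX x) (swapX y)) := by
  nth_rw 1 [← h.conj]; rfl

theorem HasHamForm.adj_apply {A : OpArr d (ℤ ⊕ ℤ)} (h : HasHamForm A) (l : Fin d → ℤ)
    (x y : ℤ ⊕ ℤ) : A l x y = sgnX x * sgnX y * star (A (-l) y x) := by
  nth_rw 1 [← h.adj]; rfl

theorem hamConj_add (A B : OpArr d (ℤ ⊕ ℤ)) : hamConj (A + B) = hamConj A + hamConj B := by
  ext l x y; simp [hamConj_apply]; ring

theorem hamConj_sub (A B : OpArr d (ℤ ⊕ ℤ)) : hamConj (A - B) = hamConj A - hamConj B := by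
  ext l x y; simp [hamConj_apply]; ring

theorem hamAdj_add (A B : OpArr d (ℤ ⊕ ℤ)) : hamAdj (A + B) = hamAdj A + hamAdj B := by
  ext l x y; simp [hamAdj_apply]; ring

theorem hamAdj_sub (A B : OpArr d (ℤ ⊕ ℤ)) : hamAdj (A - B) = hamAdj A - hamAdj B := by
  ext l x y; simp [hamAdj_apply]; ring

theorem hamConj_smul (c : ℂ) (A : OpArr d (ℤ ⊕ ℤ)) : hamConj (c • A) = star c • hamConj A := by
  ext l x y; simp [hamConj_apply]

theorem hamAdj_smul (c : ℂ) (A : OpArr d (ℤ ⊕ ℤ)) : hamAdj (c • A) = star c • hamAdj A := by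
  ext l x y; simp [hamAdj_apply]; ring

theorem HasHamForm.add {A B : OpArr d (ℤ ⊕ ℤ)} (hA : HasHamForm A) (hB : HasHamForm B) :
    HasHamForm (A + B) := by
  rw [hasHamForm_iff, hamConj_add, hamAdj_add, hA.conj, hB.conj, hA.adj, hB.adj]
  exact ⟨rfl, rfl⟩

theorem HasHamForm.sub {A B : OpArr d (ℤ ⊕ ℤ)} (hA : HasHamForm A) (hB : HasHamForm B) :
    HasHamForm (A - B) := by
  rw [hasHamForm_iff, hamConj_sub, hamAdj_sub, hA.conj, hB.conj, hA.adj, hB.adj]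
  exact ⟨rfl, rfl⟩

theorem freqDot_neg (ω : EuclideanSpace ℝ (Fin d)) (l : Fin d → ℤ) :
    freqDot ω (-l) = -freqDot ω l := by simp [freqDot]

theorem hamConj_arrDeriv (ω : EuclideanSpace ℝ (Fin d)) (A : OpArr d (ℤ ⊕ ℤ)) :
    hamConj (arrDeriv ω A) = arrDeriv ω (hamConj A) := by
  ext l x y; simp [hamConj_apply, arrDeriv, freqDot_neg]

theorem hamAdj_arrDeriv (ω : EuclideanSpace ℝ (Fin d)) (A : OpArr d (ℤ ⊕ ℤ)) :
    hamAdj (arrDeriv ω A) = arrDeriv ω (hamAdj A) := by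
  ext l x y; simp [hamAdj_apply, arrDeriv, freqDot_neg]; ring

theorem hamConj_arrMul (A B : OpArr d (ℤ ⊕ ℤ)) :
    hamConj (arrMul A B) = -arrMul (hamConj A) (hamConj B) := by
  ext l x y
  rw [hamConj_apply, arrMul, Matrix.of_apply, Complex.star_def, Complex.conj_tsum,
    ← ((Equiv.neg (Fin d → ℤ)).prodCongr swapEquiv).tsum_eq]
  simp only [Pi.neg_apply, Matrix.neg_apply, arrMul, Matrix.of_apply, neg_inj]
  refine tsum_congr fun p => ?_
  have e : -(l - p.1) = -l + p.1 := by abel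
  simp [hamConj_apply, e]

theorem hamAdj_arrMul (A B : OpArr d (ℤ ⊕ ℤ)) :
    hamAdj (arrMul A B) = arrMul (hamAdj B) (hamAdj A) := by
  ext l x y
  rw [hamAdj_apply, arrMul, Matrix.of_apply, Complex.star_def, Complex.conj_tsum,
    ← ((Equiv.subRight l).prodCongr (Equiv.refl (ℤ ⊕ ℤ))).tsum_eq, ← tsum_mul_left]
  simp only [arrMul, Matrix.of_apply]
  refine tsum_congr fun p => ?_
  have e : -(l - p.1) = p.1 - l := by abel
  have e2 : -l - (p.1 - l) = -p.1 := by abel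
  have e3 := sgnX_mul_self p.2
  simp [hamAdj_apply, e, e2]
  linear_combination (-(sgnX x * sgnX y * (starRingEnd ℂ) (A (-p.1) y p.2) *
    (starRingEnd ℂ) (B (p.1 - l) p.2 x))) * e3

/-! ### Truncations and averages -/

/-- The entries kept by `arrAvg`. -/
def avgCond (l : Fin d → ℤ) (x y : ℤ ⊕ ℤ) : Prop := l = 0 ∧ (y = x ∨ y = flipX x)

theorem avgCond_neg (l : Fin d → ℤ) (x y : ℤ ⊕ ℤ) :
    avgCond (-l) (swapX x) (swapX y) ↔ avgCond l x y := by
  rw [avgCond, avgCond, neg_eq_zero, ← swapX_flipX, swapX_inj, swapX_inj]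

theorem avgCond_comm (l : Fin d → ℤ) (x y : ℤ ⊕ ℤ) : avgCond (-l) y x ↔ avgCond l x y := by
  rw [avgCond, avgCond, neg_eq_zero]
  refine and_congr_right fun _ => ⟨?_, ?_⟩
  · rintro (h | h) <;> simp [h]
  · rintro (h | h) <;> simp [h]

open Classical in
/-- Restriction of an array to a set of entries. -/
noncomputable def arrMask (c : (Fin d → ℤ) → ℤ ⊕ ℤ → ℤ ⊕ ℤ → Prop) (A : OpArr d (ℤ ⊕ ℤ)) :
    OpArr d (ℤ ⊕ ℤ) := fun l => Matrix.of fun x y => if c l x y then A l x y else 0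

theorem HasHamForm.mask {A : OpArr d (ℤ ⊕ ℤ)} (hA : HasHamForm A)
    {c : (Fin d → ℤ) → ℤ ⊕ ℤ → ℤ ⊕ ℤ → Prop}
    (h1 : ∀ l x y, c (-l) (swapX x) (swapX y) ↔ c l x y) (h2 : ∀ l x y, c (-l) y x ↔ c l x y) :
    HasHamForm (arrMask c A) := by
  rw [hasHamForm_iff]
  constructor
  · ext l x y
    rw [hamConj_apply, arrMask, Matrix.of_apply, arrMask, Matrix.of_apply, hA.conj_apply l x y]
    by_cases h : c l x y
    · rw [if_pos h, if_pos ((h1 l x y).2 h)]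
    · rw [if_neg h, if_neg fun h' => h ((h1 l x y).1 h')]; simp
  · ext l x y
    rw [hamAdj_apply, arrMask, Matrix.of_apply, arrMask, Matrix.of_apply, hA.adj_apply l x y]
    by_cases h : c l x y
    · rw [if_pos h, if_pos ((h2 l x y).2 h)]
    · rw [if_neg h, if_neg fun h' => h ((h2 l x y).1 h')]; simp

theorem avgCond_inl (l : Fin d → ℤ) (k j : ℤ) :
    avgCond l (Sum.inl k) (Sum.inl j) ↔ l = 0 ∧ |k| = |j| := by
  rw [avgCond, abs_eq_abs]
  refine and_congr_right fun _ => ?_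
  simp only [flipX, Sum.map_inl, Sum.inl.injEq]
  constructor
  · rintro (h | h) <;> simp [h]
  · rintro (h | h) <;> simp [h]

/-- For a Hamiltonian array the conjugation symmetry forces the lower right block, so averaging is a
mere restriction of entries and cannot increase the column norm. -/
theorem arrAvg_eq_mask {P : OpArr d (ℤ ⊕ ℤ)} (hP : HasHamForm P) :
    arrAvg P = arrMask avgCond P := by
  have h1 : HasHamForm (arrMask avgCond P) := hP.mask avgCond_neg avgCond_comm
  rw [h1.1, arrAvg]
  congr 1
  · ext l k j
    simp only [diagPart, arrMask, Matrix.toBlocks₁₁, Matrix.of_apply, avgCond_inl]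
  · ext l k j
    simp [antiPart, arrMask, Matrix.toBlocks₁₂, avgCond, flipX]

theorem arrCut_eq_mask (N : ℝ) (P : OpArr d (ℤ ⊕ ℤ)) :
    arrCut N P = arrMask (fun l _ _ => freqNorm l < N) P := by
  ext l x y
  simp only [arrCut, arrMask, Matrix.of_apply]
  split_ifs <;> rfl

theorem HasHamForm.cut {P : OpArr d (ℤ ⊕ ℤ)} (hP : HasHamForm P) (N : ℝ) :
    HasHamForm (arrCut N P) := by
  rw [arrCut_eq_mask]
  exact hP.mask (fun l x y => by rw [freqNorm_neg]) (fun l x y => by rw [freqNorm_neg])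

theorem HasHamForm.avg {P : OpArr d (ℤ ⊕ ℤ)} (hP : HasHamForm P) : HasHamForm (arrAvg P) := by
  rw [arrAvg_eq_mask hP]
  exact hP.mask avgCond_neg avgCond_comm

/-- The averaged entries have frequency `0`, which survives the truncation because `N > 0`;
subtracting the average therefore just deletes entries. -/
theorem cut_sub_avg {P : OpArr d (ℤ ⊕ ℤ)} (hP : HasHamForm P) {N : ℝ} (hN : 0 < N) :
    arrCut N P - arrAvg P = arrMask (fun l x y => freqNorm l < N ∧ ¬avgCond l x y) P := by
  rw [arrAvg_eq_mask hP, arrCut_eq_mask]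
  ext l x y
  simp only [arrMask, Pi.sub_apply, Matrix.sub_apply, Matrix.of_apply]
  by_cases h1 : avgCond l x y
  · have : freqNorm l < N := by rw [h1.1]; simpa using hN
    simp [h1, this]
  · simp [h1]

theorem isBlockDiag_iff {H : OpArr d (ℤ ⊕ ℤ)} :
    IsBlockDiag H ↔ ∀ l x y, ¬avgCond l x y → H l x y = 0 := by
  constructor
  · intro h l x y hl
    have := h (l, x) (0, y) fun hm => hl ?_
    · simpa [toep] using this
    · rw [mem_nbIdx, Prod.ext_iff, Prod.ext_iff] at hm
      rcases hm with ⟨h1, h2⟩ | ⟨h1, h2⟩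
      · exact ⟨h1.symm, Or.inl h2⟩
      · exact ⟨h1.symm, Or.inr h2⟩
  · intro h p q hq
    refine h _ _ _ fun ⟨h1, h2⟩ => hq ?_
    rw [mem_nbIdx, Prod.ext_iff, Prod.ext_iff]
    exact h2.imp (fun h3 => ⟨(sub_eq_zero.1 h1).symm, h3⟩) (fun h3 => ⟨(sub_eq_zero.1 h1).symm, h3⟩)

theorem IsBlockDiag.add {H H' : OpArr d (ℤ ⊕ ℤ)} (h : IsBlockDiag H) (h' : IsBlockDiag H') :
    IsBlockDiag (H + H') := fun p q hq => by
  rw [toep_add, Pi.add_apply, Pi.add_apply, h p q hq, h' p q hq, add_zero]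

theorem isBlockDiag_mask (P : OpArr d (ℤ ⊕ ℤ)) : IsBlockDiag (arrMask avgCond P) :=
  isBlockDiag_iff.2 fun l x y h => by simp [arrMask, h]

theorem initialH_apply (m : ℝ) (κ : ℤ → ℝ) (l : Fin d → ℤ) (x y : ℤ ⊕ ℤ) :
    initialH d m κ l x y = if l = 0 ∧ y = x then
      Sum.elim (fun j : ℤ => ((Real.sqrt ((j : ℝ) ^ 2 + m) + κ j : ℝ) : ℂ))
        (fun j : ℤ => ((-(Real.sqrt ((j : ℝ) ^ 2 + m) + κ (-j)) : ℝ) : ℂ)) x else 0 := by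
  by_cases hl : l = 0
  · subst hl
    rcases x with x | x <;> rcases y with y | y <;>
      simp [initialH, opMatrix, arrConj, Matrix.diagonal_apply, eq_comm]
    by_cases h : x = y <;> simp [h]
  · rcases x with x | x <;> rcases y with y | y <;>
      simp [initialH, opMatrix, arrConj, hl]

theorem isBlockDiag_initialH (m : ℝ) (κ : ℤ → ℝ) : IsBlockDiag (initialH d m κ) :=
  isBlockDiag_iff.2 fun l x y h => by
    rw [initialH_apply, if_neg fun h' => h ⟨h'.1, Or.inl h'.2⟩]

theorem hasHamForm_initialH (m : ℝ) (κ : ℤ → ℝ) : HasHamForm (initialH d m κ) := by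
  rw [hasHamForm_iff]
  constructor
  · ext l x y
    rw [hamConj_apply, initialH_apply, initialH_apply]
    by_cases h : l = 0 ∧ y = x
    · rw [if_pos h, if_pos ⟨neg_eq_zero.2 h.1, swapX_inj.2 h.2⟩]
      rcases x with x | x <;> simp [swapX]
    · rw [if_neg h, if_neg fun h' => h ⟨neg_eq_zero.1 h'.1, swapX_inj.1 h'.2⟩]; simp
  · ext l x y
    rw [hamAdj_apply, initialH_apply, initialH_apply]
    by_cases h : l = 0 ∧ y = x
    · rw [if_pos h, if_pos ⟨neg_eq_zero.2 h.1, h.2.symm⟩, h.2, sgnX_mul_self]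
      rcases x with x | x <;> simp
    · rw [if_neg h, if_neg fun h' => h ⟨neg_eq_zero.1 h'.1, h'.2.symm⟩]; simp

end ham

/-! ### Symmetries of operators -/

section symOp
variable {d : ℕ}

def swapIdx : Idx d ≃ Idx d := (Equiv.neg _).prodCongr swapEquiv

/-- `T` is real (`c = 1`) or imaginary (`c = -1`) for the conjugation. -/
def IsConjOp (c : ℂ) (T : BOp d) : Prop :=
  ∀ p q, star (ent T (swapIdx p) (swapIdx q)) = c * ent T p q

/-- `T'` is the adjoint of `T` for the indefinite form. -/
def IsAdjOp (T T' : BOp d) : Prop :=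
  ∀ p q, sgnX p.2 * sgnX q.2 * star (ent T q p) = ent T' p q

theorem hasSum_star {ι : Type*} {f : ι → ℂ} {a : ℂ} (h : HasSum f a) :
    HasSum (fun i => star (f i)) (star a) := h.star

theorem IsConjOp.mul {c c' : ℂ} {T S : BOp d} (hT : IsConjOp c T) (hS : IsConjOp c' S) :
    IsConjOp (c * c') (T * S) := by
  intro p q
  have h1 := hasSum_star ((swapIdx (d := d)).hasSum_iff.2
    (hasSum_ent_comp T S (swapIdx p) (swapIdx q)))
  refine h1.unique (((hasSum_ent_comp T S p q).mul_left (c * c')).congr_fun fun r => ?_)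
  simp only [Function.comp, star_mul']; rw [hT p r, hS r q]; ring

theorem IsConjOp.add {c : ℂ} {T S : BOp d} (hT : IsConjOp c T) (hS : IsConjOp c S) :
    IsConjOp c (T + S) := fun p q => by
  simp only [ent_add, Pi.add_apply, star_add, hT p q, hS p q]; ring

theorem IsConjOp.sub {c : ℂ} {T S : BOp d} (hT : IsConjOp c T) (hS : IsConjOp c S) :
    IsConjOp c (T - S) := fun p q => by
  simp only [ent_sub, Pi.sub_apply, star_sub, hT p q, hS p q]; ring

theorem IsConjOp.smul {c : ℂ} {T : BOp d} (hT : IsConjOp c T) (z e : ℂ) (h : star z = e * z) :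
    IsConjOp (e * c) (z • T) := fun p q => by
  simp only [ent_smul, Pi.smul_apply, smul_eq_mul, star_mul', hT p q, h]; ring

theorem isConjOp_one : IsConjOp 1 (1 : BOp d) := fun p q => by
  simp only [ent_one, swapIdx.injective.eq_iff]; split_ifs <;> simp

theorem IsConjOp.pow {T : BOp d} (hT : IsConjOp 1 T) (n : ℕ) : IsConjOp 1 (T ^ n) := by
  induction n with
  | zero => exact isConjOp_one
  | succ n ih => rw [pow_succ]; simpa using ih.mul hT

theorem hasSum_ent_exp (X : BOp d) (p q : Idx d) :
    HasSum (fun n : ℕ => ((n.factorial : ℂ)⁻¹) * ent (X ^ n) p q) (ent (NormedSpace.exp X) p q) :=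
  ((NormedSpace.exp_series_hasSum_exp' (𝕂 := ℂ) X).mapL (entCLM p q)).congr_fun fun n => by
    rw [map_smul]; rfl

theorem IsConjOp.exp {T : BOp d} (hT : IsConjOp 1 T) : IsConjOp 1 (NormedSpace.exp T) := by
  intro p q
  refine (hasSum_star (hasSum_ent_exp T (swapIdx p) (swapIdx q))).unique
    (((hasSum_ent_exp T p q).mul_left 1).congr_fun fun n => ?_)
  rw [star_mul', hT.pow n p q]
  simp

theorem star_integral (f : ℝ → ℂ) :
    star (∫ t in (0 : ℝ)..1, f t) = ∫ t in (0 : ℝ)..1, star (f t) := by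
  simp only [Complex.star_def, intervalIntegral.integral_of_le zero_le_one]
  exact integral_conj.symm

theorem IsConjOp.avgConj {c : ℂ} {X W : BOp d} (hX : IsConjOp 1 X) (hW : IsConjOp c W) :
    IsConjOp c (avgConj X W) := by
  intro p q
  rw [← entCLM_apply, ← entCLM_apply, clm_avgConj, clm_avgConj, star_integral,
    ← intervalIntegral.integral_const_mul]
  congr 1
  funext t
  have h1 : IsConjOp 1 ((t : ℂ) • X) := by simpa using hX.smul (t : ℂ) 1 (by simp)
  have h2 : IsConjOp 1 (-((t : ℂ) • X)) := by simpa using h1.smul (-1) 1 (by simp)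
  simpa using (h1.exp.mul hW).mul h2.exp p q

theorem IsAdjOp.mul {T T' S S' : BOp d} (hT : IsAdjOp T T') (hS : IsAdjOp S S') :
    IsAdjOp (T * S) (S' * T') := by
  intro p q
  have h1 := (hasSum_star (hasSum_ent_comp T S q p)).mul_left (sgnX p.2 * sgnX q.2)
  refine h1.unique ((hasSum_ent_comp S' T' p q).congr_fun fun r => ?_)
  rw [← hS p r, ← hT r q, star_mul']
  linear_combination (sgnX p.2 * sgnX q.2 * star (ent T q r) * star (ent S r p)) *
    (sgnX_mul_self r.2).symm

theorem IsAdjOp.add {T T' S S' : BOp d} (hT : IsAdjOp T T') (hS : IsAdjOp S S') :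
    IsAdjOp (T + S) (T' + S') := fun p q => by
  simp only [ent_add, Pi.add_apply, star_add, ← hT p q, ← hS p q]; ring

theorem IsAdjOp.sub {T T' S S' : BOp d} (hT : IsAdjOp T T') (hS : IsAdjOp S S') :
    IsAdjOp (T - S) (T' - S') := fun p q => by
  simp only [ent_sub, Pi.sub_apply, star_sub, ← hT p q, ← hS p q]; ring

theorem IsAdjOp.smul {T T' : BOp d} (hT : IsAdjOp T T') (z : ℂ) :
    IsAdjOp (z • T) (star z • T') := fun p q => by
  simp only [ent_smul, Pi.smul_apply, smul_eq_mul, star_mul', ← hT p q]; ring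

theorem isAdjOp_one : IsAdjOp (1 : BOp d) 1 := fun p q => by
  simp only [ent_one]
  by_cases h : p = q
  · subst h; simp
  · rw [if_neg h, if_neg (Ne.symm h)]; simp

theorem IsAdjOp.pow {T T' : BOp d} (hT : IsAdjOp T T') (n : ℕ) : IsAdjOp (T ^ n) (T' ^ n) := by
  induction n with
  | zero => exact isAdjOp_one
  | succ n ih => rw [pow_succ, pow_succ']; exact ih.mul hT

theorem IsAdjOp.exp {T T' : BOp d} (hT : IsAdjOp T T') :
    IsAdjOp (NormedSpace.exp T) (NormedSpace.exp T') := by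
  intro p q
  refine ((hasSum_star (hasSum_ent_exp T q p)).mul_left (sgnX p.2 * sgnX q.2)).unique
    ((hasSum_ent_exp T' p q).congr_fun fun n => ?_)
  rw [star_mul', ← hT.pow n p q]
  simp; ring

theorem IsAdjOp.avgConj {X W W' : BOp d} (hX : IsAdjOp X (-X)) (hW : IsAdjOp W W') :
    IsAdjOp (avgConj X W) (avgConj X W') := by
  intro p q
  rw [← entCLM_apply, ← entCLM_apply, clm_avgConj, clm_avgConj, star_integral,
    ← intervalIntegral.integral_const_mul]
  congr 1
  funext t
  have h1 : IsAdjOp ((t : ℂ) • X) (-((t : ℂ) • X)) := by simpa using hX.smul (t : ℂ)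
  have h2 : IsAdjOp (-((t : ℂ) • X)) ((t : ℂ) • X) := by simpa using h1.smul (-1)
  simpa [mul_assoc] using (h1.exp.mul hW).mul h2.exp p q

theorem isConjOp_of_ham {T : BOp d} {A : OpArr d (ℤ ⊕ ℤ)} (h : IsOpOf T A) (hA : HasHamForm A) :
    IsConjOp (-1) T := fun p q => by
  rw [h.apply, h.apply, hA.conj_apply (p.1 - q.1)]
  have e : -p.1 - -q.1 = -(p.1 - q.1) := by abel
  simp [swapIdx, e]

theorem isAdjOp_of_ham {T : BOp d} {A : OpArr d (ℤ ⊕ ℤ)} (h : IsOpOf T A) (hA : HasHamForm A) :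
    IsAdjOp T T := fun p q => by
  rw [h.apply, h.apply, hA.adj_apply (p.1 - q.1), neg_sub]

theorem hasHamForm_of_op {T : BOp d} {A : OpArr d (ℤ ⊕ ℤ)} (h : IsOpOf T A)
    (h1 : IsConjOp (-1) T) (h2 : IsAdjOp T T) : HasHamForm A := by
  rw [hasHamForm_iff]
  constructor
  · ext l x y
    have h3 := h1 (l, x) (0, y)
    rw [h.apply, h.apply] at h3
    rw [hamConj_apply]
    simp [swapIdx] at h3
    simp [h3]
  · ext l x y
    have h3 := h2 (l, x) (0, y)
    rw [h.apply, h.apply] at h3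
    rw [hamAdj_apply]
    simpa using h3

/-- Multiplication by `i` makes a Hamiltonian `U` real for the conjugation and skew for the
indefinite adjoint. Conjugation by `e^{itU}` with real `t` then preserves both symmetries, and so do
averages, sums and differences. -/
theorem hasHamForm_stepOp {u p b a : BOp d} {U P B A F : OpArr d (ℤ ⊕ ℤ)} (hu : IsOpOf u U)
    (hp : IsOpOf p P) (hb : IsOpOf b B) (ha : IsOpOf a A) (hF : IsOpOf (stepOp u p b a) F)
    (hU : HasHamForm U) (hP : HasHamForm P) (hB : HasHamForm B) (hA : HasHamForm A) :
    HasHamForm F := by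
  have hX : IsConjOp 1 (Complex.I • u) := by
    simpa using (isConjOp_of_ham hu hU).smul Complex.I (-1) (by simp)
  have hX' : IsConjOp 1 (-(Complex.I • u)) := by simpa using hX.smul (-1) 1 (by simp)
  have cp := isConjOp_of_ham hp hP
  have cb := isConjOp_of_ham hb hB
  have ca := isConjOp_of_ham ha hA
  have hY : IsAdjOp (Complex.I • u) (-(Complex.I • u)) := by
    simpa using (isAdjOp_of_ham hu hU).smul Complex.I
  have hY' : IsAdjOp (-(Complex.I • u)) (Complex.I • u) := by simpa using hY.smul (-1)
  have ap := isAdjOp_of_ham hp hP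
  have ab := isAdjOp_of_ham hb hB
  have aa := isAdjOp_of_ham ha hA
  refine hasHamForm_of_op hF ?_ ?_
  · exact (((hX.avgConj cb).sub cb).add
      ((by simpa using (hX.exp.mul cp).mul hX'.exp : IsConjOp (-1) _).sub cp)).add ((cp.add cb).sub ca)
  · exact (((hY.avgConj ab).sub ab).add
      ((by simpa [mul_assoc] using (hY.exp.mul ap).mul hY'.exp : IsAdjOp _ _).sub ap)).add
        ((ap.add ab).sub aa)

end symOp

end WaveKAM

namespace WaveKAM

/-! ### The Sylvester equation with self-adjoint coefficients -/

section sylvester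
open Matrix
open scoped Matrix.Norms.Frobenius
variable {m n : Type*} [Fintype m] [Fintype n]

theorem frob_sq (A : Matrix m n ℂ) : ‖A‖ ^ 2 = ∑ i, ∑ j, ‖A i j‖ ^ 2 := by
  rw [Matrix.frobenius_norm_def, ← Real.rpow_natCast, ← Real.rpow_mul (by positivity)]
  norm_num

theorem norm_entry_le_frob (A : Matrix m n ℂ) (i : m) (j : n) : ‖A i j‖ ≤ ‖A‖ := by
  refine le_of_sq_le_sq ?_ (norm_nonneg _)
  rw [frob_sq]
  exact (Finset.single_le_sum (f := fun j => ‖A i j‖ ^ 2) (fun _ _ => by positivity)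
    (Finset.mem_univ j)).trans (Finset.single_le_sum (f := fun i => ∑ j, ‖A i j‖ ^ 2)
    (fun _ _ => by positivity) (Finset.mem_univ i))

theorem frob_le_sum (A : Matrix m n ℂ) : ‖A‖ ≤ ∑ i, ∑ j, ‖A i j‖ := by
  refine le_of_sq_le_sq ?_ (by positivity)
  rw [frob_sq]
  calc ∑ i, ∑ j, ‖A i j‖ ^ 2 ≤ ∑ i, (∑ j, ‖A i j‖) ^ 2 :=
        Finset.sum_le_sum fun i _ => Finset.sum_sq_le_sq_sum_of_nonneg fun j _ => norm_nonneg _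
    _ ≤ _ := Finset.sum_sq_le_sq_sum_of_nonneg fun i _ => by positivity

theorem frob_sq_trace (A : Matrix m n ℂ) : ((‖A‖ ^ 2 : ℝ) : ℂ) = (Aᴴ * A).trace := by
  rw [frob_sq, Matrix.trace]
  simp only [diag_apply, mul_apply, conjTranspose_apply]
  rw [Finset.sum_comm]
  push_cast
  refine Finset.sum_congr rfl fun i _ => Finset.sum_congr rfl fun j _ => ?_
  rw [Complex.star_def, Complex.conj_mul']

theorem frob_isometry_mul [DecidableEq m] {V : Matrix m m ℂ} (hV : Vᴴ * V = 1)
    (A : Matrix m n ℂ) : ‖V * A‖ = ‖A‖ := by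
  have h : ‖V * A‖ ^ 2 = ‖A‖ ^ 2 := by
    have h1 : ((‖V * A‖ ^ 2 : ℝ) : ℂ) = ((‖A‖ ^ 2 : ℝ) : ℂ) := by
      rw [frob_sq_trace, frob_sq_trace, conjTranspose_mul, Matrix.mul_assoc, ← Matrix.mul_assoc Vᴴ,
        hV, Matrix.one_mul]
    exact_mod_cast h1
  exact (sq_eq_sq₀ (norm_nonneg _) (norm_nonneg _)).1 h

theorem frob_mul_isometry [DecidableEq n] {W : Matrix n n ℂ} (hW : W * Wᴴ = 1)
    (A : Matrix m n ℂ) : ‖A * W‖ = ‖A‖ := by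
  rw [← frobenius_norm_conjTranspose, conjTranspose_mul, frob_isometry_mul (by simpa using hW),
    frobenius_norm_conjTranspose]

variable [DecidableEq m] [DecidableEq n]

/-- Lower bound for `U ↦ x U + A U - U B` by the distance of the spectra. -/
theorem sylvester_bound {A : Matrix m m ℂ} {B : Matrix n n ℂ} (hA : A.IsHermitian)
    (hB : B.IsHermitian) {x c : ℝ} (hc : 0 ≤ c)
    (h : ∀ μ ∈ spectrum ℝ A, ∀ ν ∈ spectrum ℝ B, c ≤ |x + μ - ν|) (U : Matrix m n ℂ) :
    c * ‖U‖ ≤ ‖(x : ℂ) • U + A * U - U * B‖ := by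
  set V : Matrix m m ℂ := (hA.eigenvectorUnitary : Matrix m m ℂ) with hVdef
  set W : Matrix n n ℂ := (hB.eigenvectorUnitary : Matrix n n ℂ) with hWdef
  have hV1 : Vᴴ * V = 1 := Unitary.coe_star_mul_self hA.eigenvectorUnitary
  have hV2 : V * Vᴴ = 1 := Unitary.coe_mul_star_self hA.eigenvectorUnitary
  have hW1 : Wᴴ * W = 1 := Unitary.coe_star_mul_self hB.eigenvectorUnitary
  have hW2 : W * Wᴴ = 1 := Unitary.coe_mul_star_self hB.eigenvectorUnitary
  have eA : A = V * diagonal (fun i => (hA.eigenvalues i : ℂ)) * Vᴴ := by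
    have := hA.spectral_theorem
    rw [Unitary.conjStarAlgAut_apply] at this
    exact this
  have eB : B = W * diagonal (fun i => (hB.eigenvalues i : ℂ)) * Wᴴ := by
    have := hB.spectral_theorem
    rw [Unitary.conjStarAlgAut_apply] at this
    exact this
  -- In eigenbases of `A` and `B` the operator multiplies each entry by `x + μ - ν`, and the
  -- Frobenius norm is invariant under the unitary changes of basis.
  set Q : Matrix m n ℂ := Vᴴ * U * W with hQ
  have hVA : Vᴴ * A = diagonal (fun i => (hA.eigenvalues i : ℂ)) * Vᴴ := by
    conv_lhs => rw [eA]
    rw [← Matrix.mul_assoc, ← Matrix.mul_assoc, hV1, Matrix.one_mul]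
  have hBW : B * W = W * diagonal (fun i => (hB.eigenvalues i : ℂ)) := by
    conv_lhs => rw [eB]
    rw [Matrix.mul_assoc, hW1, Matrix.mul_one]
  have h1 : Vᴴ * ((x : ℂ) • U + A * U - U * B) * W = (x : ℂ) • Q +
      diagonal (fun i => (hA.eigenvalues i : ℂ)) * Q -
      Q * diagonal (fun i => (hB.eigenvalues i : ℂ)) := by
    rw [Matrix.mul_sub, Matrix.mul_add, Matrix.sub_mul, Matrix.add_mul, Matrix.mul_smul,
      Matrix.smul_mul, ← Matrix.mul_assoc Vᴴ A, hVA, ← Matrix.mul_assoc Vᴴ U B,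
      Matrix.mul_assoc (Vᴴ * U) B W, hBW]
    simp only [hQ, Matrix.mul_assoc]
  have h2 : ‖(x : ℂ) • U + A * U - U * B‖ = ‖Vᴴ * ((x : ℂ) • U + A * U - U * B) * W‖ := by
    rw [frob_mul_isometry hW2, frob_isometry_mul (by simpa using hV2)]
  have h3 : ‖U‖ = ‖Q‖ := by
    rw [hQ, frob_mul_isometry hW2, frob_isometry_mul (by simpa using hV2)]
  rw [h2, h3, h1]
  refine le_of_sq_le_sq ?_ (norm_nonneg _)
  rw [mul_pow, frob_sq, frob_sq, Finset.mul_sum]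
  refine Finset.sum_le_sum fun i _ => ?_
  rw [Finset.mul_sum]
  refine Finset.sum_le_sum fun j _ => ?_
  rw [Matrix.sub_apply, Matrix.add_apply, diagonal_mul, mul_diagonal, Matrix.smul_apply,
    smul_eq_mul]
  have h4 : (x : ℂ) * Q i j + (hA.eigenvalues i : ℂ) * Q i j - Q i j * (hB.eigenvalues j : ℂ) =
      ((x + hA.eigenvalues i - hB.eigenvalues j : ℝ) : ℂ) * Q i j := by push_cast; ring
  rw [h4, norm_mul, Complex.norm_real, mul_pow, Real.norm_eq_abs]
  gcongr
  exact h _ (hA.eigenvalues_mem_spectrum_real i) _ (hB.eigenvalues_mem_spectrum_real j)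

/-- The lower bound gives injectivity, which in finite dimension is surjectivity. -/
theorem sylvester_exists {A : Matrix m m ℂ} {B : Matrix n n ℂ} (hA : A.IsHermitian)
    (hB : B.IsHermitian) {x c : ℝ} (hc : 0 < c)
    (h : ∀ μ ∈ spectrum ℝ A, ∀ ν ∈ spectrum ℝ B, c ≤ |x + μ - ν|) (R : Matrix m n ℂ) :
    ∃ U : Matrix m n ℂ, (x : ℂ) • U + A * U - U * B = R := by
  let L : Matrix m n ℂ →ₗ[ℂ] Matrix m n ℂ :=
    { toFun := fun U => (x : ℂ) • U + A * U - U * B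
      map_add' := fun U V => by
        simp only [smul_add, Matrix.mul_add, Matrix.add_mul]; abel
      map_smul' := fun c U => by
        simp only [Matrix.mul_smul, Matrix.smul_mul, RingHom.id_apply, smul_sub, smul_add,
          smul_comm c] }
  have hinj : Function.Injective L := by
    rw [injective_iff_map_eq_zero]
    intro U hU
    have h1 := sylvester_bound hA hB hc.le h U
    have h2 : (x : ℂ) • U + A * U - U * B = 0 := hU
    rw [h2, norm_zero] at h1
    have h3 := norm_nonneg U
    exact norm_eq_zero.1 (le_antisymm (by nlinarith) h3)
  exact LinearMap.injective_iff_surjective.1 hinj R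

end sylvester

/-! ### Blocks of arrays -/

section blocks
open Matrix
open scoped Matrix.Norms.Frobenius
variable {d : ℕ}

def emb : Bool → ℤ → ℤ ⊕ ℤ
  | false => Sum.inl
  | true => Sum.inr

theorem emb_injective (b : Bool) : Function.Injective (emb b) := by
  cases b
  · exact Sum.inl_injective
  · exact Sum.inr_injective

theorem exists_emb (x : ℤ ⊕ ℤ) : ∃ b j, x = emb b j := by
  rcases x with x | x
  · exact ⟨false, x, rfl⟩
  · exact ⟨true, x, rfl⟩

theorem flipX_emb (b : Bool) (j : ℤ) : flipX (emb b j) = emb b (-j) := by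
  cases b <;> rfl

theorem mem_blockIdx {α : ℕ} {j : ℤ} : j ∈ blockIdx α ↔ j.natAbs = α := by
  simp only [blockIdx, Finset.mem_insert, Finset.mem_singleton]; omega

theorem neg_mem_blockIdx {α : ℕ} {j : ℤ} (h : j ∈ blockIdx α) : -j ∈ blockIdx α := by
  rw [mem_blockIdx] at *; omega

theorem blockIdx_eq {α : ℕ} {j : ℤ} (h : j ∈ blockIdx α) : blockIdx α = {j, -j} := by
  ext k
  rw [mem_blockIdx] at *
  simp only [Finset.mem_insert, Finset.mem_singleton]
  omega

/-- Only upper rows are recorded, `b` selecting the diagonal (`false`) or anti-diagonal (`true`)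
entry. The lower rows follow from the conjugation symmetry. -/
def rowBlk (b : Bool) (M : Matrix (ℤ ⊕ ℤ) (ℤ ⊕ ℤ) ℂ) (β α : ℕ) :
    Matrix (blockIdx β) (blockIdx α) ℂ := Matrix.of fun k j => M (Sum.inl k) (emb b j)

def hamBlk (b : Bool) (H : OpArr d (ℤ ⊕ ℤ)) (α : ℕ) : Matrix (blockIdx α) (blockIdx α) ℂ :=
  Matrix.of fun k j => H 0 (emb b k) (emb b j)

def blkEmb (b : Bool) : ℤ ↪ Idx d :=
  ⟨fun j => (0, emb b j), fun _ _ h => emb_injective b (Prod.ext_iff.1 h).2⟩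

theorem blkEmb_apply (b : Bool) (j : ℤ) : (blkEmb b j : Idx d) = (0, emb b j) := rfl

theorem nbIdx_emb_subset (b : Bool) {α : ℕ} {j : ℤ} (h : j ∈ blockIdx α) :
    nbIdx ((0, emb b j) : Idx d) ⊆ (blockIdx α).map (blkEmb b) := by
  intro r hr
  rw [mem_nbIdx] at hr
  rw [Finset.mem_map]
  rcases hr with hr | hr
  · exact ⟨j, h, hr.symm⟩
  · refine ⟨-j, neg_mem_blockIdx h, ?_⟩
    rw [hr]
    exact Prod.ext rfl (flipX_emb b j).symm

theorem rowBlk_arrMul_right {H : OpArr d (ℤ ⊕ ℤ)} (hH : IsBlockDiag H) (U : OpArr d (ℤ ⊕ ℤ))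
    (b : Bool) (l : Fin d → ℤ) (β α : ℕ) :
    rowBlk b (arrMul U H l) β α = rowBlk b (U l) β α * hamBlk b H α := by
  ext k j
  have h1 := toep_arrMul U H (l, Sum.inl k) (0, emb b j)
  rw [tsum_eq_sum (s := (blockIdx α).map (blkEmb b)) fun r hr => by
    rw [hH r _ fun h => hr (nbIdx_emb_subset b j.2 (mem_nbIdx_comm.1 h)), mul_zero],
    Finset.sum_map, ← Finset.sum_coe_sort] at h1
  simpa [toep, rowBlk, hamBlk, Matrix.mul_apply, blkEmb_apply] using h1

theorem rowBlk_arrMul_left {H : OpArr d (ℤ ⊕ ℤ)} (hH : IsBlockDiag H) (U : OpArr d (ℤ ⊕ ℤ))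
    (b : Bool) (l : Fin d → ℤ) (β α : ℕ) :
    rowBlk b (arrMul H U l) β α = hamBlk false H β * rowBlk b (U l) β α := by
  ext k j
  have h1 := toep_arrMul H U (0, emb false k) (-l, emb b j)
  rw [tsum_eq_sum (s := (blockIdx β).map (blkEmb false)) fun r hr => by
    rw [hH _ r fun h => hr (nbIdx_emb_subset false k.2 h), zero_mul],
    Finset.sum_map, ← Finset.sum_coe_sort] at h1
  simpa [toep, rowBlk, hamBlk, Matrix.mul_apply, blkEmb_apply, emb] using h1

theorem hamBlk_isHermitian {H : OpArr d (ℤ ⊕ ℤ)} (hH : HasHamForm H) (b : Bool) (α : ℕ) :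
    (hamBlk b H α).IsHermitian := by
  ext k j
  rw [conjTranspose_apply, hamBlk, Matrix.of_apply, Matrix.of_apply, hH.adj_apply 0 (emb b k)]
  cases b <;> simp [sgnX, emb]

def negBlockIdx (α : ℕ) : blockIdx α ≃ blockIdx α :=
  Function.Involutive.toPerm (fun j => ⟨-j.1, neg_mem_blockIdx j.2⟩) fun j => by simp

/-- Up to the relabelling `j ↦ -j`, the lower right block is minus the complex conjugate of the
upper left one. This is why anti-diagonal blocks involve sums of eigenvalues instead of differences.
-/
theorem spectrum_hamBlk_true {H : OpArr d (ℤ ⊕ ℤ)} (hH : HasHamForm H) (α : ℕ) {ν : ℝ}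
    (hν : ν ∈ spectrum ℝ (hamBlk true H α)) : -ν ∈ blockEigs H α := by
  set φ := (Matrix.reindexAlgEquiv ℝ ℂ (negBlockIdx α)).trans
    (Complex.conjAe.mapMatrix (m := blockIdx α)) with hφ
  have h1 : hamBlk true H α = -φ (hamBlk false H α) := by
    ext k j
    simp only [hamBlk, Matrix.of_apply, emb]
    rw [hH.conj_apply 0]
    simp [hφ, swapX]
    rfl
  rw [h1, ← spectrum.neg_eq, Set.mem_neg, AlgEquiv.spectrum_eq] at hν
  exact hν

/-- Lower bounds for the divisors of the homological equation. -/
def NonRes (ω : EuclideanSpace ℝ (Fin d)) (H : OpArr d (ℤ ⊕ ℤ)) (N c : ℝ) : Prop :=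
  ∀ l : Fin d → ℤ, freqNorm l < N → ∀ i j : ℕ, ∀ μ ∈ blockEigs H i, ∀ ν ∈ blockEigs H j,
    (¬(l = 0 ∧ i = j) → c ≤ |freqDot ω l + μ - ν|) ∧ c ≤ |freqDot ω l + μ + ν|

variable {ω : EuclideanSpace ℝ (Fin d)} {H : OpArr d (ℤ ⊕ ℤ)} {N c : ℝ}

theorem NonRes.divisor (h : NonRes ω H N c) (hH : HasHamForm H) {l : Fin d → ℤ}
    (hl : freqNorm l < N) {b : Bool} {β α : ℕ} (hr : ¬(b = false ∧ l = 0 ∧ β = α)) :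
    ∀ μ ∈ spectrum ℝ (hamBlk false H β), ∀ ν ∈ spectrum ℝ (hamBlk b H α),
      c ≤ |freqDot ω l + μ - ν| := by
  intro μ hμ ν hν
  cases b
  · exact (h l hl β α μ hμ ν hν).1 fun h' => hr ⟨rfl, h'⟩
  · have := (h l hl β α μ hμ (-ν) (spectrum_hamBlk_true hH α hν)).2
    rwa [← sub_eq_add_neg] at this

theorem NonRes.blk_bound (h : NonRes ω H N c) (hH : HasHamForm H) (hc : 0 ≤ c) {l : Fin d → ℤ}
    (hl : freqNorm l < N) {b : Bool} {β α : ℕ} (hr : ¬(b = false ∧ l = 0 ∧ β = α))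
    (M : Matrix (blockIdx β) (blockIdx α) ℂ) :
    c * ‖M‖ ≤ ‖(freqDot ω l : ℂ) • M + hamBlk false H β * M - M * hamBlk b H α‖ :=
  sylvester_bound (hamBlk_isHermitian hH _ _) (hamBlk_isHermitian hH _ _) hc
    (h.divisor hH hl hr) M

/-- The homological equation with right hand side `R`. -/
def SolvesHom (ω : EuclideanSpace ℝ (Fin d)) (H R U : OpArr d (ℤ ⊕ ℤ)) : Prop :=
  arrDeriv ω U = Complex.I • (arrMul U H - arrMul H U) + R

/-- Multiplication by `∓i` turns the homological equation on one block into a Sylvester equation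
with self-adjoint coefficients. -/
theorem blk_eq_iff (hB : IsBlockDiag H) (R U : OpArr d (ℤ ⊕ ℤ)) (b : Bool) (l : Fin d → ℤ)
    (β α : ℕ) :
    rowBlk b (arrDeriv ω U l) β α =
      rowBlk b ((Complex.I • (arrMul U H - arrMul H U) + R) l) β α ↔
    (freqDot ω l : ℂ) • rowBlk b (U l) β α + hamBlk false H β * rowBlk b (U l) β α -
      rowBlk b (U l) β α * hamBlk b H α = (-Complex.I) • rowBlk b (R l) β α := by
  rw [← rowBlk_arrMul_left hB, ← rowBlk_arrMul_right hB]
  have hI := Complex.I_mul_I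
  constructor
  · intro h
    ext k j
    have h1 := congrFun (congrFun h k) j
    simp only [rowBlk, arrDeriv, Matrix.of_apply, Matrix.smul_apply, Matrix.add_apply,
      Matrix.sub_apply, Pi.add_apply, Pi.sub_apply, Pi.smul_apply, smul_eq_mul] at h1 ⊢
    linear_combination (-Complex.I) * h1 + ((freqDot ω l : ℂ) * U l (Sum.inl k) (emb b j) -
      (arrMul U H l (Sum.inl k) (emb b j) - arrMul H U l (Sum.inl k) (emb b j))) * hI
  · intro h
    ext k j
    have h1 := congrFun (congrFun h k) j
    simp only [rowBlk, arrDeriv, Matrix.of_apply, Matrix.smul_apply, Matrix.add_apply,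
      Matrix.sub_apply, Pi.add_apply, Pi.sub_apply, Pi.smul_apply, smul_eq_mul] at h1 ⊢
    linear_combination Complex.I * h1 + (-R l (Sum.inl k) (emb b j)) * hI

theorem SolvesHom.blk (hB : IsBlockDiag H) {R U : OpArr d (ℤ ⊕ ℤ)} (h : SolvesHom ω H R U)
    (b : Bool) (l : Fin d → ℤ) (β α : ℕ) :
    (freqDot ω l : ℂ) • rowBlk b (U l) β α + hamBlk false H β * rowBlk b (U l) β α -
      rowBlk b (U l) β α * hamBlk b H α = (-Complex.I) • rowBlk b (R l) β α :=
  (blk_eq_iff hB R U b l β α).1 (by rw [h])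

theorem arr_ext_of_conj {A B : OpArr d (ℤ ⊕ ℤ)} (hA : hamConj A = A) (hB : hamConj B = B)
    (h : ∀ b l β α, rowBlk b (A l) β α = rowBlk b (B l) β α) : A = B := by
  have h1 : ∀ l k y, A l (Sum.inl k) y = B l (Sum.inl k) y := by
    intro l k y
    obtain ⟨b, j, rfl⟩ := exists_emb y
    exact congrFun (congrFun (h b l k.natAbs j.natAbs) ⟨k, mem_blockIdx.2 rfl⟩)
      ⟨j, mem_blockIdx.2 rfl⟩
  ext l x y
  rcases x with k | k
  · exact h1 l k y
  · rw [← hA, ← hB, hamConj_apply, hamConj_apply]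
    simp only [swapX, Sum.elim_inr]
    rw [h1]

theorem hamConj_hom {R U : OpArr d (ℤ ⊕ ℤ)} (hH : hamConj H = H) (hR : hamConj R = R)
    (hU : hamConj U = U) : hamConj (Complex.I • (arrMul U H - arrMul H U) + R) =
      Complex.I • (arrMul U H - arrMul H U) + R := by
  rw [hamConj_add, hamConj_smul, hamConj_sub, hamConj_arrMul, hamConj_arrMul, hH, hR, hU]
  simp [sub_eq_add_neg, add_comm]

/-- The equation is invariant under the indefinite adjoint. With uniqueness on nonresonant blocks,
this makes the constructed solution self-adjoint. -/
theorem SolvesHom.adj {R U : OpArr d (ℤ ⊕ ℤ)} (hH : hamAdj H = H) (hR : hamAdj R = R)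
    (h : SolvesHom ω H R U) : SolvesHom ω H R (hamAdj U) := by
  have h1 := congrArg hamAdj h
  rw [hamAdj_arrDeriv, hamAdj_add, hamAdj_smul, hamAdj_sub, hamAdj_arrMul, hamAdj_arrMul, hH, hR]
    at h1
  rw [SolvesHom, h1]
  simp [sub_eq_add_neg, add_comm]

theorem hamConj_hamAdj (A : OpArr d (ℤ ⊕ ℤ)) : hamConj (hamAdj A) = hamAdj (hamConj A) := by
  ext l x y
  simp [hamConj_apply, hamAdj_apply, sgnX_swapX]

theorem abs_eq_iff_natAbs_eq {k j : ℤ} : |k| = |j| ↔ k.natAbs = j.natAbs := by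
  rw [Int.abs_eq_natAbs, Int.abs_eq_natAbs, Nat.cast_inj]

theorem rowBlk_resonant {U : OpArr d (ℤ ⊕ ℤ)}
    (h : ∀ k j : ℤ, |k| = |j| → diagPart U 0 k j = 0) (α : ℕ) : rowBlk false (U 0) α α = 0 := by
  ext k j
  refine h k j ?_
  rw [abs_eq_iff_natAbs_eq, mem_blockIdx.1 k.2, mem_blockIdx.1 j.2]

/-- Each upper block is solved separately and set to zero where the source vanishes identically:
high frequencies and the averaged diagonal blocks. The lower rows are defined by the conjugation
symmetry, and the adjoint symmetry follows from uniqueness. -/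
theorem exists_isHomSol {P : OpArr d (ℤ ⊕ ℤ)} (hB : IsBlockDiag H) (hH : HasHamForm H)
    (hP : HasHamForm P) (hN : 0 < N) (hc : 0 < c) (h : NonRes ω H N c) :
    ∃ U, IsHomSol ω N H P U := by
  classical
  set R : OpArr d (ℤ ⊕ ℤ) := arrCut N P - arrAvg P with hRdef
  have hR : HasHamForm R := (hP.cut N).sub hP.avg
  have hRm : R = arrMask (fun l x y => freqNorm l < N ∧ ¬avgCond l x y) P := cut_sub_avg hP hN
  have hex : ∀ (b : Bool) (l : Fin d → ℤ) (β α : ℕ), ∃ M : Matrix (blockIdx β) (blockIdx α) ℂ,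
      (¬(freqNorm l < N ∧ ¬(b = false ∧ l = 0 ∧ β = α)) → M = 0) ∧
      (freqDot ω l : ℂ) • M + hamBlk false H β * M - M * hamBlk b H α =
        (-Complex.I) • rowBlk b (R l) β α := by
    intro b l β α
    by_cases hl : freqNorm l < N ∧ ¬(b = false ∧ l = 0 ∧ β = α)
    · obtain ⟨M, hM⟩ := sylvester_exists (hamBlk_isHermitian hH false β)
        (hamBlk_isHermitian hH b α) hc (h.divisor hH hl.1 hl.2) ((-Complex.I) • rowBlk b (R l) β α)
      exact ⟨M, fun h' => absurd hl h', hM⟩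
    · refine ⟨0, fun _ => rfl, ?_⟩
      have : rowBlk b (R l) β α = 0 := by
        ext k j
        simp only [rowBlk, Matrix.of_apply, hRm, arrMask, Matrix.zero_apply]
        refine if_neg fun h' => hl ⟨h'.1, fun h'' => h'.2 ?_⟩
        obtain ⟨rfl, rfl, rfl⟩ := h''
        exact (avgCond_inl _ _ _).2 ⟨rfl, by
          rw [abs_eq_iff_natAbs_eq, mem_blockIdx.1 k.2, mem_blockIdx.1 j.2]⟩
      simp [this]
  choose M hM0 hM using hex
  let G : Bool → OpArr d ℤ := fun b l => Matrix.of fun k j =>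
    M b l k.natAbs j.natAbs ⟨k, mem_blockIdx.2 rfl⟩ ⟨j, mem_blockIdx.2 rfl⟩
  have hG : ∀ b l β α (k : blockIdx β) (j : blockIdx α), G b l k j = M b l β α k j := by
    rintro b l β α ⟨k, hk⟩ ⟨j, hj⟩
    have h1 := mem_blockIdx.1 hk
    have h2 := mem_blockIdx.1 hj
    subst h1 h2
    rfl
  set U := opMatrix (G false) (G true) with hUdef
  have hblk : ∀ b l β α, rowBlk b (U l) β α = M b l β α := by
    intro b l β α
    ext k j
    rw [← hG]
    cases b <;> rfl
  have hUc : hamConj U = U := (eq_opMatrix_iff U).1 rfl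
  have hsol : SolvesHom ω H R U := by
    refine arr_ext_of_conj (by rw [hamConj_arrDeriv, hUc]) (hamConj_hom hH.conj hR.conj hUc)
      fun b l β α => ?_
    rw [blk_eq_iff hB, hblk]
    exact hM b l β α
  have hUa : hamAdj U = U := by
    refine arr_ext_of_conj (by rw [hamConj_hamAdj, hUc]) hUc fun b l β α => ?_
    by_cases hl : freqNorm l < N ∧ ¬(b = false ∧ l = 0 ∧ β = α)
    · have h1 := (hsol.adj hH.adj hR.adj).blk hB b l β α
      have h2 := hsol.blk hB b l β α
      have h3 := h.blk_bound hH hc.le hl.1 hl.2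
        (rowBlk b (hamAdj U l) β α - rowBlk b (U l) β α)
      have h4 : (freqDot ω l : ℂ) • (rowBlk b (hamAdj U l) β α - rowBlk b (U l) β α) +
          hamBlk false H β * (rowBlk b (hamAdj U l) β α - rowBlk b (U l) β α) -
          (rowBlk b (hamAdj U l) β α - rowBlk b (U l) β α) * hamBlk b H α = 0 := by
        rw [← sub_eq_zero] at h1 h2
        rw [← sub_eq_zero.2 (h1.trans h2.symm), smul_sub, Matrix.mul_sub, Matrix.sub_mul]
        abel
      rw [h4, norm_zero] at h3
      have h5 := norm_nonneg (rowBlk b (hamAdj U l) β α - rowBlk b (U l) β α)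
      exact sub_eq_zero.1 (norm_eq_zero.1 (le_antisymm (by nlinarith) h5))
    -- The adjoint exchanges the block `(l, β, α)` with `(-l, α, β)`. The set of excluded blocks is
    -- stable under this exchange, so both vanish.
    · have hl' : ¬(freqNorm (-l) < N ∧ ¬(b = false ∧ -l = 0 ∧ α = β)) := by
        rw [freqNorm_neg, neg_eq_zero]
        intro h'
        exact hl ⟨h'.1, fun h'' => h'.2 ⟨h''.1, h''.2.1, h''.2.2.symm⟩⟩
      rw [hblk, hM0 b l β α hl]
      ext k j
      cases b
      · have : U (-l) (Sum.inl j) (Sum.inl k) = 0 := by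
          change G false (-l) j k = 0
          rw [hG, hM0 _ _ _ _ hl']; rfl
        simp [rowBlk, hamAdj_apply, emb, this]
      · have : U (-l) (Sum.inr j) (Sum.inl k) = 0 := by
          rw [← hUc, hamConj_apply]
          simp only [swapX, Sum.elim_inr, Sum.elim_inl, neg_neg]
          change -star (G true l (-(j : ℤ)) (-(k : ℤ))) = 0
          have e := hG true l α β ⟨-(j : ℤ), neg_mem_blockIdx j.2⟩ ⟨-(k : ℤ), neg_mem_blockIdx k.2⟩
          simp only at e
          rw [e, hM0 _ _ _ _ ?_]
          · simp
          · rw [freqNorm_neg] at hl'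
            exact fun h' => hl' ⟨h'.1, by simp⟩
        simp [rowBlk, hamAdj_apply, emb, this]
  refine ⟨U, (hasHamForm_iff U).2 ⟨hUc, hUa⟩, ?_, ?_, ?_⟩
  · intro l hl
    refine Matrix.ext fun x y => ?_
    have hz : ∀ b l (k j : ℤ), N ≤ freqNorm l → G b l k j = 0 := fun b l k j hl => by
      change M b l k.natAbs j.natAbs _ _ = 0
      rw [hM0 _ _ _ _ fun h' => absurd h'.1 (not_lt.2 hl)]; rfl
    have hl' : N ≤ freqNorm (-l) := by rwa [freqNorm_neg]
    rcases x with x | x <;> rcases y with y | y <;>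
      simp [hUdef, opMatrix, arrConj, hz _ _ _ _ hl, hz _ _ _ _ hl']
  · intro k j hkj
    change M false 0 k.natAbs j.natAbs _ _ = 0
    rw [hM0 _ _ _ _ fun h' => h'.2 ⟨rfl, rfl, abs_eq_iff_natAbs_eq.1 hkj⟩]; rfl
  · rw [add_sub_assoc]; exact hsol

/-! ### Entrywise estimates -/

/-- Sum over the sign changes of both space indices. -/
def quad (a : ℤ ⊕ ℤ → ℤ ⊕ ℤ → ℝ) (x y : ℤ ⊕ ℤ) : ℝ :=
  a x y + a (flipX x) y + a x (flipX y) + a (flipX x) (flipX y)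

/-- Only an inequality, since for `j = 0` the block has a single index while the right side counts
it twice. -/
theorem sum_blockIdx_le {α : ℕ} {j : ℤ} (h : j ∈ blockIdx α) (g : ℤ → ℝ) (hg : ∀ i, 0 ≤ g i) :
    ∑ i : blockIdx α, g i ≤ g j + g (-j) := by
  rw [Finset.sum_coe_sort (blockIdx α) g, blockIdx_eq h]
  by_cases hj : j = -j
  · rw [← hj, Finset.pair_eq_singleton, Finset.sum_singleton]
    linarith [hg j]
  · rw [Finset.sum_pair hj]

theorem frob_rowBlk_le_quad (M : Matrix (ℤ ⊕ ℤ) (ℤ ⊕ ℤ) ℂ) (b : Bool) {β α : ℕ} {k j : ℤ}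
    (hk : k ∈ blockIdx β) (hj : j ∈ blockIdx α) :
    ‖rowBlk b M β α‖ ≤ quad (fun x y => ‖M x y‖) (Sum.inl k) (emb b j) := by
  refine (frob_le_sum _).trans ?_
  change ∑ k' : blockIdx β, ∑ i : blockIdx α, ‖M (Sum.inl (k' : ℤ)) (emb b i)‖ ≤ _
  have h1 : ∀ k' : ℤ, ∑ i : blockIdx α, ‖M (Sum.inl k') (emb b i)‖ ≤
      ‖M (Sum.inl k') (emb b j)‖ + ‖M (Sum.inl k') (emb b (-j))‖ := fun k' =>
    sum_blockIdx_le hj (fun i => ‖M (Sum.inl k') (emb b i)‖) fun _ => norm_nonneg _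
  refine (Finset.sum_le_sum fun (k' : blockIdx β) _ => h1 k').trans ?_
  refine (sum_blockIdx_le hk (fun k' => ‖M (Sum.inl k') (emb b j)‖ +
    ‖M (Sum.inl k') (emb b (-j))‖) fun _ => by positivity).trans (le_of_eq ?_)
  simp only [quad, flipX_emb]
  simp only [flipX, Sum.map_inl]
  ring

theorem norm_le_frob_rowBlk (M : Matrix (ℤ ⊕ ℤ) (ℤ ⊕ ℤ) ℂ) (b : Bool) (k j : ℤ) :
    ‖M (Sum.inl k) (emb b j)‖ ≤ ‖rowBlk b M k.natAbs j.natAbs‖ :=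
  norm_entry_le_frob (rowBlk b M k.natAbs j.natAbs) ⟨k, mem_blockIdx.2 rfl⟩ ⟨j, mem_blockIdx.2 rfl⟩

theorem IsHomSol.solves {P U : OpArr d (ℤ ⊕ ℤ)} (h : IsHomSol ω N H P U) :
    SolvesHom ω H (arrCut N P - arrAvg P) U := by
  rw [SolvesHom, ← add_sub_assoc]; exact h.2.2.2

theorem IsHomSol.rowBlk_eq_zero {P U : OpArr d (ℤ ⊕ ℤ)} (h : IsHomSol ω N H P U) {b : Bool}
    {l : Fin d → ℤ} {β α : ℕ} (hl : ¬(freqNorm l < N ∧ ¬(b = false ∧ l = 0 ∧ β = α))) :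
    rowBlk b (U l) β α = 0 := by
  by_cases h1 : freqNorm l < N
  · rw [not_and_not_right] at hl
    obtain ⟨rfl, rfl, rfl⟩ := hl h1
    exact rowBlk_resonant h.2.2.1 β
  · rw [h.2.1 l (not_lt.1 h1)]; rfl

theorem norm_mask_le (c : (Fin d → ℤ) → ℤ ⊕ ℤ → ℤ ⊕ ℤ → Prop) (A : OpArr d (ℤ ⊕ ℤ))
    (l : Fin d → ℤ) (x y : ℤ ⊕ ℤ) : ‖arrMask c A l x y‖ ≤ ‖A l x y‖ := by
  simp only [arrMask, Matrix.of_apply]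
  split_ifs <;> simp

theorem quad_mono {a a' : ℤ ⊕ ℤ → ℤ ⊕ ℤ → ℝ} (h : ∀ x y, a x y ≤ a' x y) (x y : ℤ ⊕ ℤ) :
    quad a x y ≤ quad a' x y := by
  unfold quad; gcongr <;> exact h _ _

theorem rowBlk_rhs_le {P : OpArr d (ℤ ⊕ ℤ)} (hP : HasHamForm P) (hN : 0 < N) (b : Bool)
    (l : Fin d → ℤ) {β α : ℕ} {k j : ℤ} (hk : k ∈ blockIdx β) (hj : j ∈ blockIdx α) :
    ‖rowBlk b ((arrCut N P - arrAvg P) l) β α‖ ≤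
      quad (fun x y => ‖P l x y‖) (Sum.inl k) (emb b j) := by
  refine (frob_rowBlk_le_quad _ b hk hj).trans (quad_mono (fun x y => ?_) _ _)
  rw [cut_sub_avg hP hN]
  exact norm_mask_le _ _ _ _ _

/-- The solution of the homological equation loses a factor `c⁻¹`. -/
theorem IsHomSol.frob_bound {P U : OpArr d (ℤ ⊕ ℤ)} (h : IsHomSol ω N H P U)
    (hB : IsBlockDiag H) (hH : HasHamForm H) (hP : HasHamForm P) (hN : 0 < N) (hc : 0 < c)
    (hnr : NonRes ω H N c) (b : Bool) (l : Fin d → ℤ) {β α : ℕ} {k j : ℤ} (hk : k ∈ blockIdx β)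
    (hj : j ∈ blockIdx α) :
    ‖rowBlk b (U l) β α‖ ≤ c⁻¹ * quad (fun x y => ‖P l x y‖) (Sum.inl k) (emb b j) := by
  have hq : 0 ≤ quad (fun x y => ‖P l x y‖) (Sum.inl k) (emb b j) := by unfold quad; positivity
  by_cases hl : freqNorm l < N ∧ ¬(b = false ∧ l = 0 ∧ β = α)
  · have h1 := hnr.blk_bound hH hc.le hl.1 hl.2 (rowBlk b (U l) β α)
    rw [h.solves.blk hB, norm_smul] at h1
    have h2 := rowBlk_rhs_le hP hN b l hk hj
    rw [le_inv_mul_iff₀ hc]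
    refine h1.trans ?_
    simpa using h2
  · rw [h.rowBlk_eq_zero hl, norm_zero]
    positivity

theorem quad_conj {A : OpArr d (ℤ ⊕ ℤ)} (hA : hamConj A = A) (l : Fin d → ℤ) (x y : ℤ ⊕ ℤ) :
    quad (fun x y => ‖A (-l) x y‖) (swapX x) (swapX y) = quad (fun x y => ‖A l x y‖) x y := by
  have h1 : ∀ x y, ‖A l x y‖ = ‖A (-l) (swapX x) (swapX y)‖ := fun x y => by
    conv_lhs => rw [← hA]
    rw [hamConj_apply, norm_neg, norm_star]
  simp only [quad, h1, swapX_flipX]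

/-- Extends an estimate from the upper rows by the Hamiltonian symmetry. -/
theorem entry_bound_of_upper {U P₁ P₂ : OpArr d (ℤ ⊕ ℤ)} (hU : hamConj U = U)
    (h₁ : hamConj P₁ = P₁) (h₂ : hamConj P₂ = P₂) {C₁ C₂ : ℝ}
    (h : ∀ b l (k j : ℤ), ‖U l (Sum.inl k) (emb b j)‖ ≤
      C₁ * quad (fun x y => ‖P₁ l x y‖) (Sum.inl k) (emb b j) +
      C₂ * quad (fun x y => ‖P₂ l x y‖) (Sum.inl k) (emb b j)) (l : Fin d → ℤ) (x y : ℤ ⊕ ℤ) :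
    ‖U l x y‖ ≤ C₁ * quad (fun x y => ‖P₁ l x y‖) x y + C₂ * quad (fun x y => ‖P₂ l x y‖) x y := by
  rcases x with k | k
  · obtain ⟨b, j, rfl⟩ := exists_emb y
    exact h b l k j
  · rw [← hU, hamConj_apply, norm_neg, norm_star, ← quad_conj h₁, ← quad_conj h₂]
    obtain ⟨b, j, hj⟩ := exists_emb (swapX y)
    rw [hj]
    exact h b (-l) (-k) j

/-- The vanishing second term puts the estimate in the two-source form expected by
`colNorm_le_of_quad`. -/
theorem IsHomSol.entry_bound {P U : OpArr d (ℤ ⊕ ℤ)} (h : IsHomSol ω N H P U)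
    (hB : IsBlockDiag H) (hH : HasHamForm H) (hP : HasHamForm P) (hN : 0 < N) (hc : 0 < c)
    (hnr : NonRes ω H N c) (l : Fin d → ℤ) (x y : ℤ ⊕ ℤ) :
    ‖U l x y‖ ≤ c⁻¹ * quad (fun x y => ‖P l x y‖) x y + 0 * quad (fun x y => ‖P l x y‖) x y :=
  entry_bound_of_upper h.1.conj hP.conj hP.conj (fun b l k j => by
    rw [zero_mul, add_zero]
    exact (norm_le_frob_rowBlk _ b k j).trans
      (h.frob_bound hB hH hP hN hc hnr b l (mem_blockIdx.2 rfl) (mem_blockIdx.2 rfl))) l x y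

theorem frob_hamBlk_sub_le {H₁ H₂ : OpArr d (ℤ ⊕ ℤ)} {η : ℝ}
    (h : ∀ x y, ‖(H₁ - H₂) 0 x y‖ ≤ η) (b : Bool) (α : ℕ) :
    ‖hamBlk b H₁ α - hamBlk b H₂ α‖ ≤ 4 * η := by
  have h1 : ∀ k : ℤ, ∑ j : blockIdx α, ‖(H₁ - H₂) 0 (emb b k) (emb b j)‖ ≤ η + η := fun k =>
    (sum_blockIdx_le (mem_blockIdx.2 (Int.natAbs_natCast α))
      (fun j => ‖(H₁ - H₂) 0 (emb b k) (emb b j)‖) fun _ => norm_nonneg _).trans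
      (add_le_add (h _ _) (h _ _))
  have hη : 0 ≤ η := (norm_nonneg _).trans (h (Sum.inl 0) (Sum.inl 0))
  calc _ ≤ ∑ k : blockIdx α, ∑ j : blockIdx α, ‖(H₁ - H₂) 0 (emb b k) (emb b j)‖ := frob_le_sum _
    _ ≤ ∑ _k : blockIdx α, (η + η) := Finset.sum_le_sum fun k _ => h1 k
    _ ≤ (η + η) + (η + η) := sum_blockIdx_le (mem_blockIdx.2 (Int.natAbs_natCast α))
      (fun _ => η + η) fun _ => by positivity
    _ = _ := by ring

/-- Variation of the solution of the homological equation. -/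
theorem IsHomSol.entry_bound_sub {ω₁ ω₂ : EuclideanSpace ℝ (Fin d)}
    {H₁ H₂ P₁ P₂ U₁ U₂ : OpArr d (ℤ ⊕ ℤ)} (h₁ : IsHomSol ω₁ N H₁ P₁ U₁)
    (h₂ : IsHomSol ω₂ N H₂ P₂ U₂) (hB₁ : IsBlockDiag H₁) (hB₂ : IsBlockDiag H₂)
    (hH₁ : HasHamForm H₁) (hH₂ : HasHamForm H₂) (hP₁ : HasHamForm P₁) (hP₂ : HasHamForm P₂)
    (hN : 0 < N) (hc : 0 < c) (hnr₁ : NonRes ω₁ H₁ N c) (hnr₂ : NonRes ω₂ H₂ N c) {η : ℝ}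
    (hη : ∀ x y, ‖(H₁ - H₂) 0 x y‖ ≤ η) (l : Fin d → ℤ) (x y : ℤ ⊕ ℤ) :
    ‖(U₁ - U₂) l x y‖ ≤ c⁻¹ * quad (fun x y => ‖(P₁ - P₂) l x y‖) x y +
      (c⁻¹ * (‖ω₁ - ω₂‖ * N + 8 * η) * c⁻¹) * quad (fun x y => ‖P₂ l x y‖) x y := by
  have hη0 : 0 ≤ η := (norm_nonneg _).trans (hη (Sum.inl 0) (Sum.inl 0))
  refine entry_bound_of_upper (h₁.1.sub h₂.1).conj (hP₁.sub hP₂).conj hP₂.conj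
    (fun b l k j => ?_) l x y
  set q₁ := quad (fun x y => ‖(P₁ - P₂) l x y‖) (Sum.inl k) (emb b j)
  set q₂ := quad (fun x y => ‖P₂ l x y‖) (Sum.inl k) (emb b j)
  have hq₁ : 0 ≤ q₁ := by simp only [q₁, quad]; positivity
  have hq₂ : 0 ≤ q₂ := by simp only [q₂, quad]; positivity
  refine (norm_le_frob_rowBlk _ b k j).trans ?_
  set β := k.natAbs
  set α := j.natAbs
  by_cases hl : freqNorm l < N ∧ ¬(b = false ∧ l = 0 ∧ β = α)
  · set D := rowBlk b (U₁ l) β α - rowBlk b (U₂ l) β α with hD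
    have hD' : rowBlk b ((U₁ - U₂) l) β α = D := rfl
    rw [hD']
    have e1 := h₁.solves.blk hB₁ b l β α
    have e2 := h₂.solves.blk hB₂ b l β α
    have hU₂ := h₂.frob_bound hB₂ hH₂ hP₂ hN hc hnr₂ b l (mem_blockIdx.2 rfl : k ∈ blockIdx β)
      (mem_blockIdx.2 rfl : j ∈ blockIdx α)
    -- Subtracting the two equations, `D` solves the one with coefficients at `ω₁`. Its sources are
    -- the variation of `P` and the variations of `ω·ℓ` and of the two blocks of `H`, applied to the
    -- solution at `ω₂`.
    have e3 : (freqDot ω₁ l : ℂ) • D + hamBlk false H₁ β * D - D * hamBlk b H₁ α =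
        (-Complex.I) • rowBlk b ((arrCut N (P₁ - P₂) - arrAvg (P₁ - P₂)) l) β α +
        ((((freqDot ω₂ l - freqDot ω₁ l : ℝ) : ℂ) • rowBlk b (U₂ l) β α -
          (hamBlk false H₁ β - hamBlk false H₂ β) * rowBlk b (U₂ l) β α) +
          rowBlk b (U₂ l) β α * (hamBlk b H₁ α - hamBlk b H₂ α)) := by
      have e4 : rowBlk b ((arrCut N (P₁ - P₂) - arrAvg (P₁ - P₂)) l) β α =
          rowBlk b ((arrCut N P₁ - arrAvg P₁) l) β α -
          rowBlk b ((arrCut N P₂ - arrAvg P₂) l) β α := by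
        rw [cut_sub_avg hP₁ hN, cut_sub_avg hP₂ hN, cut_sub_avg (hP₁.sub hP₂) hN]
        ext k j
        simp only [rowBlk, arrMask, Matrix.of_apply, Matrix.sub_apply, Pi.sub_apply]
        split_ifs <;> simp
      rw [e4, smul_sub (-Complex.I), ← e1, ← e2, hD, smul_sub, Matrix.mul_sub, Matrix.sub_mul, Matrix.sub_mul,
        Matrix.mul_sub, Complex.ofReal_sub, sub_smul]
      abel
    have h3 := hnr₁.blk_bound hH₁ hc.le hl.1 hl.2 D
    rw [e3] at h3
    have hfd : |freqDot ω₂ l - freqDot ω₁ l| ≤ ‖ω₁ - ω₂‖ * N := by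
      have : freqDot ω₂ l - freqDot ω₁ l = -freqDot (ω₁ - ω₂) l := by
        simp [freqDot, sub_mul]
      rw [this, abs_neg]
      refine (abs_freqDot_le _ l).trans ?_
      gcongr
      exact hl.1.le
    have hR := rowBlk_rhs_le (hP₁.sub hP₂) hN b l (mem_blockIdx.2 rfl : k ∈ blockIdx β)
      (mem_blockIdx.2 rfl : j ∈ blockIdx α)
    have hb1 := frob_hamBlk_sub_le hη false β
    have hb2 := frob_hamBlk_sub_le hη b α
    have e5 : c⁻¹ * q₁ + c⁻¹ * (‖ω₁ - ω₂‖ * N + 8 * η) * c⁻¹ * q₂ =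
        c⁻¹ * (q₁ + (‖ω₁ - ω₂‖ * N + 8 * η) * (c⁻¹ * q₂)) := by ring
    rw [e5, le_inv_mul_iff₀ hc]
    refine h3.trans ((norm_add_le _ _).trans (add_le_add ?_ ?_))
    · rw [norm_smul, norm_neg, Complex.norm_I, one_mul]; exact hR
    · calc _ ≤ |freqDot ω₂ l - freqDot ω₁ l| * ‖rowBlk b (U₂ l) β α‖ +
            ‖hamBlk false H₁ β - hamBlk false H₂ β‖ * ‖rowBlk b (U₂ l) β α‖ +
            ‖rowBlk b (U₂ l) β α‖ * ‖hamBlk b H₁ α - hamBlk b H₂ α‖ := by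
            refine (norm_add_le _ _).trans (add_le_add ((norm_sub_le _ _).trans (add_le_add ?_
              (frobenius_norm_mul _ _))) (frobenius_norm_mul _ _))
            rw [norm_smul, Complex.norm_real, Real.norm_eq_abs]
        _ ≤ (‖ω₁ - ω₂‖ * N) * (c⁻¹ * q₂) + (4 * η) * (c⁻¹ * q₂) + (c⁻¹ * q₂) * (4 * η) := by
            gcongr
        _ = _ := by ring
  · have : rowBlk b ((U₁ - U₂) l) β α = rowBlk b (U₁ l) β α - rowBlk b (U₂ l) β α := rfl
    rw [this, h₁.rowBlk_eq_zero hl, h₂.rowBlk_eq_zero hl, sub_zero, norm_zero]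
    have := norm_nonneg (ω₁ - ω₂)
    positivity

/-- Eigenvalues of the blocks of a small perturbation of a scalar block. -/
theorem blockEigs_ge {E : OpArr d (ℤ ⊕ ℤ)} {m : ℝ} {η : ℝ}
    (hη : ∀ x y, ‖(H - E) 0 x y‖ ≤ η) (hE : E = initialH d m (fun _ => 0)) {i : ℕ} {μ : ℝ}
    (hμ : μ ∈ blockEigs H i) : Real.sqrt ((i : ℝ) ^ 2 + m) - 8 * η ≤ μ := by
  have hη0 : 0 ≤ η := (norm_nonneg _).trans (hη (Sum.inl 0) (Sum.inl 0))
  set D := Real.sqrt ((i : ℝ) ^ 2 + m) with hD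
  have h1 : hamBlk false E i = algebraMap ℝ _ D := by
    ext k j
    have hk : ((k : ℤ) : ℝ) ^ 2 = (i : ℝ) ^ 2 := by
      have h : ((k : ℤ).natAbs : ℝ) = i := congrArg _ (mem_blockIdx.1 k.2)
      rw [← h, Nat.cast_natAbs, Int.cast_abs, sq_abs]
    simp only [hamBlk, Matrix.of_apply, hE, initialH_apply, emb, Sum.inl.injEq, true_and,
      Sum.elim_inl, hk, add_zero, Matrix.algebraMap_matrix_apply]
    by_cases hkj : k = j
    · subst hkj; simp [hD]
    · rw [if_neg hkj, if_neg fun h => hkj (Subtype.ext h.symm)]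
  have h2 : hamBlk false H i = algebraMap ℝ _ D + (hamBlk false H i - hamBlk false E i) := by
    rw [← h1]; abel
  have h3 : μ - D ∈ spectrum ℝ (hamBlk false H i - hamBlk false E i) := by
    have hμ' : μ ∈ spectrum ℝ (hamBlk false H i) := hμ
    rw [h2, ← spectrum.singleton_add_eq] at hμ'
    obtain ⟨a, ha, b, hb, hab⟩ := hμ'
    rw [Set.mem_singleton_iff] at ha
    have : μ - D = b := by rw [← hab, ha]; simp
    rwa [this]
  have h4 := spectrum.norm_le_norm_mul_of_mem h3
  have h5 := frob_hamBlk_sub_le hη false i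
  -- The Frobenius norm does not give the identity norm 1, and the bound on the spectrum by the norm
  -- carries this factor.
  have h6 : ‖(1 : Matrix (blockIdx i) (blockIdx i) ℂ)‖ ≤ 2 := by
    refine le_of_sq_le_sq ?_ (by norm_num)
    rw [frob_sq]
    have h7 : ∀ k : blockIdx i, ∑ j, ‖(1 : Matrix (blockIdx i) (blockIdx i) ℂ) k j‖ ^ 2 = 1 := by
      intro k
      rw [Finset.sum_eq_single k]
      · simp
      · intro j _ hj; simp [Matrix.one_apply_ne hj.symm]
      · simp
    simp only [h7]
    have := sum_blockIdx_le (mem_blockIdx.2 (Int.natAbs_natCast i)) (fun _ => (1 : ℝ))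
      fun _ => zero_le_one
    linarith
  have h8 : ‖μ - D‖ ≤ 4 * η * 2 := h4.trans (by gcongr)
  rw [Real.norm_eq_abs] at h8
  have := (abs_le.1 h8).1
  linarith

end blocks

end WaveKAM

namespace WaveKAM

/-! ### Decay norms of arrays -/

section decay
variable {d : ℕ}

/-- The absolute value of a space index. -/
def absX : ℤ ⊕ ℤ → ℕ := Sum.elim Int.natAbs Int.natAbs

theorem mag_eq_absX (x : ℤ ⊕ ℤ) : mag x = absX x := by
  rcases x with x | x <;> simp [mag, absX, Nat.cast_natAbs]

theorem tsum_absX_le (g : ℕ → ℝ≥0∞) : ∑' x : ℤ ⊕ ℤ, g (absX x) ≤ 4 * ∑' n, g n := by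
  have h1 : ∑' n : ℤ, g n.natAbs ≤ 2 * ∑' n, g n := by
    have hs : Function.Surjective (Sum.elim (fun n : ℕ => (n : ℤ)) fun n : ℕ => -(n : ℤ)) := by
      intro n
      rcases n.natAbs_eq with h | h
      · exact ⟨Sum.inl n.natAbs, h.symm⟩
      · exact ⟨Sum.inr n.natAbs, h.symm⟩
    refine (ENNReal.tsum_le_tsum_comp_of_surjective hs fun n : ℤ => g n.natAbs).trans ?_
    rw [ENNReal.summable.tsum_sum ENNReal.summable]
    simp [two_mul]
  rw [ENNReal.summable.tsum_sum ENNReal.summable]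
  simp only [absX, Sum.elim_inl, Sum.elim_inr]
  calc _ ≤ 2 * ∑' n, g n + 2 * ∑' n, g n := add_le_add h1 h1
    _ = _ := by ring

open scoped Matrix.Norms.L2Operator in
theorem norm_le_blockNorm (M : Matrix ℤ ℤ ℂ) (k j : ℤ) :
    ‖M k j‖ ≤ blockNorm M k.natAbs j.natAbs := by
  have hk : k ∈ blockIdx k.natAbs := mem_blockIdx.2 rfl
  have hj : j ∈ blockIdx j.natAbs := mem_blockIdx.2 rfl
  set B := block M k.natAbs j.natAbs with hB
  have h1 := Matrix.l2_opNorm_mulVec B (PiLp.single 2 (⟨j, hj⟩ : blockIdx j.natAbs) (1 : ℂ))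
  rw [PiLp.norm_single, norm_one, mul_one] at h1
  refine le_trans ?_ h1
  refine le_trans (le_of_eq ?_) (PiLp.norm_apply_le _ (⟨k, hk⟩ : blockIdx k.natAbs))
  simp [hB, block]

open scoped Matrix.Norms.L2Operator in
theorem blockNorm_nonneg (M : Matrix ℤ ℤ ℂ) (β α : ℕ) : 0 ≤ blockNorm M β α :=
  norm_nonneg (block M β α)

/-- At most four indices have a given absolute value, hence the factor 2 after the square root. The
relabelling `e` allows both `l - q.1` and `q.1 - l`, because the lower rows carry the opposite
frequency. -/
theorem ell2_block_le (s : ℝ) (A : OpArr d ℤ) (e : (Fin d → ℤ) ≃ (Fin d → ℤ))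
    (q : Idx d) (he : ∀ l x, japPair (l - q.1) x = japPair (e l) x) :
    ell2 (fun p : Idx d => wt s p q * ENNReal.ofReal (blockNorm (A (e p.1)) (absX p.2) (absX q.2)))
      ≤ 2 * decayNorm s A := by
  set α := absX q.2
  set G : (Fin d → ℤ) → ℕ → ℝ≥0∞ := fun l β => ENNReal.ofReal
    (japPair l ((β : ℝ) - (α : ℝ)) ^ (2 * s) * blockNorm (A l) β α ^ 2) with hG
  have h1 : ∀ p : Idx d, (wt s p q * ENNReal.ofReal (blockNorm (A (e p.1)) (absX p.2) α)) ^ 2 =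
      G (e p.1) (absX p.2) := fun p => by
    have h0 : 0 ≤ japPair (e p.1) ((absX p.2 : ℝ) - (α : ℝ)) :=
      zero_le_one.trans (one_le_japPair _ _)
    rw [wt, idxDist, he, mag_eq_absX, mag_eq_absX, ← ENNReal.ofReal_mul (Real.rpow_nonneg h0 _),
      ← ENNReal.ofReal_pow (mul_nonneg (Real.rpow_nonneg h0 _) (blockNorm_nonneg _ _ _)), mul_pow,
      ← Real.rpow_mul_natCast h0, mul_comm s]
    norm_num [hG, α]
  rw [ell2_le_iff]
  simp only [h1]
  have h2 : ∑' p : (Fin d → ℤ) × ℕ, G p.1 p.2 ≤ decayNorm s A ^ 2 := by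
    rw [← ennreal_rpow_half_sq (∑' p : (Fin d → ℤ) × ℕ, G p.1 p.2)]
    gcongr
    exact le_iSup (fun α : ℕ => (∑' p : (Fin d → ℤ) × ℕ,
      ENNReal.ofReal (japPair p.1 ((p.2 : ℝ) - (α : ℝ)) ^ (2 * s) *
        blockNorm (A p.1) p.2 α ^ 2)) ^ (1 / 2 : ℝ)) α
  calc ∑' p : Idx d, G (e p.1) (absX p.2) = ∑' l, ∑' x, G (e l) (absX x) :=
        ENNReal.tsum_prod (f := fun l x => G (e l) (absX x))
    _ ≤ ∑' l, 4 * ∑' n, G (e l) n := ENNReal.tsum_le_tsum fun l => tsum_absX_le _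
    _ = 4 * ∑' l, ∑' n, G l n := by rw [ENNReal.tsum_mul_left, e.tsum_eq fun l => ∑' n, G l n]
    _ = 4 * ∑' p : (Fin d → ℤ) × ℕ, G p.1 p.2 := by rw [ENNReal.tsum_prod (f := G)]
    _ ≤ 4 * decayNorm s A ^ 2 := by gcongr
    _ = _ := by ring

/-- The unweighted decay norms of the two upper entries, both among the terms of `hamNorm`, bound
the upper rows. The lower rows are the upper ones at frequency `-l`, which doubles the bound. -/
theorem colNorm_toep_le_hamNorm (s : ℝ) {P : OpArr d (ℤ ⊕ ℤ)} (hP : hamConj P = P) :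
    colNorm s (toep P) ≤ 4 * hamNorm s 1 0 P := by
  have hle : decayNorm s (diagPart P) + decayNorm s (antiPart P) ≤ hamNorm s 1 0 P := by
    unfold hamNorm
    refine add_le_add (le_add_left (le_add_right le_add_self)) (le_add_right le_add_self)
  refine le_trans (iSup_le fun q => ?_) (mul_le_mul_right hle 4)
  set B : (Fin d → ℤ) → Idx d → ℝ≥0∞ := fun l p =>
    ENNReal.ofReal (blockNorm (diagPart P l) (absX p.2) (absX q.2)) +
    ENNReal.ofReal (blockNorm (antiPart P l) (absX p.2) (absX q.2)) with hB
  have hle1 : ∀ l (x y : ℤ ⊕ ℤ), ‖P l x y‖ₑ ≤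
      (ENNReal.ofReal (blockNorm (diagPart P l) (absX x) (absX y)) +
        ENNReal.ofReal (blockNorm (antiPart P l) (absX x) (absX y))) +
      (ENNReal.ofReal (blockNorm (diagPart P (-l)) (absX x) (absX y)) +
        ENNReal.ofReal (blockNorm (antiPart P (-l)) (absX x) (absX y))) := by
    have hu : ∀ l (k : ℤ) (y : ℤ ⊕ ℤ), ‖P l (Sum.inl k) y‖ₑ ≤
        ENNReal.ofReal (blockNorm (diagPart P l) k.natAbs (absX y)) +
        ENNReal.ofReal (blockNorm (antiPart P l) k.natAbs (absX y)) := by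
      intro l k y
      rw [← ofReal_norm]
      rcases y with j | j
      · exact (ENNReal.ofReal_le_ofReal (norm_le_blockNorm (diagPart P l) k j)).trans le_self_add
      · exact (ENNReal.ofReal_le_ofReal (norm_le_blockNorm (antiPart P l) k j)).trans le_add_self
    intro l x y
    rcases x with k | k
    · exact (hu l k y).trans le_self_add
    · refine le_trans ?_ le_add_self
      have h1 : ‖P l (Sum.inr k) y‖ₑ = ‖P (-l) (Sum.inl (-k)) (swapX y)‖ₑ := by
        conv_lhs => rw [← hP, hamConj_apply]
        rw [enorm_neg, ← ofReal_norm, norm_star, ofReal_norm]; rfl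
      have h2 : absX (swapX y) = absX y := by rcases y with j | j <;> simp [swapX, absX]
      have h3 := hu (-l) (-k) (swapX y)
      rw [h2, Int.natAbs_neg] at h3
      rw [h1]; exact h3
  calc ell2 (fun p => wt s p q * ‖toep P p q‖ₑ)
      ≤ ell2 (fun p => (wt s p q * ENNReal.ofReal (blockNorm (diagPart P (Equiv.subRight q.1 p.1))
            (absX p.2) (absX q.2)) +
          wt s p q * ENNReal.ofReal (blockNorm (antiPart P (Equiv.subRight q.1 p.1))
            (absX p.2) (absX q.2))) +
          (wt s p q * ENNReal.ofReal (blockNorm (diagPart P (Equiv.subLeft q.1 p.1))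
            (absX p.2) (absX q.2)) +
          wt s p q * ENNReal.ofReal (blockNorm (antiPart P (Equiv.subLeft q.1 p.1))
            (absX p.2) (absX q.2)))) := by
        refine ell2_mono fun p => ?_
        rw [← mul_add, ← mul_add, ← mul_add]
        gcongr
        have := hle1 (p.1 - q.1) p.2 q.2
        rwa [neg_sub] at this
    _ ≤ (2 * decayNorm s (diagPart P) + 2 * decayNorm s (antiPart P)) +
        (2 * decayNorm s (diagPart P) + 2 * decayNorm s (antiPart P)) := by
        have e1 : ∀ l x, japPair (l - q.1) x = japPair (Equiv.subRight q.1 l) x := fun l x => rfl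
        have e2 : ∀ l x, japPair (l - q.1) x = japPair (Equiv.subLeft q.1 l) x := fun l x => by
          rw [Equiv.subLeft_apply, ← neg_sub, japPair_neg_left]
        exact (ell2_add_le _ _).trans (add_le_add
          ((ell2_add_le _ _).trans (add_le_add (ell2_block_le s _ _ q e1) (ell2_block_le s _ _ q e1)))
          ((ell2_add_le _ _).trans (add_le_add (ell2_block_le s _ _ q e2) (ell2_block_le s _ _ q e2))))
    _ = _ := by ring

end decay

/-! ### Consequences of entrywise estimates -/

section entrywise
variable {d : ℕ}

theorem wt_flip_left (s : ℝ) (p q : Idx d) : wt s (flipIdx p) q = wt s p q := by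
  have h : flipIdx p = (p.1, flipX p.2) := rfl
  rw [wt, wt, idxDist, idxDist, h, mag_flipX]

theorem wt_flip_right (s : ℝ) (p q : Idx d) : wt s p (flipIdx q) = wt s p q := by
  rw [wt_comm, wt_flip_left, wt_comm]

theorem ell2_flip_le (s : ℝ) (a : Idx d → Idx d → ℂ) (q : Idx d) :
    ell2 (fun p => wt s p q * ‖a (flipIdx p) q‖ₑ) ≤ colNorm s a := by
  refine le_trans (le_of_eq ?_) (le_colNorm s a q)
  rw [← ell2_equiv flipIdx]
  simp only [wt_flip_left, flipIdx_flipIdx]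

theorem ell2_quad_le (s : ℝ) (P : OpArr d (ℤ ⊕ ℤ)) (q : Idx d) :
    ell2 (fun p => wt s p q * ENNReal.ofReal (quad (fun x y => ‖P (p.1 - q.1) x y‖) p.2 q.2)) ≤
      4 * colNorm s (toep P) := by
  calc _ = ell2 (fun p => ((wt s p q * ‖toep P p q‖ₑ + wt s p q * ‖toep P (flipIdx p) q‖ₑ) +
          wt s p (flipIdx q) * ‖toep P p (flipIdx q)‖ₑ) +
          wt s p (flipIdx q) * ‖toep P (flipIdx p) (flipIdx q)‖ₑ) := by
        congr 1; ext p
        rw [wt_flip_right, quad, ENNReal.ofReal_add (by positivity) (by positivity),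
          ENNReal.ofReal_add (by positivity) (by positivity),
          ENNReal.ofReal_add (by positivity) (by positivity)]
        simp only [ofReal_norm, mul_add, toep, flipIdx]
        rfl
    _ ≤ ((colNorm s (toep P) + colNorm s (toep P)) + colNorm s (toep P)) + colNorm s (toep P) :=
        (ell2_add_le _ _).trans (add_le_add ((ell2_add_le _ _).trans (add_le_add
          ((ell2_add_le _ _).trans (add_le_add (le_colNorm s _ q) (ell2_flip_le s _ q)))
          (le_colNorm s _ (flipIdx q)))) (ell2_flip_le s _ (flipIdx q)))
    _ = _ := by ring

/-- The weights depend on the space indices only through their absolute values, so each of the four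
reflected terms of `quad` has column norm at most that of the array. -/
theorem colNorm_le_of_quad {s : ℝ} {V P₁ P₂ : OpArr d (ℤ ⊕ ℤ)} {C₁ C₂ : ℝ} (h₁ : 0 ≤ C₁)
    (h₂ : 0 ≤ C₂) (h : ∀ l x y, ‖V l x y‖ ≤
      C₁ * quad (fun x y => ‖P₁ l x y‖) x y + C₂ * quad (fun x y => ‖P₂ l x y‖) x y) :
    colNorm s (toep V) ≤ ENNReal.ofReal (4 * C₁) * colNorm s (toep P₁) +
      ENNReal.ofReal (4 * C₂) * colNorm s (toep P₂) := by
  refine iSup_le fun q => ?_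
  calc ell2 (fun p => wt s p q * ‖toep V p q‖ₑ) ≤ ell2 (fun p =>
        ENNReal.ofReal C₁ * (wt s p q *
          ENNReal.ofReal (quad (fun x y => ‖P₁ (p.1 - q.1) x y‖) p.2 q.2)) +
        ENNReal.ofReal C₂ * (wt s p q *
          ENNReal.ofReal (quad (fun x y => ‖P₂ (p.1 - q.1) x y‖) p.2 q.2))) := by
        refine ell2_mono fun p => ?_
        rw [mul_left_comm, mul_left_comm (ENNReal.ofReal C₂), ← mul_add, ← ofReal_norm,
          ← ENNReal.ofReal_mul h₁, ← ENNReal.ofReal_mul h₂]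
        gcongr
        exact (ENNReal.ofReal_le_ofReal (h _ _ _)).trans ENNReal.ofReal_add_le
    _ ≤ ENNReal.ofReal C₁ * (4 * colNorm s (toep P₁)) +
        ENNReal.ofReal C₂ * (4 * colNorm s (toep P₂)) := by
        refine (ell2_add_le _ _).trans ?_
        rw [ell2_const_mul, ell2_const_mul]
        gcongr <;> exact ell2_quad_le s _ q
    _ = _ := by
        rw [ENNReal.ofReal_mul (by norm_num), ENNReal.ofReal_mul (by norm_num)]
        norm_num; ring

theorem colNorm_mask_le (s : ℝ) (c : (Fin d → ℤ) → ℤ ⊕ ℤ → ℤ ⊕ ℤ → Prop)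
    (A : OpArr d (ℤ ⊕ ℤ)) : colNorm s (toep (arrMask c A)) ≤ colNorm s (toep A) :=
  colNorm_le_of_enorm_le fun p q => by
    rw [← ofReal_norm, ← ofReal_norm]
    exact ENNReal.ofReal_le_ofReal (norm_mask_le c A _ _ _)

theorem arrMask_sub (c : (Fin d → ℤ) → ℤ ⊕ ℤ → ℤ ⊕ ℤ → Prop) (A B : OpArr d (ℤ ⊕ ℤ)) :
    arrMask c (A - B) = arrMask c A - arrMask c B := by
  ext l x y
  simp only [arrMask, Matrix.of_apply, Pi.sub_apply, Matrix.sub_apply]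
  split_ifs <;> simp

/-- Smoothing estimate for the high frequencies. -/
theorem colNorm_high_le {s t N : ℝ} (hst : s ≤ t) (hN : 1 ≤ N) (A : OpArr d (ℤ ⊕ ℤ)) :
    colNorm s (toep (arrMask (fun l _ _ => ¬freqNorm l < N) A)) ≤
      ENNReal.ofReal (N ^ (s - t)) * colNorm t (toep A) := by
  refine iSup_le fun q => ?_
  refine le_trans ?_ (mul_le_mul_right (le_colNorm t (toep A) q) _)
  rw [← ell2_const_mul]
  refine ell2_mono fun p => ?_
  simp only [toep, arrMask, Matrix.of_apply]
  split_ifs with h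
  · simp
  · rw [← mul_assoc]
    gcongr
    rw [show s = (s - t) + t by ring, ← wt_mul, show s - t + t - t = s - t by ring]
    gcongr
    refine ENNReal.ofReal_le_ofReal (Real.rpow_le_rpow_of_nonpos (by linarith) ?_ (by linarith))
    exact (not_lt.1 h).trans (freqNorm_le_japPair _ _)

/-- The derivative of a trigonometric polynomial is bounded. The iteration needs only its
finiteness, because this term cancels in the new perturbation. -/
theorem colNorm_arrDeriv_le {s N : ℝ} (ω : EuclideanSpace ℝ (Fin d)) {U : OpArr d (ℤ ⊕ ℤ)}
    (hU : ∀ l, N ≤ freqNorm l → U l = 0) :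
    colNorm s (toep (arrDeriv ω U)) ≤ ENNReal.ofReal (‖ω‖ * N) * colNorm s (toep U) := by
  have h : ∀ p q : Idx d, ‖toep (arrDeriv ω U) p q‖ₑ ≤ ‖toep (((‖ω‖ * N : ℝ) : ℂ) • U) p q‖ₑ := by
    intro p q
    simp only [toep, arrDeriv, Pi.smul_apply, Matrix.smul_apply, smul_eq_mul, enorm_mul]
    by_cases hl : freqNorm (p.1 - q.1) < N
    · gcongr
      rw [← ofReal_norm, ← ofReal_norm, ← ofReal_norm, ← ENNReal.ofReal_mul (norm_nonneg _)]
      refine ENNReal.ofReal_le_ofReal ?_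
      rw [Complex.norm_I, one_mul, Complex.norm_real, Complex.norm_real, Real.norm_eq_abs,
        Real.norm_eq_abs]
      refine ((abs_freqDot_le ω _).trans ?_).trans (le_abs_self _)
      gcongr
    · rw [hU _ (not_lt.1 hl)]; simp
  refine (colNorm_le_of_enorm_le h).trans (le_of_eq ?_)
  rw [toep_smul, colNorm_smul, ← ofReal_norm, Complex.norm_real, Real.norm_eq_abs]
  by_cases hN : 0 ≤ N
  · rw [abs_of_nonneg (by positivity)]
  · have : U = 0 := by
      ext1 l; exact hU l ((not_le.1 hN).le.trans (freqNorm_nonneg l))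
    have h0 : colNorm s (toep (0 : OpArr d (ℤ ⊕ ℤ))) = 0 := by simp [colNorm, toep_zero, ell2]
    rw [this, h0, mul_zero, mul_zero]

end entrywise

end WaveKAM

namespace WaveKAM

/-! ### Lipschitz families of arrays and the estimates of one step -/

section liparr
variable {d : ℕ} {γ : ℝ} {S : Set (EuclideanSpace ℝ (Fin d))}

/-- The Lipschitz decay norm of a family of arrays. -/
noncomputable def arrLip (γ : ℝ) (S : Set (EuclideanSpace ℝ (Fin d))) (t : ℝ)
    (A : EuclideanSpace ℝ (Fin d) → OpArr d (ℤ ⊕ ℤ)) : ℝ≥0∞ :=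
  lipNorm γ S (fun A => colNorm t (toep A)) A

theorem arrLip_eq_of_isOpOf {T : EuclideanSpace ℝ (Fin d) → BOp d}
    {A : EuclideanSpace ℝ (Fin d) → OpArr d (ℤ ⊕ ℤ)} (h : ∀ ω ∈ S, IsOpOf (T ω) (A ω)) (t : ℝ) :
    lipNorm γ S (fun T : BOp d => colNorm t (ent T)) T = arrLip γ S t A := by
  refine le_antisymm ?_ ?_
  · refine (lipNorm_le_mul (C := 1) (fun ω hω => ?_) fun ω₁ h₁ ω₂ h₂ => ?_).trans_eq (one_mul _)
    · rw [one_mul, h ω hω]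
    · rw [one_mul, (h ω₁ h₁).sub (h ω₂ h₂)]
  · refine (lipNorm_le_mul (C := 1) (fun ω hω => ?_) fun ω₁ h₁ ω₂ h₂ => ?_).trans_eq (one_mul _)
    · rw [one_mul, h ω hω]
    · rw [one_mul, (h ω₁ h₁).sub (h ω₂ h₂)]

theorem colNorm_le_arrLip {A : EuclideanSpace ℝ (Fin d) → OpArr d (ℤ ⊕ ℤ)} {ω} (hω : ω ∈ S)
    (t : ℝ) : colNorm t (toep (A ω)) ≤ arrLip γ S t A :=
  le_lipNorm (N := fun A => colNorm t (toep A)) A hω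

theorem arrLip_mono {A : EuclideanSpace ℝ (Fin d) → OpArr d (ℤ ⊕ ℤ)} {t t' : ℝ} (h : t ≤ t') :
    arrLip γ S t A ≤ arrLip γ S t' A := by
  refine (lipNorm_le_mul (C := 1) (fun ω _ => ?_) fun ω₁ _ ω₂ _ => ?_).trans_eq (one_mul _)
  · rw [one_mul]; exact colNorm_mono h _
  · rw [one_mul]; exact colNorm_mono h _

theorem exists_isOpOf_family {A : EuclideanSpace ℝ (Fin d) → OpArr d (ℤ ⊕ ℤ)} {t : ℝ}
    (ht : sZero d ≤ t) (h : ∀ ω ∈ S, colNorm t (toep (A ω)) < ⊤) :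
    ∃ T : EuclideanSpace ℝ (Fin d) → BOp d, ∀ ω ∈ S, IsOpOf (T ω) (A ω) := by
  classical
  have : ∀ ω, ∃ T : BOp d, ω ∈ S → IsOpOf T (A ω) := fun ω => by
    by_cases hω : ω ∈ S
    · obtain ⟨T, hT⟩ := exists_isOpOf ((colNorm_mono ht _).trans_lt (h ω hω))
      exact ⟨T, fun _ => hT⟩
    · exact ⟨0, fun h => absurd h hω⟩
  choose T hT using this
  exact ⟨T, hT⟩

theorem arrLip_mask_le (t : ℝ) (c : (Fin d → ℤ) → ℤ ⊕ ℤ → ℤ ⊕ ℤ → Prop)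
    (A : EuclideanSpace ℝ (Fin d) → OpArr d (ℤ ⊕ ℤ)) :
    arrLip γ S t (fun ω => arrMask c (A ω)) ≤ arrLip γ S t A := by
  refine (lipNorm_le_mul (C := 1) (fun ω _ => ?_) fun ω₁ _ ω₂ _ => ?_).trans_eq (one_mul _)
  · rw [one_mul]; exact colNorm_mask_le t c _
  · rw [one_mul, ← arrMask_sub]; exact colNorm_mask_le t c _

theorem arrLip_high_le {s t N : ℝ} (hst : s ≤ t) (hN : 1 ≤ N)
    (A : EuclideanSpace ℝ (Fin d) → OpArr d (ℤ ⊕ ℤ)) :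
    arrLip γ S s (fun ω => arrMask (fun l _ _ => ¬freqNorm l < N) (A ω)) ≤
      ENNReal.ofReal (N ^ (s - t)) * arrLip γ S t A :=
  lipNorm_le_mul (fun ω _ => colNorm_high_le hst hN _) fun ω₁ _ ω₂ _ => by
    rw [← arrMask_sub]; exact colNorm_high_le hst hN _

/-- The conjugation estimate holds uniformly for `tX` with `t` in the unit interval; averaging costs
a factor 2, so 8 becomes 16. -/
theorem IsTame.lip_avgConj_sub {K : ℝ≥0∞} {hi lo : BOp d → ℝ≥0∞} (h : IsTame K hi lo)
    (hγ : 0 < γ) {X W : EuclideanSpace ℝ (Fin d) → BOp d}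
    (hX : 2 * K * lipNorm γ S lo X ≤ 2⁻¹) :
    lipNorm γ S hi (fun ω => avgConj (X ω) (W ω) - W ω) ≤
      16 * K * (lipNorm γ S hi X * lipNorm γ S lo W + lipNorm γ S lo X * lipNorm γ S hi W) := by
  simp only [avgConj_sub_self]
  refine (lipNorm_integral_le h.hi_norm (c := 8 * K * (lipNorm γ S hi X * lipNorm γ S lo W +
    lipNorm γ S lo X * lipNorm γ S hi W)) (fun ω => (continuous_exp_smul_conj _ _).sub
      continuous_const) (fun t ht => ?_) hγ).trans_eq (by ring)
  have ht1 : ‖(t : ℂ)‖ₑ ≤ 1 := by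
    rw [← ofReal_norm, Complex.norm_real, Real.norm_of_nonneg ht.1]
    exact ENNReal.ofReal_le_one.2 ht.2
  have h1 : lipNorm γ S lo (fun ω => (t : ℂ) • X ω) ≤ lipNorm γ S lo X :=
    (lipNorm_smul_le h.lo_norm _ X).trans (mul_le_of_le_one_left' ht1)
  have h2 : lipNorm γ S hi (fun ω => (t : ℂ) • X ω) ≤ lipNorm γ S hi X :=
    (lipNorm_smul_le h.hi_norm _ X).trans (mul_le_of_le_one_left' ht1)
  refine (h.lip_conj_sub (le_trans (by gcongr) hX)).trans ?_
  gcongr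

theorem lipNorm_I_smul_le {R : Type*} [NormedAddCommGroup R] [NormedSpace ℂ R] {N : R → ℝ≥0∞}
    (hN : IsExtNorm N) (f : EuclideanSpace ℝ (Fin d) → R) :
    lipNorm γ S N (fun ω => Complex.I • f ω) ≤ lipNorm γ S N f :=
  (lipNorm_smul_le hN _ f).trans_eq (by rw [← ofReal_norm, Complex.norm_I]; simp)

/-- The constant 24 adds 16 for the averaged conjugation of `b` and 8 for the conjugation of `p`.
The last term is linear and must be small for another reason, namely its high frequencies. -/
theorem IsTame.lip_stepOp {K : ℝ≥0∞} {hi lo : BOp d → ℝ≥0∞} (h : IsTame K hi lo)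
    (hγ : 0 < γ) {u p b a : EuclideanSpace ℝ (Fin d) → BOp d}
    (hu : 2 * K * lipNorm γ S lo u ≤ 2⁻¹) (hb_lo : lipNorm γ S lo b ≤ lipNorm γ S lo p)
    (hb_hi : lipNorm γ S hi b ≤ lipNorm γ S hi p) :
    lipNorm γ S hi (fun ω => stepOp (u ω) (p ω) (b ω) (a ω)) ≤
      24 * K * (lipNorm γ S hi u * lipNorm γ S lo p + lipNorm γ S lo u * lipNorm γ S hi p) +
      lipNorm γ S hi (fun ω => p ω + b ω - a ω) := by
  have h1 := lipNorm_I_smul_le (γ := γ) (S := S) h.lo_norm u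
  have h2 := lipNorm_I_smul_le (γ := γ) (S := S) h.hi_norm u
  have h3 : 2 * K * lipNorm γ S lo (fun ω => Complex.I • u ω) ≤ 2⁻¹ := le_trans (by gcongr) hu
  have h4 := h.lip_avgConj_sub hγ (W := b) h3
  have h5 := h.lip_conj_sub (a := p) h3
  unfold stepOp
  refine (lipNorm_add_le h.hi_norm _ _).trans (add_le_add ?_ le_rfl)
  refine (lipNorm_add_le h.hi_norm _ _).trans ?_
  calc _ ≤ 16 * K * (lipNorm γ S hi u * lipNorm γ S lo p + lipNorm γ S lo u * lipNorm γ S hi p) +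
        8 * K * (lipNorm γ S hi u * lipNorm γ S lo p + lipNorm γ S lo u * lipNorm γ S hi p) :=
        add_le_add (h4.trans (by gcongr)) (h5.trans (by gcongr))
    _ = _ := by ring

/-- Estimate of the solution of the homological equation. -/
theorem arrLip_homSol_le {H P U : EuclideanSpace ℝ (Fin d) → OpArr d (ℤ ⊕ ℤ)} {N c η : ℝ}
    (hsol : ∀ ω ∈ S, IsHomSol ω N (H ω) (P ω) (U ω)) (hB : ∀ ω ∈ S, IsBlockDiag (H ω))
    (hH : ∀ ω ∈ S, HasHamForm (H ω)) (hP : ∀ ω ∈ S, HasHamForm (P ω)) (hN : 0 < N) (hc : 0 < c)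
    (hγ : 0 < γ) (hη : 0 ≤ η) (hnr : ∀ ω ∈ S, NonRes ω (H ω) N c)
    (hlip : ∀ ω₁ ∈ S, ∀ ω₂ ∈ S, ∀ x y, ‖(H ω₁ - H ω₂) 0 x y‖ ≤ η * ‖ω₁ - ω₂‖) (t : ℝ) :
    arrLip γ S t U ≤
      ENNReal.ofReal (4 * c⁻¹ + γ * (4 * (c⁻¹ * (N + 8 * η) * c⁻¹))) * arrLip γ S t P := by
  rw [arrLip, arrLip, lipNorm_eq, lipNorm_eq]
  set M : OpArr d (ℤ ⊕ ℤ) → ℝ≥0∞ := fun A => colNorm t (toep A)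
  set Λ := 4 * (c⁻¹ * (N + 8 * η) * c⁻¹) with hΛ
  have hΛ0 : 0 ≤ Λ := by positivity
  have h1 : supSemi S M U ≤ ENNReal.ofReal (4 * c⁻¹) * supSemi S M P := supSemi_le fun ω hω => by
    have := colNorm_le_of_quad (s := t) (inv_nonneg.2 hc.le) le_rfl
      ((hsol ω hω).entry_bound (hB ω hω) (hH ω hω) (hP ω hω) hN hc (hnr ω hω))
    simp only [mul_zero, ENNReal.ofReal_zero, zero_mul, add_zero] at this
    refine this.trans ?_
    gcongr
    exact le_supSemi (N := M) P hω
  -- The second term, quadratic in `c⁻¹`, comes from the variation of the divisors with the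
  -- frequency.
  have h2 : lipSemi S M U ≤ ENNReal.ofReal (4 * c⁻¹) * lipSemi S M P +
      ENNReal.ofReal Λ * supSemi S M P := lipSemi_le fun ω₁ hω₁ ω₂ hω₂ hne => by
    have := colNorm_le_of_quad (s := t) (inv_nonneg.2 hc.le) (by positivity)
      ((hsol ω₁ hω₁).entry_bound_sub (hsol ω₂ hω₂) (hB ω₁ hω₁) (hB ω₂ hω₂) (hH ω₁ hω₁) (hH ω₂ hω₂)
        (hP ω₁ hω₁) (hP ω₂ hω₂) hN hc (hnr ω₁ hω₁) (hnr ω₂ hω₂) (hlip ω₁ hω₁ ω₂ hω₂))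
    refine this.trans ?_
    rw [add_mul]
    refine add_le_add ?_ ?_
    · rw [mul_assoc]
      gcongr
      exact le_lipSemi (N := M) P hω₁ hω₂ hne
    · have e : 4 * (c⁻¹ * (‖ω₁ - ω₂‖ * N + 8 * (η * ‖ω₁ - ω₂‖)) * c⁻¹) = Λ * ‖ω₁ - ω₂‖ := by
        rw [hΛ]; ring
      rw [e, ENNReal.ofReal_mul hΛ0, mul_right_comm]
      gcongr
      exact le_supSemi (N := M) P hω₂
  rw [ENNReal.ofReal_add (by positivity) (by positivity), ENNReal.ofReal_mul hγ.le]
  calc _ ≤ ENNReal.ofReal (4 * c⁻¹) * supSemi S M P + ENNReal.ofReal γ *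
        (ENNReal.ofReal (4 * c⁻¹) * lipSemi S M P + ENNReal.ofReal Λ * supSemi S M P) := by gcongr
    _ = ENNReal.ofReal (4 * c⁻¹) * (supSemi S M P + ENNReal.ofReal γ * lipSemi S M P) +
        ENNReal.ofReal γ * ENNReal.ofReal Λ * supSemi S M P := by ring
    _ ≤ ENNReal.ofReal (4 * c⁻¹) * (supSemi S M P + ENNReal.ofReal γ * lipSemi S M P) +
        ENNReal.ofReal γ * ENNReal.ofReal Λ *
          (supSemi S M P + ENNReal.ofReal γ * lipSemi S M P) := by
        gcongr; exact le_self_add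
    _ = _ := by ring

theorem arrMul_smul_left (c : ℂ) (A B : OpArr d (ℤ ⊕ ℤ)) : arrMul (c • A) B = c • arrMul A B := by
  refine toep_injective ?_
  ext p q
  simp only [toep_arrMul, toep_smul, Pi.smul_apply, smul_eq_mul, mul_assoc, tsum_mul_left]

theorem arrMul_smul_right (c : ℂ) (A B : OpArr d (ℤ ⊕ ℤ)) : arrMul A (c • B) = c • arrMul A B := by
  refine toep_injective ?_
  ext p q
  simp only [toep_arrMul, toep_smul, Pi.smul_apply, smul_eq_mul, mul_left_comm _ c, tsum_mul_left]

theorem add_avg_sub_cut_sub_avg (N : ℝ) (P : OpArr d (ℤ ⊕ ℤ)) :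
    P + (arrAvg P - arrCut N P) - arrAvg P = arrMask (fun l _ _ => ¬freqNorm l < N) P := by
  rw [arrCut_eq_mask]
  ext l x y
  simp only [arrMask, Matrix.of_apply, Pi.sub_apply, Pi.add_apply, Matrix.sub_apply,
    Matrix.add_apply]
  split_ifs <;> ring

/-- One step of the iteration for families of arrays. -/
theorem kam_step {K : ℝ≥0∞} {s t : ℝ} (hK : 1 ≤ K)
    (hts : t ≤ s) (ht : sZero d ≤ t)
    (hT : IsTame K (fun T : BOp d => colNorm s (ent T)) (fun T => colNorm t (ent T)))
    {H P U : EuclideanSpace ℝ (Fin d) → OpArr d (ℤ ⊕ ℤ)} {N : ℝ}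
    (hsol : ∀ ω ∈ S, IsHomSol ω N (H ω) (P ω) (U ω)) (hB : ∀ ω ∈ S, IsBlockDiag (H ω))
    (hP : ∀ ω ∈ S, HasHamForm (P ω)) (hN : 1 ≤ N) (hγ : 0 < γ)
    (hPlo : arrLip γ S t P < ⊤)
    (hU : 2 * K * arrLip γ S t U ≤ 2⁻¹) :
    (∀ ω ∈ S, HasHamForm (pushHam ω (U ω) (H ω + P ω) - (H ω + arrAvg (P ω)))) ∧
    arrLip γ S t (fun ω => pushHam ω (U ω) (H ω + P ω) - (H ω + arrAvg (P ω))) ≤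
      48 * K * (arrLip γ S t U * arrLip γ S t P) +
        ENNReal.ofReal (N ^ (t - s)) * arrLip γ S s P ∧
    arrLip γ S s (fun ω => pushHam ω (U ω) (H ω + P ω) - (H ω + arrAvg (P ω))) ≤
      24 * K * (arrLip γ S s U * arrLip γ S t P + arrLip γ S t U * arrLip γ S s P) +
        arrLip γ S s P := by
  have hN0 : 0 < N := by linarith
  have hUfin : arrLip γ S t U < ⊤ := by
    rcases eq_or_ne (arrLip γ S t U) ⊤ with h | h
    · rw [h, ENNReal.mul_top (by
        have : K ≠ 0 := fun h => by simp [h] at hK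
        simp [this]), top_le_iff] at hU
      simp at hU
    · exact h.lt_top
  obtain ⟨u, hu⟩ := exists_isOpOf_family (S := S) (A := U) ht
    fun ω hω => (colNorm_le_arrLip hω t).trans_lt hUfin
  obtain ⟨p, hp⟩ := exists_isOpOf_family (S := S) (A := P) ht
    fun ω hω => (colNorm_le_arrLip hω t).trans_lt hPlo
  obtain ⟨a, ha⟩ := exists_isOpOf_family (S := S) (A := fun ω => arrAvg (P ω)) ht fun ω hω => by
    rw [arrAvg_eq_mask (hP ω hω)]
    exact (colNorm_mask_le t _ _).trans_lt ((colNorm_le_arrLip hω t).trans_lt hPlo)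
  -- Up to sign, `b` is `P` restricted to a set of entries; hence its norms never exceed those of
  -- `P`.
  have hbm : ∀ ω ∈ S, arrAvg (P ω) - arrCut N (P ω) =
      -arrMask (fun l x y => freqNorm l < N ∧ ¬avgCond l x y) (P ω) := fun ω hω => by
    rw [← cut_sub_avg (hP ω hω) hN0, neg_sub]
  obtain ⟨g, hg⟩ := exists_isOpOf_family (S := S)
    (A := fun ω => arrMask (fun l x y => freqNorm l < N ∧ ¬avgCond l x y) (P ω)) ht fun ω hω =>
    (colNorm_mask_le t _ _).trans_lt ((colNorm_le_arrLip hω t).trans_lt hPlo)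
  have hb : ∀ ω ∈ S, IsOpOf (-g ω) (arrAvg (P ω) - arrCut N (P ω)) := fun ω hω => by
    rw [hbm ω hω]; exact (hg ω hω).neg
  obtain ⟨D, hD⟩ := exists_isOpOf_family (S := S) (A := fun ω => arrDeriv ω (U ω)) ht fun ω hω =>
    (colNorm_arrDeriv_le ω (hsol ω hω).2.1).trans_lt
      (ENNReal.mul_lt_top ENNReal.ofReal_lt_top ((colNorm_le_arrLip hω t).trans_lt hUfin))
  have hstep : ∀ ω ∈ S, IsOpOf (stepOp (u ω) (p ω) (-g ω) (a ω))
      (pushHam ω (U ω) (H ω + P ω) - (H ω + arrAvg (P ω))) := fun ω hω => by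
    refine isOpOf_pushHam_sub (hB ω hω) (hu ω hω) (hp ω hω) (ha ω hω) (hD ω hω) ?_
    have h1 := (hD ω hω).add (hb ω hω)
    -- This is the homological equation solved for the commutator: it is bounded although `H` is
    -- not.
    have h2 : arrDeriv ω (U ω) + (arrAvg (P ω) - arrCut N (P ω)) =
        arrMul (Complex.I • U ω) (H ω) - arrMul (H ω) (Complex.I • U ω) := by
      rw [(hsol ω hω).2.2.2, arrMul_smul_left, arrMul_smul_right, smul_sub]
      abel
    rwa [h2] at h1
  have hlipb : ∀ r, lipNorm γ S (fun T : BOp d => colNorm r (ent T)) (fun ω => -g ω) ≤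
      lipNorm γ S (fun T : BOp d => colNorm r (ent T)) p := fun r => by
    rw [arrLip_eq_of_isOpOf hp]
    refine le_trans ?_ (arrLip_mask_le r (fun l x y => freqNorm l < N ∧ ¬avgCond l x y) P)
    rw [← arrLip_eq_of_isOpOf hg]
    have := lipNorm_smul_le (γ := γ) (S := S) (isExtNorm_colNorm (d := d) r) (-1) g
    simpa using this
  have hhigh : ∀ ω ∈ S, IsOpOf (p ω + -g ω - a ω)
      (arrMask (fun l _ _ => ¬freqNorm l < N) (P ω)) := fun ω hω => by
    rw [← add_avg_sub_cut_sub_avg]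
    exact ((hp ω hω).add (hb ω hω)).sub (ha ω hω)
  have hU' : 2 * K * lipNorm γ S (fun T : BOp d => colNorm t (ent T)) u ≤ 2⁻¹ := by
    rwa [arrLip_eq_of_isOpOf hu]
  refine ⟨fun ω hω => ?_, ?_, ?_⟩
  · exact hasHamForm_stepOp (hu ω hω) (hp ω hω) (hb ω hω) (ha ω hω) (hstep ω hω) (hsol ω hω).1
      (hP ω hω) ((hP ω hω).avg.sub ((hP ω hω).cut N)) (hP ω hω).avg
  · rw [← arrLip_eq_of_isOpOf hstep]
    refine (hT.low.lip_stepOp hγ hU' (hlipb t) (hlipb t)).trans ?_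
    rw [arrLip_eq_of_isOpOf hu, arrLip_eq_of_isOpOf hp, arrLip_eq_of_isOpOf hhigh]
    refine add_le_add (le_of_eq (by ring)) (arrLip_high_le hts hN P)
  · rw [← arrLip_eq_of_isOpOf hstep]
    refine (hT.lip_stepOp hγ hU' (hlipb t) (hlipb s)).trans ?_
    rw [arrLip_eq_of_isOpOf hu, arrLip_eq_of_isOpOf hp, arrLip_eq_of_isOpOf hu,
      arrLip_eq_of_isOpOf hp, arrLip_eq_of_isOpOf hhigh]
    exact add_le_add le_rfl (arrLip_mask_le s _ P)

end liparr

end WaveKAM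

namespace WaveKAM

/-! ### The scales -/

section scales

/-- `N₀ ^ ((2/3) (3/2)^n)`. -/
noncomputable def scaleM (N₀ : ℕ) (n : ℕ) : ℝ := (N₀ : ℝ) ^ ((2 / 3 : ℝ) * (3 / 2 : ℝ) ^ n)

theorem scaleM_succ (N₀ n : ℕ) : scaleM N₀ (n + 1) = scaleN N₀ n := by
  rw [scaleM, scaleN, pow_succ]; congr 1; ring

theorem scaleN_eq (N₀ n : ℕ) : scaleN N₀ n = scaleM N₀ n ^ (3 / 2 : ℝ) := by
  rw [scaleM, scaleN, ← Real.rpow_mul (by positivity)]; congr 1; ring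

/-- The threshold 8 is chosen so that `8^{2/3} = 4`; then `M^{1/2} ≥ 2` pays for the two terms of
each step. -/
theorem four_le_scaleM {N₀ : ℕ} (h : 8 ≤ N₀) (n : ℕ) : 4 ≤ scaleM N₀ n := by
  have h1 : (8 : ℝ) ≤ N₀ := by exact_mod_cast h
  have h2 : (1 : ℝ) ≤ (3 / 2 : ℝ) ^ n := one_le_pow₀ (by norm_num)
  have e : (4 : ℝ) = (8 : ℝ) ^ (2 / 3 : ℝ) := by
    rw [show (8 : ℝ) = 2 ^ (3 : ℝ) by norm_num, ← Real.rpow_mul (by norm_num)]; norm_num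
  calc (4 : ℝ) = (8 : ℝ) ^ (2 / 3 : ℝ) := e
    _ ≤ (N₀ : ℝ) ^ (2 / 3 : ℝ) := Real.rpow_le_rpow (by norm_num) h1 (by norm_num)
    _ ≤ _ := Real.rpow_le_rpow_of_exponent_le (by linarith) (by nlinarith)

theorem two_le_rpow_half {M : ℝ} (h : 4 ≤ M) : 2 ≤ M ^ (1 / 2 : ℝ) := by
  have e : (2 : ℝ) = (4 : ℝ) ^ (1 / 2 : ℝ) := by
    rw [show (4 : ℝ) = 2 ^ (2 : ℝ) by norm_num, ← Real.rpow_mul (by norm_num)]; norm_num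
  exact e.trans_le (Real.rpow_le_rpow (by norm_num) h (by norm_num))

theorem two_mul_scaleM_le {N₀ : ℕ} (h : 8 ≤ N₀) (n : ℕ) :
    2 * scaleM N₀ n ≤ scaleM N₀ (n + 1) := by
  have h4 := four_le_scaleM h n
  have h0 : 0 < scaleM N₀ n := by linarith
  rw [scaleM_succ, scaleN_eq, show (3 / 2 : ℝ) = 1 / 2 + 1 by norm_num, Real.rpow_add h0,
    Real.rpow_one]
  gcongr
  exact two_le_rpow_half h4

/-- The scales at least double, so any inverse power of order at least 1 decays at least like `2⁻ⁿ`;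
a geometric rate is enough to sum everything. -/
theorem scaleM_rpow_neg_le {N₀ : ℕ} (h : 8 ≤ N₀) {r : ℝ} (hr : 1 ≤ r) (n : ℕ) :
    scaleM N₀ n ^ (-r) ≤ scaleM N₀ 0 ^ (-r) * (2⁻¹ : ℝ) ^ n := by
  induction n with
  | zero => simp
  | succ n ih =>
    have h4 := four_le_scaleM h n
    have h0 : 0 < scaleM N₀ n := by linarith
    calc scaleM N₀ (n + 1) ^ (-r) ≤ (2 * scaleM N₀ n) ^ (-r) :=
          Real.rpow_le_rpow_of_nonpos (by positivity) (two_mul_scaleM_le h n) (by linarith)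
      _ = 2 ^ (-r) * scaleM N₀ n ^ (-r) := Real.mul_rpow (by norm_num) h0.le
      _ ≤ 2⁻¹ * (scaleM N₀ 0 ^ (-r) * (2⁻¹ : ℝ) ^ n) := by
          gcongr
          rw [← Real.rpow_neg_one]
          exact Real.rpow_le_rpow_of_exponent_le (by norm_num) (by linarith)
      _ = _ := by ring

/-- The low norm after one step. -/
theorem low_step_le {M τ q e K : ℝ} (hM : 4 ≤ M) (he : 0 ≤ e) (hq : 48 * K * q ≤ 1) :
    48 * K * (q * M ^ (-(3 * τ + 5 / 2)) * (e * M ^ (-(6 * τ + 4)))) +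
      (M ^ (3 / 2 : ℝ)) ^ (-(6 * τ + 4 + 1)) * (e * M) ≤
      e * (M ^ (3 / 2 : ℝ)) ^ (-(6 * τ + 4)) := by
  have h0 : 0 < M := by linarith
  have h2 := two_le_rpow_half hM
  -- The quadratic term and the smoothed tail have exactly this same power, thanks to `b = 6τ + 5`.
  -- The target `M^{-(9τ+6)}` is larger by `M^{1/2}`, enough to absorb both.
  set E := M ^ (-(9 * τ + 13 / 2)) with hE
  have hE0 : 0 < E := Real.rpow_pos_of_pos h0 _
  have e1 : M ^ (-(3 * τ + 5 / 2)) * M ^ (-(6 * τ + 4)) = E := by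
    rw [← Real.rpow_add h0]; congr 1; ring
  have e2 : (M ^ (3 / 2 : ℝ)) ^ (-(6 * τ + 4 + 1)) * M = E := by
    rw [← Real.rpow_mul h0.le, ← Real.rpow_add_one h0.ne']; congr 1; ring
  have e3 : (M ^ (3 / 2 : ℝ)) ^ (-(6 * τ + 4)) = M ^ (1 / 2 : ℝ) * E := by
    rw [← Real.rpow_mul h0.le, ← Real.rpow_add h0]; congr 1; ring
  calc _ = 48 * K * q * (e * (M ^ (-(3 * τ + 5 / 2)) * M ^ (-(6 * τ + 4)))) +
        e * ((M ^ (3 / 2 : ℝ)) ^ (-(6 * τ + 4 + 1)) * M) := by ring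
    _ = 48 * K * q * (e * E) + e * E := by rw [e1, e2]
    _ ≤ 1 * (e * E) + e * E := by gcongr
    _ = e * (2 * E) := by ring
    _ ≤ e * (M ^ (1 / 2 : ℝ) * E) := by gcongr
    _ = _ := by rw [e3]

/-- The high norm after one step. -/
theorem high_step_le {M τ q e K : ℝ} (hM : 4 ≤ M) (hτ : 0 < τ) (he : 0 ≤ e)
    (hq : 48 * K * q ≤ 1) :
    24 * K * (q * M ^ (3 * τ + 5 / 2) * (e * M ^ (-(6 * τ + 4))) +
      q * M ^ (-(3 * τ + 5 / 2)) * (e * M)) + e * M ≤ e * M ^ (3 / 2 : ℝ) := by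
  have h0 : 0 < M := by linarith
  have h2 := two_le_rpow_half hM
  set E := M ^ (-(3 * τ + 3 / 2)) with hE
  have hE0 : 0 < E := Real.rpow_pos_of_pos h0 _
  have hE1 : E ≤ M := (Real.rpow_le_one_of_one_le_of_nonpos (by linarith) (by linarith)).trans
    (by linarith)
  have e1 : M ^ (3 * τ + 5 / 2) * M ^ (-(6 * τ + 4)) = E := by
    rw [← Real.rpow_add h0]; congr 1; ring
  have e2 : M ^ (-(3 * τ + 5 / 2)) * M = E := by
    rw [← Real.rpow_add_one h0.ne']; congr 1; ring
  have e3 : M ^ (3 / 2 : ℝ) = M ^ (1 / 2 : ℝ) * M := by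
    rw [← Real.rpow_add_one h0.ne']; congr 1; norm_num
  calc _ = 24 * K * q * (e * (M ^ (3 * τ + 5 / 2) * M ^ (-(6 * τ + 4)))) +
        24 * K * q * (e * (M ^ (-(3 * τ + 5 / 2)) * M)) + e * M := by ring
    _ = 48 * K * q * (e * E) + e * M := by rw [e1, e2]; ring
    _ ≤ 1 * (e * M) + e * M := by gcongr
    _ = e * (2 * M) := by ring
    _ ≤ e * (M ^ (1 / 2 : ℝ) * M) := by gcongr
    _ = _ := by rw [e3]

end scales

/-! ### The iteration -/

section iteration
variable {d : ℕ} {γ : ℝ} {S : Set (EuclideanSpace ℝ (Fin d))}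

theorem norm_entry_le_of_colNorm {A : OpArr d (ℤ ⊕ ℤ)} {t c : ℝ} (ht : 0 ≤ t) (hc : 0 ≤ c)
    (h : colNorm t (toep A) ≤ ENNReal.ofReal c) (x y : ℤ ⊕ ℤ) : ‖A 0 x y‖ ≤ c := by
  have h1 := (enorm_le_colNorm ht (toep A) (0, x) (0, y)).trans h
  rw [← ofReal_norm, ENNReal.ofReal_le_ofReal_iff hc] at h1
  simpa [toep] using h1

theorem lipNorm_sub_le {E : Type*} [Sub E] {N : E → ℝ≥0∞} {f : EuclideanSpace ℝ (Fin d) → E}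
    {c : ℝ} (hγ : 0 < γ) (h : lipNorm γ S N f ≤ ENNReal.ofReal c) {ω₁ ω₂} (h₁ : ω₁ ∈ S)
    (h₂ : ω₂ ∈ S) (hne : ω₁ ≠ ω₂) :
    N (f ω₁ - f ω₂) ≤ ENNReal.ofReal (c * γ⁻¹ * ‖ω₁ - ω₂‖) := by
  refine (le_lipSemi f h₁ h₂ hne).trans ?_
  have h3 : lipSemi S N f ≤ ENNReal.ofReal (c * γ⁻¹) := by
    have := (lipSemi_le_lipNorm (γ := γ) (S := S) (N := N) f).trans h
    rw [mul_comm c, ENNReal.ofReal_mul (by positivity), ENNReal.ofReal_inv_of_pos hγ]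
    exact (ENNReal.mul_le_iff_le_inv (by simpa using hγ) ENNReal.ofReal_ne_top).1 this
  rw [ENNReal.ofReal_mul' (norm_nonneg _)]
  gcongr

/-- The defining inequalities exclude `ℓ = 0`, `i = j`, also for sums. There `μ + ν ≥ 2√m - 16 η ≥
√m`, since the blocks are within `η`, entry by entry, of scalars at least `√m`. This is the origin
of the factor `min 1 √m`. -/
theorem nonRes_of_mem_kamSet {τ₀ τ m η : ℝ} {N₀ n : ℕ} {ω : EuclideanSpace ℝ (Fin d)}
    {H P : EuclideanSpace ℝ (Fin d) → OpArr d (ℤ ⊕ ℤ)} (hm : 0 < m) (hγ : 0 < γ) (hγ1 : γ < 1)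
    (hτ : 0 < τ) (hN : 1 ≤ scaleN N₀ n) (hω : ω ∈ kamSet γ τ₀ τ N₀ H P (n + 1))
    (hη : 16 * η ≤ Real.sqrt m)
    (hH : ∀ x y, ‖((kamState N₀ ω (H ω) (P ω) n).1 - initialH d m fun _ => 0) 0 x y‖ ≤ η) :
    NonRes ω (kamState N₀ ω (H ω) (P ω) n).1 (scaleN N₀ n)
      (min 1 (Real.sqrt m) * γ / scaleN N₀ n ^ τ) := by
  intro l hl i j μ hμ ν hν
  have hNτ : 1 ≤ scaleN N₀ n ^ τ := Real.one_le_rpow hN hτ.le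
  have hsm : 0 < Real.sqrt m := Real.sqrt_pos.2 hm
  have hc : ∀ x, min 1 (Real.sqrt m) * γ / scaleN N₀ n ^ τ ≤ γ * jap x / scaleN N₀ n ^ τ := by
    intro x
    refine div_le_div_of_nonneg_right ?_ (by linarith)
    rw [mul_comm]
    exact mul_le_mul_of_nonneg_left ((min_le_left _ _).trans (one_le_jap x)) hγ.le
  by_cases h : l = 0 ∧ i = j
  · refine ⟨fun h' => absurd h h', ?_⟩
    have h1 := blockEigs_ge hH rfl hμ
    have h2 := blockEigs_ge hH rfl hν
    have h3 : ∀ i : ℕ, Real.sqrt m ≤ Real.sqrt ((i : ℝ) ^ 2 + m) := fun i =>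
      Real.sqrt_le_sqrt (by nlinarith [sq_nonneg (i : ℝ)])
    have h4 := h3 i
    have h5 := h3 j
    have h6 : freqDot ω l = 0 := by rw [h.1]; simp [freqDot]
    rw [h6, zero_add]
    refine le_trans ?_ (le_abs_self _)
    calc min 1 (Real.sqrt m) * γ / scaleN N₀ n ^ τ ≤ min 1 (Real.sqrt m) * γ :=
          div_le_self (by positivity) hNτ
      _ ≤ Real.sqrt m * 1 := by gcongr; exact min_le_right _ _
      _ ≤ _ := by linarith
  · have h1 := hω.2 l i j hl.le h μ hμ ν hν
    exact ⟨fun _ => (hc _).trans h1.1, (hc _).trans h1.2⟩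

/-- One power `N^τ` is the divisor; the variation of the divisor costs another `N^τ` and a factor
`N`. The constant is `40 = 4 + 4 · 9`, using `N + 8η ≤ 9N`. -/
theorem hom_const_le {γ N c₀ τ η : ℝ} (hγ : 0 < γ) (hN : 1 ≤ N) (hc : 0 < c₀) (hc1 : c₀ ≤ 1)
    (hτ : 0 < τ) (hη : η ≤ 1) :
    4 * (c₀ * γ / N ^ τ)⁻¹ +
      γ * (4 * ((c₀ * γ / N ^ τ)⁻¹ * (N + 8 * η) * (c₀ * γ / N ^ τ)⁻¹)) ≤
      40 / c₀ ^ 2 * γ⁻¹ * N ^ (2 * τ + 1) := by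
  have hN0 : 0 < N := by linarith
  set y := N ^ τ with hy
  have hy1 : 1 ≤ y := Real.one_le_rpow hN hτ.le
  have e1 : N ^ (2 * τ + 1) = y * y * N := by
    rw [Real.rpow_add_one hN0.ne', two_mul, Real.rpow_add hN0]
  have e2 : (c₀ * γ / y)⁻¹ = c₀⁻¹ * γ⁻¹ * y := by
    rw [inv_div]; field_simp
  have hci : 1 ≤ c₀⁻¹ := (one_le_inv₀ hc).2 hc1
  rw [e1, e2]
  have hγi : γ * γ⁻¹ = 1 := mul_inv_cancel₀ hγ.ne'
  calc _ = 4 * (c₀⁻¹ * γ⁻¹ * y) +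
        (γ * γ⁻¹) * (4 * (c₀⁻¹ * y * (N + 8 * η) * (c₀⁻¹ * γ⁻¹ * y))) := by ring
    _ = 4 * (c₀⁻¹ * γ⁻¹ * y) * 1 + 4 * (c₀⁻¹ * y * (N + 8 * η) * (c₀⁻¹ * γ⁻¹ * y)) := by
        rw [hγi]; ring
    _ ≤ 4 * (c₀⁻¹ * γ⁻¹ * y) * (c₀⁻¹ * y * N) +
        4 * (c₀⁻¹ * y * (N + 8 * N) * (c₀⁻¹ * γ⁻¹ * y)) := by
        gcongr
        · calc (1 : ℝ) = 1 * 1 * 1 := by norm_num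
            _ ≤ c₀⁻¹ * y * N := by gcongr
        · linarith
    _ = _ := by field_simp; ring

/-- The bounds on `(H₀ⁿ, Pⁿ)` that are propagated by the iteration. -/
structure KamBound (γ : ℝ) (S : Set (EuclideanSpace ℝ (Fin d))) (m s t e h τ : ℝ) (M : ℝ)
    (H P : EuclideanSpace ℝ (Fin d) → OpArr d (ℤ ⊕ ℤ)) : Prop where
  ham : ∀ ω ∈ S, HasHamForm (P ω)
  diag : ∀ ω ∈ S, IsBlockDiag (H ω)
  ham_diag : ∀ ω ∈ S, HasHamForm (H ω)
  low : arrLip γ S t P ≤ ENNReal.ofReal (e * M ^ (-(6 * τ + 4)))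
  high : arrLip γ S s P ≤ ENNReal.ofReal (e * M)
  near : ∀ ω ∈ S, ∀ x y, ‖(H ω - initialH d m fun _ => 0) 0 x y‖ ≤ h
  lip : ∀ ω₁ ∈ S, ∀ ω₂ ∈ S, ∀ x y, ‖(H ω₁ - H ω₂) 0 x y‖ ≤ h * γ⁻¹ * ‖ω₁ - ω₂‖

variable {m s t e h τ M : ℝ} {H P : EuclideanSpace ℝ (Fin d) → OpArr d (ℤ ⊕ ℤ)}

/-- The condition `h ≤ γ` makes the Lipschitz constant `h γ⁻¹` of the blocks at most 1, so they move
no faster than the fixed constant allowed in `hom_const_le`. -/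
theorem KamBound.isHomSol {N c₀ : ℝ} (hb : KamBound γ S m s t e h τ M H P)
    (hN : 1 ≤ N) (hγ : 0 < γ) (hc : 0 < c₀) (hc1 : c₀ ≤ 1) (hτ : 0 < τ) (hh : h ≤ γ) (hh0 : 0 ≤ h)
    (hnr : ∀ ω ∈ S, NonRes ω (H ω) N (c₀ * γ / N ^ τ)) :
    (∀ ω ∈ S, IsHomSol ω N (H ω) (P ω) (homSol ω N (H ω) (P ω))) ∧
    ∀ r, arrLip γ S r (fun ω => homSol ω N (H ω) (P ω)) ≤
      ENNReal.ofReal (40 / c₀ ^ 2 * γ⁻¹ * N ^ (2 * τ + 1)) * arrLip γ S r P := by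
  have hN0 : 0 < N := by linarith
  have hcc : 0 < c₀ * γ / N ^ τ := by positivity
  have h1 : ∀ ω ∈ S, IsHomSol ω N (H ω) (P ω) (homSol ω N (H ω) (P ω)) := fun ω hω => by
    have h2 := exists_isHomSol (hb.diag ω hω) (hb.ham_diag ω hω) (hb.ham ω hω) hN0 hcc (hnr ω hω)
    rw [homSol, dif_pos h2]
    exact h2.choose_spec
  have hη : h * γ⁻¹ ≤ 1 := by rw [← div_eq_mul_inv]; exact (div_le_one hγ).2 hh
  refine ⟨h1, fun r => ?_⟩
  refine (arrLip_homSol_le h1 hb.diag hb.ham_diag hb.ham hN0 hcc hγ (by positivity) hnr hb.lip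
    r).trans ?_
  gcongr
  exact hom_const_le hγ hN hc hc1 hτ hη

/-- The loss `N^{2τ+1}` equals `M^{3τ+3/2}`: against the low bound `M^{-(6τ+4)}` it leaves a
strictly negative power. -/
theorem KamBound.hom_bounds {N C₂ : ℝ} (hb : KamBound γ S m s t e h τ M H P)
    (hM : 4 ≤ M) (hN : N = M ^ (3 / 2 : ℝ)) (hC₂ : 0 ≤ C₂)
    {U : EuclideanSpace ℝ (Fin d) → OpArr d (ℤ ⊕ ℤ)}
    (hU : ∀ r, arrLip γ S r U ≤ ENNReal.ofReal (C₂ * N ^ (2 * τ + 1)) * arrLip γ S r P) :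
    arrLip γ S t U ≤ ENNReal.ofReal (C₂ * e * M ^ (-(3 * τ + 5 / 2))) ∧
    arrLip γ S s U ≤ ENNReal.ofReal (C₂ * e * M ^ (3 * τ + 5 / 2)) := by
  have h0 : 0 < M := by linarith
  have hN0 : 0 ≤ C₂ * N ^ (2 * τ + 1) := by rw [hN]; positivity
  have e0 : N ^ (2 * τ + 1) = M ^ (3 * τ + 3 / 2) := by
    rw [hN, ← Real.rpow_mul h0.le]; congr 1; ring
  constructor
  · refine ((hU t).trans (mul_le_mul_right hb.low _)).trans_eq ?_
    have e1 : M ^ (-(3 * τ + 5 / 2)) = M ^ (3 * τ + 3 / 2) * M ^ (-(6 * τ + 4)) := by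
      rw [← Real.rpow_add h0]; congr 1; ring
    rw [← ENNReal.ofReal_mul hN0, e0, e1]
    congr 1; ring
  · refine ((hU s).trans (mul_le_mul_right hb.high _)).trans_eq ?_
    have e1 : M ^ (3 * τ + 5 / 2) = M ^ (3 * τ + 3 / 2) * M := by
      rw [← Real.rpow_add_one h0.ne']; congr 1; ring
    rw [← ENNReal.ofReal_mul hN0, e0, e1]
    congr 1; ring

/-- Only the drift `⌊P⌋` of the normal form enters the bounds on `H`; its entries and their
variation are controlled by the low norm of `P`, hence the increment of `h`. -/
theorem KamBound.step {N K q : ℝ} (hb : KamBound γ S m s t e h τ M H P) (hK : 1 ≤ K)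
    (hts : t = s - (6 * τ + 4 + 1)) (ht : sZero d ≤ t) (he : 0 ≤ e)
    (hT : IsTame (ENNReal.ofReal K) (fun T : BOp d => colNorm s (ent T))
      (fun T => colNorm t (ent T)))
    (hM : 4 ≤ M) (hN : N = M ^ (3 / 2 : ℝ)) (hτ : 0 < τ) (hq0 : 0 ≤ q) (hq : 48 * K * q ≤ 1)
    (hγ : 0 < γ) {U : EuclideanSpace ℝ (Fin d) → OpArr d (ℤ ⊕ ℤ)}
    (hsol : ∀ ω ∈ S, IsHomSol ω N (H ω) (P ω) (U ω))
    (hUlo : arrLip γ S t U ≤ ENNReal.ofReal (q * M ^ (-(3 * τ + 5 / 2))))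
    (hUhi : arrLip γ S s U ≤ ENNReal.ofReal (q * M ^ (3 * τ + 5 / 2))) :
    KamBound γ S m s t e (h + e * M ^ (-(6 * τ + 4))) τ N (fun ω => H ω + arrAvg (P ω))
      (fun ω => pushHam ω (U ω) (H ω + P ω) - (H ω + arrAvg (P ω))) := by
  have h0 : 0 < M := by linarith
  have hN1 : 1 ≤ N := by rw [hN]; exact Real.one_le_rpow (by linarith) (by norm_num)
  have ht0 : 0 ≤ t := (sZero_pos d).le.trans ht
  have hKr : 0 ≤ K := by linarith
  have hsmall : 2 * ENNReal.ofReal K * arrLip γ S t U ≤ 2⁻¹ := by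
    calc _ ≤ 2 * ENNReal.ofReal K * ENNReal.ofReal (q * M ^ (-(3 * τ + 5 / 2))) := by gcongr
      _ = ENNReal.ofReal (2 * K * (q * M ^ (-(3 * τ + 5 / 2)))) := by
          rw [ENNReal.ofReal_mul (p := 2 * K) (by positivity), ENNReal.ofReal_mul (p := 2)
            (by norm_num), ENNReal.ofReal_ofNat]
      _ ≤ ENNReal.ofReal 2⁻¹ := by
          refine ENNReal.ofReal_le_ofReal ?_
          have h1 : M ^ (-(3 * τ + 5 / 2)) ≤ 1 :=
            Real.rpow_le_one_of_one_le_of_nonpos (by linarith) (by linarith)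
          calc _ ≤ 2 * K * (q * 1) := by gcongr
            _ ≤ _ := by nlinarith
      _ = 2⁻¹ := by rw [ENNReal.ofReal_inv_of_pos (by norm_num)]; norm_num
  obtain ⟨k1, k2, k3⟩ := kam_step (by simpa using hK) (by linarith) ht hT hsol hb.diag hb.ham hN1 hγ
    (hb.low.trans_lt ENNReal.ofReal_lt_top) hsmall
  have hlow0 : 0 ≤ e * M ^ (-(6 * τ + 4)) := by positivity
  have havg : ∀ ω ∈ S, ∀ x y, ‖arrAvg (P ω) 0 x y‖ ≤ e * M ^ (-(6 * τ + 4)) := fun ω hω x y => by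
    rw [arrAvg_eq_mask (hb.ham ω hω)]
    exact norm_entry_le_of_colNorm ht0 hlow0 ((colNorm_mask_le t _ _).trans
      ((colNorm_le_arrLip hω t).trans hb.low)) x y
  have havg2 : ∀ ω₁ ∈ S, ∀ ω₂ ∈ S, ∀ x y, ‖(arrAvg (P ω₁) - arrAvg (P ω₂)) 0 x y‖ ≤
      e * M ^ (-(6 * τ + 4)) * γ⁻¹ * ‖ω₁ - ω₂‖ := fun ω₁ h₁ ω₂ h₂ x y => by
    by_cases hne : ω₁ = ω₂
    · subst hne; simp
    · rw [arrAvg_eq_mask (hb.ham ω₁ h₁), arrAvg_eq_mask (hb.ham ω₂ h₂), ← arrMask_sub]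
      exact norm_entry_le_of_colNorm ht0 (by positivity) ((colNorm_mask_le t _ _).trans
        (lipNorm_sub_le hγ hb.low h₁ h₂ hne)) x y
  refine ⟨k1, ?_, ?_, ?_, ?_, ?_, ?_⟩
  · intro ω hω
    rw [arrAvg_eq_mask (hb.ham ω hω)]
    exact (hb.diag ω hω).add (isBlockDiag_mask _)
  · exact fun ω hω => (hb.ham_diag ω hω).add (hb.ham ω hω).avg
  · refine k2.trans ?_
    calc _ ≤ 48 * ENNReal.ofReal K * (ENNReal.ofReal (q * M ^ (-(3 * τ + 5 / 2))) *
          ENNReal.ofReal (e * M ^ (-(6 * τ + 4)))) +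
          ENNReal.ofReal (N ^ (t - s)) * ENNReal.ofReal (e * M) := by
          gcongr
          · exact hb.low
          · exact hb.high
      _ = ENNReal.ofReal (48 * K * (q * M ^ (-(3 * τ + 5 / 2)) * (e * M ^ (-(6 * τ + 4)))) +
          N ^ (t - s) * (e * M)) := by
          rw [ENNReal.ofReal_add (by positivity) (by positivity),
            ENNReal.ofReal_mul (p := N ^ (t - s)) (by positivity),
            ENNReal.ofReal_mul (p := 48 * K) (by positivity),
            ENNReal.ofReal_mul (p := q * M ^ (-(3 * τ + 5 / 2))) (by positivity),
            ENNReal.ofReal_mul (p := 48) (by norm_num)]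
          norm_num
      _ ≤ _ := by
          refine ENNReal.ofReal_le_ofReal ?_
          rw [hN, show t - s = -(6 * τ + 4 + 1) by rw [hts]; ring]
          exact low_step_le hM he hq
  · refine k3.trans ?_
    calc _ ≤ 24 * ENNReal.ofReal K * (ENNReal.ofReal (q * M ^ (3 * τ + 5 / 2)) *
          ENNReal.ofReal (e * M ^ (-(6 * τ + 4))) +
          ENNReal.ofReal (q * M ^ (-(3 * τ + 5 / 2))) * ENNReal.ofReal (e * M)) +
          ENNReal.ofReal (e * M) := by
          gcongr
          · exact hb.low
          · exact hb.high
          · exact hb.high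
      _ = ENNReal.ofReal (24 * K * (q * M ^ (3 * τ + 5 / 2) * (e * M ^ (-(6 * τ + 4))) +
          q * M ^ (-(3 * τ + 5 / 2)) * (e * M)) + e * M) := by
          rw [ENNReal.ofReal_add (by positivity) (by positivity),
            ENNReal.ofReal_mul (p := 24 * K) (by positivity),
            ENNReal.ofReal_add (by positivity) (by positivity),
            ENNReal.ofReal_mul (p := q * M ^ (3 * τ + 5 / 2)) (by positivity),
            ENNReal.ofReal_mul (p := q * M ^ (-(3 * τ + 5 / 2))) (by positivity),
            ENNReal.ofReal_mul (p := 24) (by norm_num)]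
          norm_num
      _ ≤ _ := by
          refine ENNReal.ofReal_le_ofReal ?_
          rw [hN]
          exact high_step_le hM hτ he hq
  · intro ω hω x y
    have : (H ω + arrAvg (P ω) - initialH d m fun _ => 0) 0 x y =
        (H ω - initialH d m fun _ => 0) 0 x y + arrAvg (P ω) 0 x y := by
      simp only [Pi.sub_apply, Pi.add_apply, Matrix.sub_apply, Matrix.add_apply]; ring
    rw [this]
    exact (norm_add_le _ _).trans (add_le_add (hb.near ω hω x y) (havg ω hω x y))
  · intro ω₁ h₁ ω₂ h₂ x y
    have : (H ω₁ + arrAvg (P ω₁) - (H ω₂ + arrAvg (P ω₂))) 0 x y =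
        (H ω₁ - H ω₂) 0 x y + (arrAvg (P ω₁) - arrAvg (P ω₂)) 0 x y := by
      simp only [Pi.sub_apply, Pi.add_apply, Matrix.sub_apply, Matrix.add_apply]; ring
    rw [this, add_mul, add_mul]
    exact (norm_add_le _ _).trans (add_le_add (hb.lip ω₁ h₁ ω₂ h₂ x y) (havg2 ω₁ h₁ ω₂ h₂ x y))

theorem KamBound.mono_h {h' : ℝ} (hb : KamBound γ S m s t e h τ M H P) (hγ : 0 < γ) (hh : h ≤ h') :
    KamBound γ S m s t e h' τ M H P where
  ham := hb.ham
  diag := hb.diag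
  ham_diag := hb.ham_diag
  low := hb.low
  high := hb.high
  near ω hω x y := (hb.near ω hω x y).trans hh
  lip ω₁ h₁ ω₂ h₂ x y := (hb.lip ω₁ h₁ ω₂ h₂ x y).trans (by gcongr)

/-- The drifts of the normal form are at most `ε₁ 2⁻ⁿ`, with partial sums `2 ε₁ (1 - 2⁻ⁿ)`. The
total budget `h₁` therefore keeps the blocks close enough to the initial ones, and Lipschitz enough,
at every step. -/
theorem kamBound_all {N₀ : ℕ} {τ₀ K h₀ h₁ C₂ : ℝ} (hN₀ : 8 ≤ N₀)
    (hK : 1 ≤ K) (hts : t = s - (6 * τ + 4 + 1)) (ht : sZero d ≤ t) (he : 0 ≤ e) (hh0 : 0 ≤ h₀)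
    (hT : IsTame (ENNReal.ofReal K) (fun T : BOp d => colNorm s (ent T))
      (fun T => colNorm t (ent T)))
    (hτ : 0 < τ) (hm : 0 < m) (hγ : 0 < γ) (hγ1 : γ < 1)
    (hC₂ : C₂ = 40 / (min 1 (Real.sqrt m)) ^ 2 * γ⁻¹) (hq : 48 * K * (C₂ * e) ≤ 1)
    (hh₁ : h₁ = h₀ + 2 * (e * scaleM N₀ 0 ^ (-(6 * τ + 4)))) (hhγ : h₁ ≤ γ)
    (hhm : 16 * h₁ ≤ Real.sqrt m)
    (hS : ∀ n, S ⊆ kamSet γ τ₀ τ N₀ H P n)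
    (hb : KamBound γ S m s t e h₀ τ (scaleM N₀ 0) H P) (n : ℕ) :
    KamBound γ S m s t e
      (h₀ + 2 * (e * scaleM N₀ 0 ^ (-(6 * τ + 4))) * (1 - (2⁻¹ : ℝ) ^ n)) τ (scaleM N₀ n)
      (fun ω => (kamState N₀ ω (H ω) (P ω) n).1) (fun ω => (kamState N₀ ω (H ω) (P ω) n).2) ∧
    (∀ ω ∈ S, IsHomSol ω (scaleN N₀ n) (kamState N₀ ω (H ω) (P ω) n).1
      (kamState N₀ ω (H ω) (P ω) n).2 (kamU N₀ ω (H ω) (P ω) n)) ∧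
    arrLip γ S t (fun ω => kamU N₀ ω (H ω) (P ω) n) ≤
      ENNReal.ofReal (C₂ * e * scaleM N₀ n ^ (-(3 * τ + 5 / 2))) ∧
    arrLip γ S s (fun ω => kamU N₀ ω (H ω) (P ω) n) ≤
      ENNReal.ofReal (C₂ * e * scaleM N₀ n ^ (3 * τ + 5 / 2)) := by
  set c₀ := min 1 (Real.sqrt m) with hc₀
  have hc : 0 < c₀ := lt_min one_pos (Real.sqrt_pos.2 hm)
  have hC0 : 0 ≤ C₂ := by rw [hC₂]; positivity
  set ε₁ := e * scaleM N₀ 0 ^ (-(6 * τ + 4)) with hε₁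
  have hM0 := four_le_scaleM hN₀ 0
  have hε₁0 : 0 ≤ ε₁ := by
    have : 0 ≤ scaleM N₀ 0 := by linarith
    positivity
  have key : ∀ n, KamBound γ S m s t e (h₀ + 2 * ε₁ * (1 - (2⁻¹ : ℝ) ^ n)) τ (scaleM N₀ n)
      (fun ω => (kamState N₀ ω (H ω) (P ω) n).1) (fun ω => (kamState N₀ ω (H ω) (P ω) n).2) →
    (∀ ω ∈ S, IsHomSol ω (scaleN N₀ n) (kamState N₀ ω (H ω) (P ω) n).1
      (kamState N₀ ω (H ω) (P ω) n).2 (kamU N₀ ω (H ω) (P ω) n)) ∧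
    arrLip γ S t (fun ω => kamU N₀ ω (H ω) (P ω) n) ≤
      ENNReal.ofReal (C₂ * e * scaleM N₀ n ^ (-(3 * τ + 5 / 2))) ∧
    arrLip γ S s (fun ω => kamU N₀ ω (H ω) (P ω) n) ≤
      ENNReal.ofReal (C₂ * e * scaleM N₀ n ^ (3 * τ + 5 / 2)) := by
    intro n hn
    have hM := four_le_scaleM hN₀ n
    have hp : (0 : ℝ) < 2⁻¹ ^ n := by positivity
    have hp1 : (2⁻¹ : ℝ) ^ n ≤ 1 := pow_le_one₀ (by norm_num) (by norm_num)
    have hle : h₀ + 2 * ε₁ * (1 - (2⁻¹ : ℝ) ^ n) ≤ h₁ := by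
      rw [hh₁]; nlinarith
    have hge : 0 ≤ h₀ + 2 * ε₁ * (1 - (2⁻¹ : ℝ) ^ n) := by
      have : 0 ≤ 1 - (2⁻¹ : ℝ) ^ n := by linarith
      positivity
    have hN : 1 ≤ scaleN N₀ n := by
      rw [scaleN_eq]; exact Real.one_le_rpow (by linarith) (by norm_num)
    obtain ⟨k1, k2⟩ := hn.isHomSol hN hγ hc (min_le_left _ _) hτ (hle.trans hhγ) hge
      fun ω hω => nonRes_of_mem_kamSet hm hγ hγ1 hτ hN (hS (n + 1) hω)
        ((mul_le_mul_of_nonneg_left hle (by norm_num)).trans hhm) (hn.near ω hω)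
    rw [← hC₂] at k2
    exact ⟨k1, hn.hom_bounds hM (scaleN_eq N₀ n) hC0 k2⟩
  have main : ∀ n, KamBound γ S m s t e (h₀ + 2 * ε₁ * (1 - (2⁻¹ : ℝ) ^ n)) τ (scaleM N₀ n)
      (fun ω => (kamState N₀ ω (H ω) (P ω) n).1)
      (fun ω => (kamState N₀ ω (H ω) (P ω) n).2) := by
    intro n
    induction n with
    | zero => simpa [kamState] using hb
    | succ n ih =>
      obtain ⟨k1, k2, k3⟩ := key n ih
      have hp1 : (2⁻¹ : ℝ) ^ n ≤ 1 := pow_le_one₀ (by norm_num) (by norm_num)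
      have hge : 0 ≤ h₀ + 2 * ε₁ * (1 - (2⁻¹ : ℝ) ^ n) := by
        have : 0 ≤ 1 - (2⁻¹ : ℝ) ^ n := by linarith
        positivity
      have h1 := ih.step hK hts ht he hT (four_le_scaleM hN₀ n) (scaleN_eq N₀ n) hτ
        (mul_nonneg hC0 he) hq hγ k1 k2 k3
      rw [← scaleM_succ] at h1
      refine h1.mono_h hγ ?_
      have h2 : e * scaleM N₀ n ^ (-(6 * τ + 4)) ≤ ε₁ * (2⁻¹ : ℝ) ^ n := by
        rw [hε₁, mul_assoc]
        gcongr
        exact scaleM_rpow_neg_le hN₀ (by linarith) n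
      rw [pow_succ]
      linarith
  exact ⟨main n, key n (main n)⟩

end iteration

end WaveKAM

namespace WaveKAM

/-! ### Initial bounds and the choice of the smallness threshold -/

section main
variable {d : ℕ} {γ : ℝ} {S : Set (EuclideanSpace ℝ (Fin d))}

theorem norm_initialH_sub_le {m c : ℝ} {κ₁ κ₂ : ℤ → ℝ} (hc : 0 ≤ c)
    (h : ∀ j, |κ₁ j - κ₂ j| ≤ c) (x y : ℤ ⊕ ℤ) :
    ‖(initialH d m κ₁ - initialH d m κ₂) 0 x y‖ ≤ c := by
  simp only [Pi.sub_apply, Matrix.sub_apply, initialH_apply]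
  by_cases hxy : y = x
  · simp only [hxy, and_self, if_true]
    rcases x with j | j
    · simp only [Sum.elim_inl]
      rw [← Complex.ofReal_sub, Complex.norm_real, Real.norm_eq_abs]
      convert h j using 2; ring
    · simp only [Sum.elim_inr]
      rw [← Complex.ofReal_sub, Complex.norm_real, Real.norm_eq_abs, ← abs_neg]
      convert h (-j) using 2; ring
  · simpa [hxy] using hc

/-- The factor 4 compares column and Hamiltonian norms; `e` is normalised so that the low bound at
the first scale is exactly `4ε`. Using `|C₀|` keeps the bound on `κ` nonnegative. -/
theorem kamBound_initial {τ₀ ε m C₀ s t e τ M : ℝ} (hε : 0 ≤ ε) (hγ : 0 < γ) (hts : t ≤ s)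
    (hS : S ⊆ diophSet d γ τ₀) {κ : EuclideanSpace ℝ (Fin d) → ℤ → ℝ}
    {P : EuclideanSpace ℝ (Fin d) → OpArr d (ℤ ⊕ ℤ)} (hM : 1 ≤ M)
    (hκ : ∀ j : ℤ, lipNorm γ (diophSet d γ τ₀) (fun x : ℝ => ENNReal.ofReal |x|) (fun ω => κ ω j)
      ≤ ENNReal.ofReal (C₀ * ε))
    (hP : ∀ ω ∈ diophSet d γ τ₀, HasHamForm (P ω))
    (hPε : lipNorm γ (diophSet d γ τ₀) (hamNorm s 1 0) P ≤ ENNReal.ofReal ε)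
    (he : e * M ^ (-(6 * τ + 4)) = 4 * ε) (he4 : 4 * ε ≤ e) :
    KamBound γ S m s t e (|C₀| * ε) τ M (fun ω => initialH d m (κ ω)) P := by
  have hs : arrLip γ S s P ≤ ENNReal.ofReal (4 * ε) := by
    refine (lipNorm_mono_set hS).trans ?_
    rw [ENNReal.ofReal_mul (by norm_num), ENNReal.ofReal_ofNat]
    refine le_trans ?_ (mul_le_mul_right hPε 4)
    exact lipNorm_le_mul (fun ω hω => colNorm_toep_le_hamNorm s (hP ω hω).conj)
      fun ω₁ h₁ ω₂ h₂ => colNorm_toep_le_hamNorm s ((hP ω₁ h₁).sub (hP ω₂ h₂)).conj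
  have hκ' : ∀ j : ℤ, lipNorm γ (diophSet d γ τ₀) (fun x : ℝ => ENNReal.ofReal |x|)
      (fun ω => κ ω j) ≤ ENNReal.ofReal (|C₀| * ε) := fun j =>
    (hκ j).trans (ENNReal.ofReal_le_ofReal (by gcongr; exact le_abs_self _))
  have hc0 : 0 ≤ |C₀| * ε := by positivity
  refine ⟨fun ω hω => hP ω (hS hω), fun ω _ => isBlockDiag_initialH m _,
    fun ω _ => hasHamForm_initialH m _, ?_, ?_, ?_, ?_⟩
  · rw [he]; exact (arrLip_mono hts).trans hs
  · refine hs.trans (ENNReal.ofReal_le_ofReal ?_)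
    nlinarith
  · intro ω hω
    refine norm_initialH_sub_le hc0 fun j => ?_
    have := (le_lipNorm (N := fun x : ℝ => ENNReal.ofReal |x|) (fun ω => κ ω j) (hS hω)).trans
      (hκ' j)
    rw [sub_zero]
    exact (ENNReal.ofReal_le_ofReal_iff hc0).1 this
  · intro ω₁ h₁ ω₂ h₂
    refine norm_initialH_sub_le (by positivity) fun j => ?_
    by_cases hne : ω₁ = ω₂
    · subst hne; simp
    · have := lipNorm_sub_le hγ (hκ' j) (hS h₁) (hS h₂) hne
      exact (ENNReal.ofReal_le_ofReal_iff (by positivity)).1 this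

/-- Solvability of the homological equations and geometric decay of their solutions. -/
theorem exists_kamU_bound {τ₀ τ m C₀ s b : ℝ} (hτ : 0 < τ) (hm : 0 < m)
    (hb : b = (6 * τ + 4) + 1) (hs : sZero d + b < s) {N₀ : ℕ} (hN₀ : 8 ≤ N₀) :
    ∃ δ₀ : ℝ, 0 < δ₀ ∧ δ₀ < 1 ∧ ∃ C : ℝ, 0 < C ∧
    ∀ (γ ε : ℝ), 0 < γ → γ < 1 → 0 < ε → ε * γ⁻¹ ≤ δ₀ →
    ∀ (κ : EuclideanSpace ℝ (Fin d) → ℤ → ℝ)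
      (P : EuclideanSpace ℝ (Fin d) → OpArr d (ℤ ⊕ ℤ)),
    (∀ j : ℤ, lipNorm γ (diophSet d γ τ₀) (fun x : ℝ => ENNReal.ofReal |x|) (fun ω => κ ω j)
      ≤ ENNReal.ofReal (C₀ * ε)) →
    (∀ ω ∈ diophSet d γ τ₀, HasHamForm (P ω)) →
    lipNorm γ (diophSet d γ τ₀) (hamNorm s 1 0) P ≤ ENNReal.ofReal ε →
    ∀ S : Set (EuclideanSpace ℝ (Fin d)),
      (∀ n, S ⊆ kamSet γ τ₀ τ N₀ (fun ω => initialH d m (κ ω)) P n) → ∀ n,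
      (∀ ω ∈ S, IsHomSol ω (scaleN N₀ n) (kamState N₀ ω (initialH d m (κ ω)) (P ω) n).1
        (kamState N₀ ω (initialH d m (κ ω)) (P ω) n).2
        (kamU N₀ ω (initialH d m (κ ω)) (P ω) n)) ∧
      arrLip γ S (s - b) (fun ω => kamU N₀ ω (initialH d m (κ ω)) (P ω) n) ≤
        ENNReal.ofReal (C * (ε * γ⁻¹) * (2⁻¹ : ℝ) ^ n) := by
  obtain ⟨K, hK, hT⟩ := exists_isTame_colNorm d (s := s)
  set M₀ := scaleM N₀ 0 with hM₀
  have hM4 : 4 ≤ M₀ := four_le_scaleM hN₀ 0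
  have hM0 : 0 < M₀ := by linarith
  set c₀ := min 1 (Real.sqrt m) with hc₀
  have hsm : 0 < Real.sqrt m := Real.sqrt_pos.2 hm
  have hc : 0 < c₀ := lt_min one_pos hsm
  set A := 40 / c₀ ^ 2 * (4 * M₀ ^ (6 * τ + 4)) with hA
  have hA0 : 0 < A := by positivity
  set B := |C₀| + 8 with hB
  have hB0 : 0 < B := by positivity
  -- The inverse of `R` is the threshold. Its summands secure a threshold below 1, the contraction
  -- condition `48 K C₂ e ≤ 1`, the drift condition `Bε ≤ γ`, and the spectral condition `16 Bε ≤
  -- √m`.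
  set R := 2 + 48 * K * A + B + 16 * B / Real.sqrt m with hR
  have hKA : 0 ≤ 48 * K * A := by positivity
  have hBm : 0 < 16 * B / Real.sqrt m := by positivity
  have hR0 : 0 < R := by positivity
  have hle : ∀ x, x ≤ R → x * R⁻¹ ≤ 1 := fun x hx => by
    rw [← div_eq_mul_inv]; exact (div_le_one hR0).2 hx
  refine ⟨R⁻¹, inv_pos.2 hR0, inv_lt_one_of_one_lt₀ (by linarith), A, hA0, ?_⟩
  intro γ ε hγ hγ1 hε hδ κ P hκ hP hPε S hS n
  -- This choice makes `e M₀^{-(6τ+4)} = 4ε`. In `B`, the summand 8 accounts for twice this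
  -- quantity, the total drift.
  set e := 4 * ε * M₀ ^ (6 * τ + 4) with he
  have he0 : 0 ≤ e := by positivity
  have he1 : e * M₀ ^ (-(6 * τ + 4)) = 4 * ε := by
    rw [he, mul_assoc, ← Real.rpow_add hM0]; simp
  have he4 : 4 * ε ≤ e := by
    rw [he]
    exact le_mul_of_one_le_right (by positivity) (Real.one_le_rpow (by linarith) (by linarith))
  have hδ' : ∀ x, 0 ≤ x → x ≤ R → x * (ε * γ⁻¹) ≤ 1 := fun x hx0 hx =>
    (mul_le_mul_of_nonneg_left hδ hx0).trans (hle x hx)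
  have hCe : 40 / c₀ ^ 2 * γ⁻¹ * e = A * (ε * γ⁻¹) := by rw [hA, he]; ring
  have h1 : B * ε ≤ γ := by
    have := hδ' B hB0.le (by linarith)
    rwa [← mul_assoc, ← div_eq_mul_inv, div_le_one hγ] at this
  have h2 : 16 * (B * ε) ≤ Real.sqrt m := by
    have := hδ' (16 * B / Real.sqrt m) hBm.le (by linarith)
    have h3 : ε ≤ ε * γ⁻¹ := le_mul_of_one_le_right hε.le ((one_le_inv₀ hγ).2 hγ1.le)
    have h4 := (mul_le_mul_of_nonneg_left h3 hBm.le).trans this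
    rw [div_mul_eq_mul_div, div_le_one hsm] at h4
    linarith
  have hinit := kamBound_initial (m := m) (t := s - b) (e := e) (τ := τ) (M := M₀) hε.le hγ
    (by rw [hb]; linarith) (hS 0) (by linarith) hκ hP hPε he1 he4
  have hall := kamBound_all (C₂ := 40 / c₀ ^ 2 * γ⁻¹) (h₁ := B * ε) hN₀ hK (by rw [hb])
    (by linarith) he0 (by positivity)
    (hT (s - b) (by linarith) (by rw [hb]; linarith)) hτ hm hγ hγ1 rfl
    (by rw [hCe, ← mul_assoc]; exact hδ' _ hKA (by linarith)) (by rw [he1]; ring) h1 h2 hS hinit n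
  refine ⟨hall.2.1, hall.2.2.1.trans (ENNReal.ofReal_le_ofReal ?_)⟩
  rw [hCe]
  have h5 := scaleM_rpow_neg_le hN₀ (r := 3 * τ + 5 / 2) (by linarith) n
  have h6 : scaleM N₀ 0 ^ (-(3 * τ + 5 / 2)) ≤ 1 :=
    Real.rpow_le_one_of_one_le_of_nonpos (by linarith) (by linarith)
  calc _ ≤ A * (ε * γ⁻¹) * (1 * (2⁻¹ : ℝ) ^ n) := by
        gcongr
        exact h5.trans (by gcongr)
    _ = _ := by rw [one_mul]

end main

end WaveKAM

namespace WaveKAM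

/-! ### Fourier coefficients of pairs -/

section pairs

theorem ell2_sum_sq (f : ℤ ⊕ ℤ → ℝ≥0∞) :
    ell2 f ^ 2 = ell2 (fun k => f (Sum.inl k)) ^ 2 + ell2 (fun k => f (Sum.inr k)) ^ 2 := by
  rw [ell2_sq, ell2_sq, ell2_sq, ENNReal.summable.tsum_sum ENNReal.summable]

theorem enorm_L2_eq (u : L2) :
    ‖u‖ₑ = ell2 fun k => ‖fourierCoeff (T := 2 * Real.pi) (u : Circ → ℂ) k‖ₑ := by
  have h1 : ‖fourierBasis.repr u‖ₑ = ‖u‖ₑ := by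
    rw [← ofReal_norm, ← ofReal_norm, LinearIsometryEquiv.norm_map]
  rw [← h1, enorm_eq_ell2]
  simp only [fourierBasis_repr]

theorem enorm_pair_sq (w : L2 × L2) :
    ell2 (fun k => ‖pairCoeff w k‖ₑ) ^ 2 = ‖w.1‖ₑ ^ 2 + ‖w.2‖ₑ ^ 2 := by
  rw [ell2_sum_sq, enorm_L2_eq, enorm_L2_eq]; rfl

theorem ell2_pairCoeff_lt_top (w : L2 × L2) : ell2 (fun k => ‖pairCoeff w k‖ₑ) < ⊤ := by
  have h : ell2 (fun k => ‖pairCoeff w k‖ₑ) ^ 2 < ⊤ := by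
    rw [enorm_pair_sq]; exact ENNReal.add_lt_top.2 ⟨by simp, by simp⟩
  by_contra h'
  rw [not_lt, top_le_iff] at h'
  simp [h'] at h

/-- The sequence of the coefficients of a pair. -/
noncomputable def coeffFun (w : L2 × L2) : Lp2 (ℤ ⊕ ℤ) :=
  ⟨pairCoeff w, memLp2_of_ell2 (ell2_pairCoeff_lt_top w)⟩

@[simp] theorem coeffFun_apply (w : L2 × L2) (k : ℤ ⊕ ℤ) : coeffFun w k = pairCoeff w k := rfl

theorem enorm_coeffFun_sq (w : L2 × L2) : ‖coeffFun w‖ₑ ^ 2 = ‖w.1‖ₑ ^ 2 + ‖w.2‖ₑ ^ 2 := by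
  rw [enorm_eq_ell2, ← enorm_pair_sq]; rfl

theorem pairCoeff_inl (w : L2 × L2) (k : ℤ) :
    pairCoeff w (Sum.inl k) = fourierBasis.repr w.1 k := (fourierBasis_repr _ _).symm

theorem pairCoeff_inr (w : L2 × L2) (k : ℤ) :
    pairCoeff w (Sum.inr k) = fourierBasis.repr w.2 k := (fourierBasis_repr _ _).symm

theorem ell2_inl_lt_top (f : Lp2 (ℤ ⊕ ℤ)) : ell2 (fun k : ℤ => ‖f (Sum.inl k)‖ₑ) < ⊤ := by
  have h : ell2 (fun k => ‖f k‖ₑ) < ⊤ := by rw [← enorm_eq_ell2]; simp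
  refine lt_of_le_of_lt (ennreal_le_of_sq_le ?_) h
  rw [ell2_sum_sq fun k => ‖f k‖ₑ]
  exact le_self_add

theorem ell2_inr_lt_top (f : Lp2 (ℤ ⊕ ℤ)) : ell2 (fun k : ℤ => ‖f (Sum.inr k)‖ₑ) < ⊤ := by
  have h : ell2 (fun k => ‖f k‖ₑ) < ⊤ := by rw [← enorm_eq_ell2]; simp
  refine lt_of_le_of_lt (ennreal_le_of_sq_le ?_) h
  rw [ell2_sum_sq fun k => ‖f k‖ₑ]
  exact le_add_self

/-- The pair with given coefficients. -/
noncomputable def coeffInv (f : Lp2 (ℤ ⊕ ℤ)) : L2 × L2 :=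
  (fourierBasis.repr.symm ⟨fun k => f (Sum.inl k), memLp2_of_ell2 (ell2_inl_lt_top f)⟩,
    fourierBasis.repr.symm ⟨fun k => f (Sum.inr k), memLp2_of_ell2 (ell2_inr_lt_top f)⟩)

theorem pairCoeff_coeffInv (f : Lp2 (ℤ ⊕ ℤ)) (k : ℤ ⊕ ℤ) : pairCoeff (coeffInv f) k = f k := by
  rcases k with k | k
  · rw [pairCoeff_inl, coeffInv, LinearIsometryEquiv.apply_symm_apply]
  · rw [pairCoeff_inr, coeffInv, LinearIsometryEquiv.apply_symm_apply]

theorem pairCoeff_injective : Function.Injective pairCoeff := by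
  intro v w h
  refine Prod.ext ?_ ?_
  · refine fourierBasis.repr.injective ?_
    ext k
    rw [← pairCoeff_inl, ← pairCoeff_inl, h]
  · refine fourierBasis.repr.injective ?_
    ext k
    rw [← pairCoeff_inr, ← pairCoeff_inr, h]

theorem pairCoeff_add (v w : L2 × L2) : pairCoeff (v + w) = pairCoeff v + pairCoeff w := by
  ext k
  rcases k with k | k
  · simp only [Pi.add_apply, pairCoeff_inl, Prod.fst_add, map_add, lp.coeFn_add]
  · simp only [Pi.add_apply, pairCoeff_inr, Prod.snd_add, map_add, lp.coeFn_add]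

theorem pairCoeff_smul (c : ℂ) (w : L2 × L2) : pairCoeff (c • w) = c • pairCoeff w := by
  ext k
  rcases k with k | k
  · simp only [Pi.smul_apply, pairCoeff_inl, Prod.smul_fst, map_smul, lp.coeFn_smul]
  · simp only [Pi.smul_apply, pairCoeff_inr, Prod.smul_snd, map_smul, lp.coeFn_smul]

theorem norm_le_norm_coeffFun (w : L2 × L2) : ‖w‖ ≤ 1 * ‖coeffFun w‖ := by
  have h := enorm_coeffFun_sq w
  have h1 : ‖w.1‖ₑ ≤ ‖coeffFun w‖ₑ := ennreal_le_of_sq_le (by rw [h]; exact le_self_add)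
  have h2 : ‖w.2‖ₑ ≤ ‖coeffFun w‖ₑ := ennreal_le_of_sq_le (by rw [h]; exact le_add_self)
  rw [enorm_le_iff_norm_le] at h1 h2
  rw [one_mul, Prod.norm_def]
  exact max_le h1 h2

theorem norm_coeffFun_le (w : L2 × L2) : ‖coeffFun w‖ ≤ 2 * ‖w‖ := by
  have h := enorm_coeffFun_sq w
  have h1 : ‖w.1‖ₑ ≤ ‖w‖ₑ := enorm_le_iff_norm_le.2 (norm_fst_le w)
  have h2 : ‖w.2‖ₑ ≤ ‖w‖ₑ := enorm_le_iff_norm_le.2 (norm_snd_le w)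
  have h3 : ‖coeffFun w‖ₑ ≤ ENNReal.ofReal 2 * ‖w‖ₑ := by
    refine ennreal_le_of_sq_le ?_
    rw [h, ENNReal.ofReal_ofNat]
    calc _ ≤ ‖w‖ₑ ^ 2 + ‖w‖ₑ ^ 2 := by gcongr
      _ = 2 * ‖w‖ₑ ^ 2 := by ring
      _ ≤ 4 * ‖w‖ₑ ^ 2 := by gcongr; norm_num
      _ = _ := by ring
  rw [← ofReal_norm, ← ofReal_norm, ← ENNReal.ofReal_mul (by norm_num)] at h3
  exact (ENNReal.ofReal_le_ofReal_iff (by positivity)).1 h3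

/-- The identification of pairs of functions with their coefficients. -/
noncomputable def coeffEquiv : (L2 × L2) ≃L[ℂ] Lp2 (ℤ ⊕ ℤ) :=
  LinearEquiv.toContinuousLinearEquivOfBounds
    { toFun := coeffFun
      map_add' := fun v w => by ext k; exact congrFun (pairCoeff_add v w) k
      map_smul' := fun c w => by ext k; exact congrFun (pairCoeff_smul c w) k
      invFun := coeffInv
      left_inv := fun w => pairCoeff_injective (by ext k; rw [pairCoeff_coeffInv]; rfl)
      right_inv := fun f => by ext k; exact pairCoeff_coeffInv f k } 2 1 norm_coeffFun_le
    fun f => by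
      refine (norm_le_norm_coeffFun _).trans_eq ?_
      congr 2
      ext k
      exact pairCoeff_coeffInv f k

theorem coeffEquiv_apply (w : L2 × L2) (k : ℤ ⊕ ℤ) : coeffEquiv w k = pairCoeff w k := rfl

theorem pairCoeff_pairBasis (j k : ℤ ⊕ ℤ) :
    pairCoeff (pairBasis j) k = if k = j then 1 else 0 := by
  classical
  have h : ∀ j k : ℤ, fourierBasis.repr (fourierLp (T := 2 * Real.pi) 2 j) k =
      if k = j then 1 else 0 := fun j k => by
    rw [← coe_fourierBasis, HilbertBasis.repr_self, lp.single_apply]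
    by_cases hk : k = j
    · subst hk; simp
    · simp [hk]
  rcases k with k | k <;> rcases j with j | j
  · rw [pairCoeff_inl, pairBasis, h]; simp
  · rw [pairCoeff_inl, pairBasis]; simp
  · rw [pairCoeff_inr, pairBasis]; simp
  · rw [pairCoeff_inr, pairBasis, h]; simp

theorem coeffEquiv_pairBasis (j : ℤ ⊕ ℤ) : coeffEquiv (pairBasis j) = lp.single 2 j 1 := by
  ext k
  rw [coeffEquiv_apply, pairCoeff_pairBasis, lp.single_apply]
  by_cases hk : k = j
  · subst hk; simp
  · simp [hk]

/-- Transport of operators to the space of coefficients. -/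
noncomputable def coeffConj (T : BPair) : Lp2 (ℤ ⊕ ℤ) →L[ℂ] Lp2 (ℤ ⊕ ℤ) :=
  (coeffEquiv : L2 × L2 →L[ℂ] Lp2 (ℤ ⊕ ℤ)).comp (T.comp (coeffEquiv.symm : _ →L[ℂ] L2 × L2))

theorem ent_coeffConj (T : BPair) (k j : ℤ ⊕ ℤ) :
    ent (coeffConj T) k j = pairCoeff (T (pairBasis j)) k := by
  rw [ent, ← coeffEquiv_pairBasis]
  simp [coeffConj, coeffEquiv_apply]

theorem hasSum_pairCoeff (T : BPair) (w : L2 × L2) (k : ℤ ⊕ ℤ) :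
    HasSum (fun j => pairCoeff (T (pairBasis j)) k * pairCoeff w j) (pairCoeff (T w) k) := by
  have h := hasSum_ent_mul (coeffConj T) (coeffEquiv w) k
  simp only [ent_coeffConj, coeffEquiv_apply] at h
  simpa [coeffConj, coeffEquiv_apply] using h

theorem HasMatrix.unique {T S : BPair} {M : Matrix (ℤ ⊕ ℤ) (ℤ ⊕ ℤ) ℂ} (hT : HasMatrix T M)
    (hS : HasMatrix S M) : T = S := by
  refine ContinuousLinearMap.ext fun w => pairCoeff_injective (funext fun k => ?_)
  refine (hasSum_pairCoeff T w k).unique ((hasSum_pairCoeff S w k).congr_fun fun j => ?_)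
  rw [hT, hS]

/-- A bounded operator is determined by its matrix, so the choice made in `toOp` is harmless. -/
theorem HasMatrix.toOp_eq {T : BPair} {M : Matrix (ℤ ⊕ ℤ) (ℤ ⊕ ℤ) ℂ} (hT : HasMatrix T M) :
    toOp M = T := by
  have h : ∃ T, HasMatrix T M := ⟨T, hT⟩
  rw [toOp, dif_pos h]
  exact h.choose_spec.unique hT

theorem HasMatrix.sub {T S : BPair} {M N : Matrix (ℤ ⊕ ℤ) (ℤ ⊕ ℤ) ℂ} (hT : HasMatrix T M)
    (hS : HasMatrix S N) : HasMatrix (T - S) (M - N) := by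
  intro k j
  have h1 : (T - S) (pairBasis j) = T (pairBasis j) + (-1 : ℂ) • S (pairBasis j) := by
    simp [sub_eq_add_neg]
  rw [h1, pairCoeff_add, pairCoeff_smul, Pi.add_apply, Pi.smul_apply, hT, hS, Matrix.sub_apply]
  simp [sub_eq_add_neg]

end pairs

/-! ### Operator norms on Sobolev spaces -/

section sobolev

/-- The Sobolev weight. -/
noncomputable def sobWt (r : ℝ) (k : ℤ ⊕ ℤ) : ℝ≥0∞ := ENNReal.ofReal (jap (mag k) ^ r)

theorem sobWt_ne_top (r : ℝ) (k : ℤ ⊕ ℤ) : sobWt r k ≠ ⊤ := ENNReal.ofReal_ne_top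

theorem one_le_sobWt {r : ℝ} (hr : 0 ≤ r) (k : ℤ ⊕ ℤ) : 1 ≤ sobWt r k := by
  rw [sobWt, ← ENNReal.ofReal_one]
  exact ENNReal.ofReal_le_ofReal (Real.one_le_rpow (one_le_jap _) hr)

@[simp] theorem sobWt_zero (k : ℤ ⊕ ℤ) : sobWt 0 k = 1 := by simp [sobWt]

theorem sobNorm_sq (r : ℝ) (u : L2) : sobNorm r u ^ 2 = ell2 (fun k : ℤ =>
    ENNReal.ofReal (jap (k : ℝ) ^ r) *
      ‖fourierCoeff (T := 2 * Real.pi) (u : Circ → ℂ) k‖ₑ) ^ 2 := by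
  rw [sobNorm, ennreal_rpow_half_sq, ell2_sq]
  refine tsum_congr fun j => ?_
  have h0 : 0 ≤ jap (j : ℝ) := zero_le_one.trans (one_le_jap _)
  rw [← ofReal_norm, mul_pow, ← ENNReal.ofReal_pow (Real.rpow_nonneg h0 _),
    ← ENNReal.ofReal_pow (norm_nonneg _), ← ENNReal.ofReal_mul (by positivity),
    ← Real.rpow_mul_natCast h0, mul_comm r]
  norm_num

theorem pairNorm_eq (r : ℝ) (w : L2 × L2) :
    pairNorm r w = ell2 fun k => sobWt r k * ‖pairCoeff w k‖ₑ := by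
  rw [pairNorm, sobNorm_sq, sobNorm_sq, ← ennreal_sq_rpow_half (ell2 fun k => sobWt r k * ‖pairCoeff w k‖ₑ),
    ell2_sum_sq]
  simp [sobWt, mag, jap, pairCoeff]

theorem pairNorm_add_le (r : ℝ) (v w : L2 × L2) :
    pairNorm r (v + w) ≤ pairNorm r v + pairNorm r w := by
  simp only [pairNorm_eq, pairCoeff_add]
  exact ell2_enorm_add_le (sobWt r) (pairCoeff v) (pairCoeff w)

theorem pairNorm_smul (r : ℝ) (c : ℂ) (w : L2 × L2) :
    pairNorm r (c • w) = ‖c‖ₑ * pairNorm r w := by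
  simp only [pairNorm_eq, pairCoeff_smul]
  rw [← ell2_const_mul]
  congr 1; ext k
  rw [Pi.smul_apply, smul_eq_mul, enorm_mul]; ring

theorem enorm_le_pairNorm {r : ℝ} (hr : 0 ≤ r) (w : L2 × L2) (k : ℤ ⊕ ℤ) :
    ‖pairCoeff w k‖ₑ ≤ pairNorm r w := by
  rw [pairNorm_eq]
  exact (le_mul_of_one_le_left' (one_le_sobWt hr k)).trans
    (le_ell2 (fun k => sobWt r k * ‖pairCoeff w k‖ₑ) k)

theorem eq_zero_of_pairNorm {r : ℝ} (hr : 0 ≤ r) {w : L2 × L2} (h : pairNorm r w = 0) : w = 0 := by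
  refine pairCoeff_injective (funext fun k => ?_)
  have h1 := enorm_le_pairNorm hr w k
  rw [h, nonpos_iff_eq_zero, enorm_eq_zero] at h1
  have h2 : pairCoeff (0 : L2 × L2) k = 0 := by
    have := congrFun (pairCoeff_smul 0 0) k
    simpa using this
  rw [h1, h2]

theorem pairNorm_pairBasis_lt_top (r : ℝ) (j : ℤ ⊕ ℤ) : pairNorm r (pairBasis j) < ⊤ := by
  rw [pairNorm_eq]
  have h : ell2 (fun k => sobWt r k * ‖pairCoeff (pairBasis j) k‖ₑ) ^ 2 = sobWt r j ^ 2 := by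
    rw [ell2_sq, tsum_eq_single j]
    · simp [pairCoeff_pairBasis]
    · intro k hk; simp [pairCoeff_pairBasis, hk]
  have h2 : ell2 (fun k => sobWt r k * ‖pairCoeff (pairBasis j) k‖ₑ) ≤ sobWt r j :=
    ennreal_le_of_sq_le h.le
  exact h2.trans_lt ENNReal.ofReal_lt_top

theorem pairNorm_apply_le {r : ℝ} (hr : 0 ≤ r) (T : BPair) {w : L2 × L2} (hw : pairNorm r w < ⊤) :
    pairNorm r (T w) ≤ opNorm r T * pairNorm r w := by
  rcases eq_or_ne (pairNorm r w) 0 with h0 | h0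
  · rw [eq_zero_of_pairNorm hr h0, map_zero]
    have : pairNorm r (0 : L2 × L2) = 0 := by
      have := pairNorm_smul r 0 0
      simpa using this
    rw [this]; exact zero_le
  · set c := (pairNorm r w).toReal with hc
    have hcpos : 0 < c := ENNReal.toReal_pos h0 hw.ne
    have hcw : ENNReal.ofReal c = pairNorm r w := ENNReal.ofReal_toReal hw.ne
    have hci : ‖((c⁻¹ : ℝ) : ℂ)‖ₑ = (pairNorm r w)⁻¹ := by
      rw [← ofReal_norm, Complex.norm_real, Real.norm_of_nonneg (by positivity),
        ENNReal.ofReal_inv_of_pos hcpos, hcw]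
    have h1 : pairNorm r (((c⁻¹ : ℝ) : ℂ) • w) ≤ 1 := by
      rw [pairNorm_smul, hci, ENNReal.inv_mul_cancel h0 hw.ne]
    have h2 : pairNorm r (T (((c⁻¹ : ℝ) : ℂ) • w)) ≤ opNorm r T :=
      le_iSup₂ (f := fun w (_ : pairNorm r w ≤ 1) => pairNorm r (T w)) _ h1
    rw [map_smul, pairNorm_smul, hci] at h2
    exact ((ENNReal.inv_mul_le_iff h0 hw.ne).1 h2).trans_eq (mul_comm _ _)

theorem opNorm_le {r : ℝ} {T : BPair} {c : ℝ≥0∞} (h : ∀ w, pairNorm r (T w) ≤ c * pairNorm r w) :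
    opNorm r T ≤ c :=
  iSup₂_le fun w hw => (h w).trans (mul_le_of_le_one_right' hw)

/-- The exponentials belong to every `H^r`, and a bounded operator on `L²` vanishing on them is
zero. -/
theorem eq_zero_of_opNorm {r : ℝ} (hr : 0 ≤ r) {T : BPair} (h : opNorm r T = 0) : T = 0 := by
  have h1 : ∀ j, T (pairBasis j) = 0 := fun j => by
    have := pairNorm_apply_le hr T (pairNorm_pairBasis_lt_top r j)
    rw [h, zero_mul, nonpos_iff_eq_zero] at this
    exact eq_zero_of_pairNorm hr this
  have h2 : ∀ S : BPair, (∀ j, S (pairBasis j) = 0) → HasMatrix S 0 := fun S hS k j => by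
    have h3 : pairCoeff (0 : L2 × L2) k = 0 := by
      have := congrFun (pairCoeff_smul 0 0) k
      simpa using this
    rw [hS, h3]; rfl
  exact (h2 T h1).unique (h2 0 fun _ => rfl)

theorem opNorm_mul_le {r : ℝ} (hr : 0 ≤ r) (T S : BPair) :
    opNorm r (T * S) ≤ opNorm r T * opNorm r S := by
  -- The case is separated because the right side reads `0 · ∞ = 0` when `S` is unbounded on `H^r`.
  rcases eq_or_ne (opNorm r T) 0 with h0 | h0
  · rw [eq_zero_of_opNorm hr h0, zero_mul]
    refine (opNorm_le (c := 0) fun w => ?_).trans zero_le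
    have : pairNorm r (0 : L2 × L2) = 0 := by
      have := pairNorm_smul r 0 0
      simpa using this
    rw [show (0 : BPair) w = 0 from rfl, this]; exact zero_le
  · rcases eq_or_ne (opNorm r S) ⊤ with h1 | h1
    · rw [h1, ENNReal.mul_top h0]; exact le_top
    · refine iSup₂_le fun w hw => ?_
      have h2 := (pairNorm_apply_le hr S (hw.trans_lt ENNReal.one_lt_top)).trans
        (mul_le_of_le_one_right' hw)
      exact (pairNorm_apply_le hr T (h2.trans_lt h1.lt_top)).trans (by gcongr)

theorem continuous_pairCoeff (k : ℤ ⊕ ℤ) : Continuous fun w => pairCoeff w k :=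
  (evalCLM k).continuous.comp coeffEquiv.continuous

/-- Closedness is in the topology of operators on `L²`: Fourier coefficients are continuous there.
Thus limits constructed once on `L²` inherit the bounds on each `H^r`. -/
theorem isExtNorm_opNorm (r : ℝ) : IsExtNorm (opNorm r) where
  add_le T S := iSup₂_le fun w hw => (pairNorm_add_le r (T w) (S w)).trans (add_le_add
    (le_iSup₂ (f := fun w (_ : pairNorm r w ≤ 1) => pairNorm r (T w)) w hw)
    (le_iSup₂ (f := fun w (_ : pairNorm r w ≤ 1) => pairNorm r (S w)) w hw))
  smul_le c T := iSup₂_le fun w hw => (pairNorm_smul r c (T w)).le.trans (by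
    gcongr
    exact le_iSup₂ (f := fun w (_ : pairNorm r w ≤ 1) => pairNorm r (T w)) w hw)
  closed c := by
    simp only [opNorm, iSup_le_iff, Set.ofPred_forall, pairNorm_eq]
    refine isClosed_iInter fun w => isClosed_iInter fun _ => isClosed_ell2_le _ (fun k => ?_) c
    refine (ENNReal.continuous_const_mul (sobWt_ne_top r k)).comp (Continuous.enorm ?_)
    exact (continuous_pairCoeff k).comp (ContinuousLinearMap.apply ℂ (L2 × L2) w).continuous

theorem isTame_opNorm {r : ℝ} (hr : 0 ≤ r) : IsTame 1 (opNorm r) (opNorm r) where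
  hi_norm := isExtNorm_opNorm r
  lo_norm := isExtNorm_opNorm r
  hi_mul x y := by rw [one_mul]; exact (opNorm_mul_le hr x y).trans le_self_add
  lo_mul x y := by rw [one_mul]; exact (opNorm_mul_le hr x y).trans le_self_add

theorem opNorm_one_le (r : ℝ) : opNorm r 1 ≤ 1 := iSup₂_le fun _ hw => hw

theorem pairNorm_zero_eq (w : L2 × L2) : pairNorm 0 w = ‖coeffFun w‖ₑ := by
  rw [pairNorm_eq, enorm_eq_ell2]; simp

/-- The factor 2 comes from the maximum norm on the product, as opposed to the Euclidean norm of the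
coefficients. -/
theorem norm_le_of_opNorm {T : BPair} {c : ℝ} (hc : 0 ≤ c) (h : opNorm 0 T ≤ ENNReal.ofReal c) :
    ‖T‖ ≤ 2 * c := by
  refine T.opNorm_le_bound (by positivity) fun w => ?_
  have h1 : pairNorm 0 w < ⊤ := by rw [pairNorm_zero_eq]; simp
  have h2 := (pairNorm_apply_le le_rfl T h1).trans (mul_le_mul_left h _)
  rw [pairNorm_zero_eq, pairNorm_zero_eq, ← ofReal_norm, ← ofReal_norm, ← ENNReal.ofReal_mul hc,
    ENNReal.ofReal_le_ofReal_iff (by positivity)] at h2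
  calc ‖T w‖ ≤ 1 * ‖coeffFun (T w)‖ := norm_le_norm_coeffFun _
    _ ≤ c * ‖coeffFun w‖ := by rw [one_mul]; exact h2
    _ ≤ c * (2 * ‖w‖) := by gcongr; exact norm_coeffFun_le w
    _ = _ := by ring

end sobolev

end WaveKAM

namespace WaveKAM

/-! ### Operators on `H^r × H^r` from arrays -/

section evaluation
variable {d : ℕ}

/-- Peetre's inequality: `⟨k⟩ ≤ 2 ⟨k - j⟩ ⟨j⟩`, applied to absolute values. -/
theorem sobWt_le {r : ℝ} (hr : 0 ≤ r) (l : Fin d → ℤ) (k j : ℤ ⊕ ℤ) :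
    sobWt r k ≤ ENNReal.ofReal (2 ^ r) * wt r (l, k) (0, j) * sobWt r j := by
  have h1 := one_le_jap (mag j)
  have h2 : 1 ≤ idxDist ((l, k) : Idx d) (0, j) := one_le_idxDist _ _
  have h3 : jap (mag k) ≤ 2 * idxDist ((l, k) : Idx d) (0, j) * jap (mag j) := by
    have h4 : |mag k - mag j| ≤ idxDist ((l, k) : Idx d) (0, j) :=
      (le_max_left _ _).trans (le_max_right _ _)
    have h5 : |mag j| ≤ jap (mag j) := le_max_right _ _
    have h6 : |mag k| ≤ |mag k - mag j| + |mag j| := by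
      have := abs_add_le (mag k - mag j) (mag j)
      rwa [sub_add_cancel] at this
    refine max_le ?_ ?_
    · nlinarith
    · nlinarith [mul_nonneg (sub_nonneg.2 h1) (sub_nonneg.2 h2)]
  have h0 : 0 ≤ idxDist ((l, k) : Idx d) (0, j) := by linarith
  have h7 : 0 ≤ jap (mag j) := by linarith
  rw [sobWt, sobWt, wt, ← ENNReal.ofReal_mul (by positivity), ← ENNReal.ofReal_mul (by positivity),
    ← Real.mul_rpow (by norm_num) h0, ← Real.mul_rpow (by positivity) h7]
  exact ENNReal.ofReal_le_ofReal (Real.rpow_le_rpow (zero_le_one.trans (one_le_jap _)) h3 hr)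

/-- Peetre's inequality moves the Sobolev weight onto `f` at the cost of `r` orders of decay. A
further `s₀` orders make the sum over `ℓ` and `j` converge by Cauchy–Schwarz, uniformly in `θ`
because only absolute values of entries enter. -/
theorem ell2_eval_le {ζ : ℝ≥0∞} (hζ : ∀ p : Idx d, ell2 (fun q => wt (-sZero d) p q) ≤ ζ)
    {r : ℝ} (hr : 0 ≤ r) (A : OpArr d (ℤ ⊕ ℤ)) (f : ℤ ⊕ ℤ → ℝ≥0∞) :
    ell2 (fun k => sobWt r k * ∑' j, (∑' l, ‖A l k j‖ₑ) * f j) ≤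
      ENNReal.ofReal (2 ^ r) * ζ * colNorm (r + sZero d) (toep A) *
        ell2 fun j => sobWt r j * f j := by
  set a : ℤ ⊕ ℤ → Idx d → ℝ≥0∞ := fun k p =>
    wt (r + sZero d) (p.1, k) (0, p.2) * ‖A p.1 k p.2‖ₑ * (sobWt r p.2 * f p.2) with ha
  set v : ℤ ⊕ ℤ → Idx d → ℝ≥0∞ := fun k p => wt (-sZero d) (p.1, k) (0, p.2) with hv
  have hv1 : ∀ k, ell2 (v k) ≤ ζ := fun k => by
    refine le_trans (le_of_eq ?_) (hζ (0, k))
    rw [← ell2_equiv ((Equiv.neg (Fin d → ℤ)).prodCongr (Equiv.refl (ℤ ⊕ ℤ)))]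
    congr 1; ext p
    simp [hv, wt, idxDist]
  have h1 : ∀ k, sobWt r k * ∑' j, (∑' l, ‖A l k j‖ₑ) * f j ≤
      ENNReal.ofReal (2 ^ r) * ∑' p, a k p * v k p := fun k => by
    rw [← ENNReal.tsum_mul_left, ← ENNReal.tsum_mul_left,
      ENNReal.tsum_prod (f := fun l j => ENNReal.ofReal (2 ^ r) * (a k (l, j) * v k (l, j))),
      ENNReal.tsum_comm]
    refine ENNReal.tsum_le_tsum fun j => ?_
    rw [← ENNReal.tsum_mul_right, ← ENNReal.tsum_mul_left]
    refine ENNReal.tsum_le_tsum fun l => ?_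
    calc sobWt r k * (‖A l k j‖ₑ * f j) ≤
          (ENNReal.ofReal (2 ^ r) * wt r (l, k) (0, j) * sobWt r j) * (‖A l k j‖ₑ * f j) := by
          gcongr; exact sobWt_le hr l k j
      _ = (ENNReal.ofReal (2 ^ r) * (wt (r + sZero d) (l, k) (0, j) *
          wt (-sZero d) (l, k) (0, j)) * sobWt r j) * (‖A l k j‖ₑ * f j) := by
          rw [wt_mul, add_neg_cancel_right]
      _ = _ := by simp only [ha, hv]; ring
  have h2 : ∑' p, ∑' k, a k p ^ 2 ≤
      (colNorm (r + sZero d) (toep A) * ell2 fun j => sobWt r j * f j) ^ 2 := by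
    rw [ENNReal.tsum_prod (f := fun l j => ∑' k, a k (l, j) ^ 2), ENNReal.tsum_comm, mul_pow,
      ell2_sq, ← ENNReal.tsum_mul_left]
    refine ENNReal.tsum_le_tsum fun j => ?_
    have h3 := le_colNorm (r + sZero d) (toep A) (0, j)
    rw [ell2_le_iff, ENNReal.tsum_prod (f := fun l k =>
      (wt (r + sZero d) (l, k) (0, j) * ‖toep A (l, k) (0, j)‖ₑ) ^ 2)] at h3
    refine le_trans (le_of_eq ?_) (mul_le_mul_left h3 _)
    simp only [← ENNReal.tsum_mul_right, ha, mul_pow, toep, sub_zero]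
  refine (ell2_mono h1).trans ?_
  rw [ell2_const_mul, mul_assoc, mul_assoc]
  gcongr
  refine (ell2_kernel_le a v ζ hv1).trans ?_
  gcongr
  rw [← ennreal_sq_rpow_half (colNorm (r + sZero d) (toep A) * _)]
  gcongr

theorem tsum_enorm_lt_top {A : OpArr d (ℤ ⊕ ℤ)} (hA : colNorm (sZero d) (toep A) < ⊤)
    (k j : ℤ ⊕ ℤ) : ∑' l, ‖A l k j‖ₑ < ⊤ := by
  classical
  obtain ⟨ζ, -, hζ⟩ := exists_ell2_wt_le d
  have h := ell2_eval_le hζ le_rfl A fun i => if i = j then 1 else 0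
  simp only [sobWt_zero, one_mul, zero_add] at h
  have h1 := (le_ell2 (fun k => ∑' j', (∑' l, ‖A l k j'‖ₑ) * if j' = j then 1 else 0) k).trans h
  have h2 : ell2 (fun i => if i = j then (1 : ℝ≥0∞) else 0) ≤ 1 := by
    rw [ell2_le_iff, tsum_eq_single j fun i hi => by simp [hi]]; simp
  rw [tsum_eq_single j fun i hi => by simp [hi]] at h1
  simp only [if_true, mul_one] at h1
  refine h1.trans_lt (ENNReal.mul_lt_top (ENNReal.mul_lt_top (ENNReal.mul_lt_top
    ENNReal.ofReal_lt_top ENNReal.ofReal_lt_top) hA) (h2.trans_lt ENNReal.one_lt_top))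

theorem enorm_character (θ : Fin d → Circ) (l : Fin d → ℤ) :
    ‖∏ i, fourier (l i) (θ i)‖ₑ = 1 := by
  rw [← ofReal_norm, norm_prod, Finset.prod_eq_one, ENNReal.ofReal_one]
  intro i _
  rw [fourier_apply]; exact Circle.norm_coe _

theorem enorm_evalAt_le (A : OpArr d (ℤ ⊕ ℤ)) (θ : Fin d → Circ) (k j : ℤ ⊕ ℤ) :
    ‖evalAt A θ k j‖ₑ ≤ ∑' l, ‖A l k j‖ₑ := by
  refine enorm_tsum_le_tsum_enorm.trans (le_of_eq (tsum_congr fun l => ?_))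
  rw [enorm_mul, enorm_character, one_mul]

theorem evalAt_sub {A B : OpArr d (ℤ ⊕ ℤ)} (hA : colNorm (sZero d) (toep A) < ⊤)
    (hB : colNorm (sZero d) (toep B) < ⊤) (θ : Fin d → Circ) :
    evalAt (A - B) θ = evalAt A θ - evalAt B θ := by
  have hs : ∀ {A : OpArr d (ℤ ⊕ ℤ)}, colNorm (sZero d) (toep A) < ⊤ → ∀ k j,
      Summable fun l : Fin d → ℤ => (∏ i, fourier (l i) (θ i)) * A l k j := fun {A} hA k j => by
    refine Summable.of_enorm (ne_of_lt ?_)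
    refine lt_of_le_of_lt (le_of_eq (tsum_congr fun l => ?_)) (tsum_enorm_lt_top hA k j)
    rw [enorm_mul, enorm_character, one_mul]
  ext k j
  simp only [evalAt, Matrix.of_apply, Matrix.sub_apply]
  rw [← (hs hA k j).tsum_sub (hs hB k j)]
  refine tsum_congr fun l => ?_
  rw [Pi.sub_apply, Matrix.sub_apply, mul_sub]

theorem hasMatrix_toOp {A : OpArr d (ℤ ⊕ ℤ)} (hA : colNorm (sZero d) (toep A) < ⊤)
    (θ : Fin d → Circ) : HasMatrix (toOp (evalAt A θ)) (evalAt A θ) := by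
  obtain ⟨ζ, -, hζ⟩ := exists_ell2_wt_le d
  obtain ⟨T, hT⟩ := exists_clm_of_kernel (evalAt A θ)
    (ENNReal.ofReal ζ * colNorm (sZero d) (toep A)) (ENNReal.mul_lt_top ENNReal.ofReal_lt_top hA)
    fun f => by
      have h := ell2_eval_le hζ le_rfl A f
      simp only [sobWt_zero, one_mul, zero_add, Real.rpow_zero, ENNReal.ofReal_one] at h
      refine (ell2_mono fun k => ENNReal.tsum_le_tsum fun j => ?_).trans h
      gcongr
      exact enorm_evalAt_le A θ k j
  have h1 : HasMatrix ((coeffEquiv.symm : _ →L[ℂ] L2 × L2).comp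
      (T.comp (coeffEquiv : L2 × L2 →L[ℂ] Lp2 (ℤ ⊕ ℤ)))) (evalAt A θ) := by
    intro k j
    rw [← coeffEquiv_apply]
    simp only [ContinuousLinearMap.comp_apply, ContinuousLinearEquiv.coe_coe,
      ContinuousLinearEquiv.apply_symm_apply, coeffEquiv_pairBasis]
    refine (hT _ k).unique ?_
    convert hasSum_single j fun i hi => ?_ using 1
    · simp
    · simp [hi]
  rwa [h1.toOp_eq]

theorem opNorm_toOp_le {ζ : ℝ≥0∞} (hζ : ∀ p : Idx d, ell2 (fun q => wt (-sZero d) p q) ≤ ζ)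
    {r : ℝ} (hr : 0 ≤ r) {A : OpArr d (ℤ ⊕ ℤ)} (hA : colNorm (sZero d) (toep A) < ⊤)
    (θ : Fin d → Circ) : opNorm r (toOp (evalAt A θ)) ≤
      ENNReal.ofReal (2 ^ r) * ζ * colNorm (r + sZero d) (toep A) := by
  refine opNorm_le fun w => ?_
  rw [pairNorm_eq, pairNorm_eq]
  refine le_trans (ell2_mono fun k => ?_) (ell2_eval_le hζ hr A fun j => ‖pairCoeff w j‖ₑ)
  gcongr
  have h1 := hasSum_pairCoeff (toOp (evalAt A θ)) w k
  rw [← h1.tsum_eq]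
  refine enorm_tsum_le_tsum_enorm.trans (ENNReal.tsum_le_tsum fun j => ?_)
  rw [enorm_mul, hasMatrix_toOp hA θ k j]
  gcongr
  exact enorm_evalAt_le A θ k j

/-- On arrays with `s₀` orders of decay, evaluation is additive, so the pointwise bound also applies
to differences in `ω`. -/
theorem lipNorm_toOp_le {γ : ℝ} {S : Set (EuclideanSpace ℝ (Fin d))} {ζ : ℝ≥0∞}
    (hζ : ∀ p : Idx d, ell2 (fun q => wt (-sZero d) p q) ≤ ζ)
    {r : ℝ} (hr : 0 ≤ r) {A : EuclideanSpace ℝ (Fin d) → OpArr d (ℤ ⊕ ℤ)}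
    (hA : ∀ ω ∈ S, colNorm (sZero d) (toep (A ω)) < ⊤) (θ : Fin d → Circ) :
    lipNorm γ S (opNorm r) (fun ω => toOp (evalAt (A ω) θ)) ≤
      ENNReal.ofReal (2 ^ r) * ζ * arrLip γ S (r + sZero d) A := by
  refine lipNorm_le_mul (fun ω hω => opNorm_toOp_le hζ hr (hA ω hω) θ) fun ω₁ h₁ ω₂ h₂ => ?_
  have h3 : colNorm (sZero d) (toep (A ω₁ - A ω₂)) < ⊤ := by
    rw [toep_sub, sub_eq_add_neg]
    refine (colNorm_add_le _ _ _).trans_lt (ENNReal.add_lt_top.2 ⟨hA ω₁ h₁, ?_⟩)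
    refine (colNorm_le_of_enorm_le fun p q => ?_).trans_lt (hA ω₂ h₂)
    simp
  have h4 : toOp (evalAt (A ω₁) θ) - toOp (evalAt (A ω₂) θ) = toOp (evalAt (A ω₁ - A ω₂) θ) := by
    refine (HasMatrix.toOp_eq ?_).symm
    rw [evalAt_sub (hA ω₁ h₁) (hA ω₂ h₂)]
    exact (hasMatrix_toOp (hA ω₁ h₁) θ).sub (hasMatrix_toOp (hA ω₂ h₂) θ)
  rw [h4]
  exact opNorm_toOp_le hζ hr h3 θ

end evaluation

/-! ### Convergence of the transformations -/

section limit
variable {d : ℕ} {γ : ℝ} {S : Set (EuclideanSpace ℝ (Fin d))}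

/-- Each factor `e^{-iU} - 1` has size `2X 2⁻ⁿ`. As long as the product stays within distance 1 of
the identity, the new increment is at most three times that, and the increments `6X 2⁻ⁿ` sum to
`12X`, which closes the induction. -/
theorem kamPhi_bounds {N₀ : ℕ} {H P : EuclideanSpace ℝ (Fin d) → OpArr d (ℤ ⊕ ℤ)} {r X : ℝ}
    (hr : 0 ≤ r) (hX0 : 0 ≤ X) (hX : X ≤ 1 / 64) (θ : Fin d → Circ)
    (hu : ∀ n, lipNorm γ S (opNorm r) (fun ω => kamOpU N₀ H P n ω θ) ≤
      ENNReal.ofReal (X * (2⁻¹ : ℝ) ^ n)) (n : ℕ) :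
    lipNorm γ S (opNorm r) (fun ω => kamPhi N₀ H P n ω θ - 1) ≤
      ENNReal.ofReal (12 * X * (1 - (2⁻¹ : ℝ) ^ n)) ∧
    lipNorm γ S (opNorm r) (fun ω => kamPhi N₀ H P (n + 1) ω θ - kamPhi N₀ H P n ω θ) ≤
      ENNReal.ofReal (6 * X * (2⁻¹ : ℝ) ^ n) := by
  have hT := isTame_opNorm hr
  have hp : ∀ n : ℕ, (0 : ℝ) < 2⁻¹ ^ n := fun n => by positivity
  have hp1 : ∀ n : ℕ, (2⁻¹ : ℝ) ^ n ≤ 1 := fun n => pow_le_one₀ (by norm_num) (by norm_num)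
  have hF : ∀ n, lipNorm γ S (opNorm r) (fun ω =>
      NormedSpace.exp (-Complex.I • kamOpU N₀ H P n ω θ) - 1) ≤
      ENNReal.ofReal (2 * X * (2⁻¹ : ℝ) ^ n) := fun n => by
    have h1 : lipNorm γ S (opNorm r) (fun ω => -Complex.I • kamOpU N₀ H P n ω θ) ≤
        ENNReal.ofReal (X * (2⁻¹ : ℝ) ^ n) := by
      refine (lipNorm_smul_le hT.hi_norm _ _).trans ?_
      rw [enorm_neg, ← ofReal_norm, Complex.norm_I, ENNReal.ofReal_one, one_mul]
      exact hu n
    have h2 : 2 * 1 * lipNorm γ S (opNorm r) (fun ω => -Complex.I • kamOpU N₀ H P n ω θ) ≤ 2⁻¹ := by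
      rw [mul_one]
      refine (mul_le_mul_right h1 2).trans ?_
      rw [← ENNReal.ofReal_ofNat 2, ← ENNReal.ofReal_mul (by norm_num),
        ← ENNReal.ofReal_inv_of_pos (by norm_num)]
      refine ENNReal.ofReal_le_ofReal ?_
      have := mul_le_mul hX (hp1 n) (hp n).le (by norm_num)
      linarith
    refine (hT.lip_exp_sub_one h2).trans ((mul_le_mul_right h1 2).trans_eq ?_)
    rw [mul_assoc 2, ENNReal.ofReal_mul (p := 2) (by norm_num), ENNReal.ofReal_ofNat]
  have hq : ∀ n, 0 ≤ 12 * X * (1 - (2⁻¹ : ℝ) ^ n) := fun n => by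
    have := hp1 n
    have : 0 ≤ 1 - (2⁻¹ : ℝ) ^ n := by linarith
    positivity
  have hdiff : ∀ n, lipNorm γ S (opNorm r) (fun ω => kamPhi N₀ H P n ω θ - 1) ≤
      ENNReal.ofReal (12 * X * (1 - (2⁻¹ : ℝ) ^ n)) →
      lipNorm γ S (opNorm r) (fun ω => kamPhi N₀ H P (n + 1) ω θ - kamPhi N₀ H P n ω θ) ≤
      ENNReal.ofReal (6 * X * (2⁻¹ : ℝ) ^ n) := fun n hn => by
    have e : (fun ω => kamPhi N₀ H P (n + 1) ω θ - kamPhi N₀ H P n ω θ) = fun ω =>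
        (NormedSpace.exp (-Complex.I • kamOpU N₀ H P n ω θ) - 1) * (kamPhi N₀ H P n ω θ - 1) +
        (NormedSpace.exp (-Complex.I • kamOpU N₀ H P n ω θ) - 1) := by
      funext ω
      rw [kamPhi, mul_sub, sub_mul, mul_one, one_mul]; abel
    rw [e]
    refine (lipNorm_add_le hT.hi_norm _ _).trans ((add_le_add (hT.lip_mul _ _) le_rfl).trans ?_)
    calc _ ≤ 1 * (ENNReal.ofReal (2 * X * (2⁻¹ : ℝ) ^ n) *
          ENNReal.ofReal (12 * X * (1 - (2⁻¹ : ℝ) ^ n)) + ENNReal.ofReal (2 * X * (2⁻¹ : ℝ) ^ n) *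
          ENNReal.ofReal (12 * X * (1 - (2⁻¹ : ℝ) ^ n))) +
          ENNReal.ofReal (2 * X * (2⁻¹ : ℝ) ^ n) := by
          have := hF n
          gcongr
      _ = ENNReal.ofReal (2 * X * (2⁻¹ : ℝ) ^ n * (12 * X * (1 - (2⁻¹ : ℝ) ^ n)) +
          2 * X * (2⁻¹ : ℝ) ^ n * (12 * X * (1 - (2⁻¹ : ℝ) ^ n)) + 2 * X * (2⁻¹ : ℝ) ^ n) := by
          have := hq n
          rw [one_mul, ENNReal.ofReal_add (by positivity) (by positivity),
            ENNReal.ofReal_add (by positivity) (by positivity),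
            ENNReal.ofReal_mul (p := 2 * X * (2⁻¹ : ℝ) ^ n) (by positivity)]
      _ ≤ _ := by
          refine ENNReal.ofReal_le_ofReal ?_
          have h3 : 12 * X * (1 - (2⁻¹ : ℝ) ^ n) ≤ 1 := by nlinarith [hp n]
          have h4 : 0 ≤ 2 * X * (2⁻¹ : ℝ) ^ n := by positivity
          nlinarith
  have main : ∀ n, lipNorm γ S (opNorm r) (fun ω => kamPhi N₀ H P n ω θ - 1) ≤
      ENNReal.ofReal (12 * X * (1 - (2⁻¹ : ℝ) ^ n)) := by
    intro n
    induction n with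
    | zero =>
      have e : (fun ω => kamPhi N₀ H P 0 ω θ - 1) = fun _ => (0 : ℂ) • (0 : BPair) := by
        funext ω; simp [kamPhi]
      rw [e]
      refine (lipNorm_smul_le hT.hi_norm 0 _).trans ?_
      simp
    | succ n ih =>
      have e : (fun ω => kamPhi N₀ H P (n + 1) ω θ - 1) = fun ω =>
          (kamPhi N₀ H P (n + 1) ω θ - kamPhi N₀ H P n ω θ) + (kamPhi N₀ H P n ω θ - 1) := by
        funext ω; abel
      rw [e]
      refine (lipNorm_add_le hT.hi_norm _ _).trans ((add_le_add (hdiff n ih) ih).trans_eq ?_)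
      rw [← ENNReal.ofReal_add (by positivity) (hq n), pow_succ]
      congr 1; ring
  exact ⟨main n, hdiff n (main n)⟩

theorem lipNorm_sub_rev_le {R : Type*} [NormedAddCommGroup R] [NormedSpace ℂ R] {N : R → ℝ≥0∞}
    (hN : IsExtNorm N) (f g : EuclideanSpace ℝ (Fin d) → R) :
    lipNorm γ S N (fun ω => f ω - g ω) ≤ lipNorm γ S N (fun ω => g ω - f ω) := by
  have e : (fun ω => f ω - g ω) = fun ω => (-1 : ℂ) • (g ω - f ω) := by
    funext ω; simp
  rw [e]
  refine (lipNorm_smul_le hN _ _).trans ?_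
  simp

theorem tsum_ofReal_geometric {c : ℝ} (hc : 0 ≤ c) :
    ∑' n : ℕ, ENNReal.ofReal (c * (2⁻¹ : ℝ) ^ n) = ENNReal.ofReal (2 * c) := by
  rw [← ENNReal.ofReal_tsum_of_nonneg (fun n => by positivity)
    ((summable_geometric_of_lt_one (by norm_num) (by norm_num)).mul_left c), tsum_mul_left,
    tsum_geometric_of_lt_one (by norm_num) (by norm_num)]
  congr 1; norm_num; ring

/-- The limit is defined by a telescoping series of operators on `L²`, so it does not depend on `r`;
the tail bounds on each `H^r` follow from closedness of the norms. The inverse is likewise a single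
Neumann series, since `Φ - 1` has norm at most `24 X < 1` on `L²`. -/
theorem exists_kamPhi_limit {N₀ : ℕ} {H P : EuclideanSpace ℝ (Fin d) → OpArr d (ℤ ⊕ ℤ)}
    {ρ X : ℝ} (hρ : 0 ≤ ρ) (hX0 : 0 ≤ X) (hX : X ≤ 1 / 64)
    (hu : ∀ r, 0 ≤ r → r ≤ ρ → ∀ n θ, lipNorm γ S (opNorm r) (fun ω => kamOpU N₀ H P n ω θ) ≤
      ENNReal.ofReal (X * (2⁻¹ : ℝ) ^ n)) :
    ∃ Φ Ψ : EuclideanSpace ℝ (Fin d) → (Fin d → Circ) → BPair,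
      (∀ ω ∈ S, ∀ θ, Φ ω θ * Ψ ω θ = 1 ∧ Ψ ω θ * Φ ω θ = 1) ∧
      ∀ r, 0 ≤ r → r ≤ ρ → ∀ θ,
        (∀ n, lipNorm γ S (opNorm r) (fun ω => kamPhi N₀ H P n ω θ - Φ ω θ) ≤
          ENNReal.ofReal (12 * X * (2⁻¹ : ℝ) ^ n)) ∧
        lipNorm γ S (opNorm r) (fun ω => Φ ω θ - 1) ≤ ENNReal.ofReal (12 * X) ∧
        lipNorm γ S (opNorm r) (fun ω => Ψ ω θ - 1) ≤ ENNReal.ofReal (24 * X) := by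
  set D : ℕ → EuclideanSpace ℝ (Fin d) → (Fin d → Circ) → BPair := fun n ω θ =>
    kamPhi N₀ H P (n + 1) ω θ - kamPhi N₀ H P n ω θ with hD
  have hDlip : ∀ r, 0 ≤ r → r ≤ ρ → ∀ n θ, lipNorm γ S (opNorm r) (fun ω => D n ω θ) ≤
      ENNReal.ofReal (6 * X * (2⁻¹ : ℝ) ^ n) := fun r hr hrρ n θ =>
    (kamPhi_bounds hr hX0 hX θ (fun n => hu r hr hrρ n θ) n).2
  have hsum : ∀ ω ∈ S, ∀ θ, Summable fun n => D n ω θ := fun ω hω θ => by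
    refine Summable.of_norm_bounded (g := fun n : ℕ => 2 * (6 * X * (2⁻¹ : ℝ) ^ n))
      (((summable_geometric_of_lt_one (by norm_num) (by norm_num)).mul_left _).mul_left _)
      fun n => ?_
    exact norm_le_of_opNorm (by positivity)
      ((le_lipNorm (fun ω => D n ω θ) hω).trans (hDlip 0 le_rfl hρ n θ))
  set Φ : EuclideanSpace ℝ (Fin d) → (Fin d → Circ) → BPair := fun ω θ => 1 + ∑' n, D n ω θ with hΦ
  have htail : ∀ n, ∀ ω ∈ S, ∀ θ, HasSum (fun k => D (k + n) ω θ)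
      (Φ ω θ - kamPhi N₀ H P n ω θ) := fun n ω hω θ => by
    have h1 := (hasSum_nat_add_iff' n).2 (hsum ω hω θ).hasSum
    rw [Finset.sum_range_sub (fun n => kamPhi N₀ H P n ω θ)] at h1
    have e : Φ ω θ - kamPhi N₀ H P n ω θ =
        ∑' n, D n ω θ - (kamPhi N₀ H P n ω θ - kamPhi N₀ H P 0 ω θ) := by
      simp only [hΦ, kamPhi]; abel
    rw [e]; exact h1
  have hlim : ∀ r, 0 ≤ r → r ≤ ρ → ∀ n θ,
      lipNorm γ S (opNorm r) (fun ω => Φ ω θ - kamPhi N₀ H P n ω θ) ≤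
        ENNReal.ofReal (12 * X * (2⁻¹ : ℝ) ^ n) := fun r hr hrρ n θ => by
    refine (lipNorm_hasSum_le (isExtNorm_opNorm r) fun ω hω => htail n ω hω θ).trans ?_
    refine (ENNReal.tsum_le_tsum fun k => hDlip r hr hrρ (k + n) θ).trans_eq ?_
    have e : ∀ k, 6 * X * (2⁻¹ : ℝ) ^ (k + n) = 6 * X * (2⁻¹ : ℝ) ^ n * (2⁻¹ : ℝ) ^ k := fun k => by
      rw [pow_add]; ring
    simp only [e]
    rw [tsum_ofReal_geometric (by positivity)]
    congr 1; ring
  have hone : ∀ r, 0 ≤ r → r ≤ ρ → ∀ θ,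
      lipNorm γ S (opNorm r) (fun ω => Φ ω θ - 1) ≤ ENNReal.ofReal (12 * X) :=
    fun r hr hrρ θ => by simpa [kamPhi] using hlim r hr hrρ 0 θ
  have hnorm : ∀ ω ∈ S, ∀ θ, ‖1 - Φ ω θ‖ < 1 := fun ω hω θ => by
    rw [norm_sub_rev]
    refine (norm_le_of_opNorm (c := 12 * X) (by positivity)
      ((le_lipNorm (fun ω => Φ ω θ - 1) hω).trans (hone 0 le_rfl hρ θ))).trans_lt ?_
    linarith
  refine ⟨Φ, fun ω θ => ∑' n : ℕ, (1 - Φ ω θ) ^ n, fun ω hω θ => ⟨?_, ?_⟩,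
    fun r hr hrρ θ => ⟨fun n => ?_, hone r hr hrρ θ, ?_⟩⟩
  · have := mul_neg_geom_series (1 - Φ ω θ) (hnorm ω hω θ)
    rwa [sub_sub_cancel] at this
  · have := geom_series_mul_neg (1 - Φ ω θ) (hnorm ω hω θ)
    rwa [sub_sub_cancel] at this
  · exact (lipNorm_sub_rev_le (isExtNorm_opNorm r) _ _).trans (hlim r hr hrρ n θ)
  · have hT := isTame_opNorm hr
    have h1 : lipNorm γ S (opNorm r) (fun ω => 1 - Φ ω θ) ≤ ENNReal.ofReal (12 * X) :=
      (lipNorm_sub_rev_le (isExtNorm_opNorm r) (fun _ => 1) fun ω => Φ ω θ).trans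
        (hone r hr hrρ θ)
    have h2 : 2 * 1 * lipNorm γ S (opNorm r) (fun ω => 1 - Φ ω θ) ≤ 2⁻¹ := by
      rw [mul_one]
      refine (mul_le_mul_right h1 2).trans ?_
      rw [← ENNReal.ofReal_ofNat 2, ← ENNReal.ofReal_mul (by norm_num),
        ← ENNReal.ofReal_inv_of_pos (by norm_num)]
      exact ENNReal.ofReal_le_ofReal (by linarith)
    have h3 : ∀ ω ∈ S, HasSum (fun n : ℕ => (1 - Φ ω θ) ^ (n + 1))
        (∑' n : ℕ, (1 - Φ ω θ) ^ n - 1) := fun ω hω => by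
      have := (hasSum_nat_add_iff' 1).2
        (summable_geometric_of_norm_lt_one (hnorm ω hω θ)).hasSum
      simpa using this
    refine (lipNorm_hasSum_le (isExtNorm_opNorm r) h3).trans ?_
    calc _ ≤ ∑' n : ℕ, 2⁻¹ ^ n * ENNReal.ofReal (12 * X) :=
          ENNReal.tsum_le_tsum fun n => (hT.lip_pow h2 n).1.trans (by gcongr)
      _ = ENNReal.ofReal (24 * X) := by
          rw [ENNReal.tsum_mul_right, ennreal_tsum_geometric_two, ← ENNReal.ofReal_ofNat 2,
            ← ENNReal.ofReal_mul (by norm_num)]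
          congr 1; ring

end limit

end WaveKAM

namespace WaveKAM

/-! ### Uniformity in the angle and conclusion -/

theorem lipNorm_one_le {d : ℕ} {γ : ℝ} {S : Set (EuclideanSpace ℝ (Fin d))} (r : ℝ) :
    lipNorm γ S (opNorm r) (fun _ => (1 : BPair)) ≤ 1 := by
  rw [lipNorm_eq]
  have h1 : lipSemi S (opNorm r) (fun _ => (1 : BPair)) ≤ 0 := lipSemi_le fun _ _ _ _ _ => by
    rw [sub_self, (isExtNorm_opNorm r).zero]; exact zero_le
  rw [nonpos_iff_eq_zero.1 h1, mul_zero, add_zero]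
  exact supSemi_le fun _ _ => opNorm_one_le r

theorem exists_transformations {d : ℕ} {γ : ℝ} {S : Set (EuclideanSpace ℝ (Fin d))} {N₀ : ℕ}
    {H P : EuclideanSpace ℝ (Fin d) → OpArr d (ℤ ⊕ ℤ)}
    {ρ X : ℝ} (hρ : 0 ≤ ρ) (hX0 : 0 ≤ X) (hX : X ≤ 1 / 64)
    (hu : ∀ r, 0 ≤ r → r ≤ ρ → ∀ n θ, lipNorm γ S (opNorm r) (fun ω => kamOpU N₀ H P n ω θ) ≤
      ENNReal.ofReal (X * (2⁻¹ : ℝ) ^ n)) :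
    ∃ Φ Ψ : EuclideanSpace ℝ (Fin d) → (Fin d → Circ) → BPair,
      (∀ ω ∈ S, ∀ θ, Φ ω θ * Ψ ω θ = 1 ∧ Ψ ω θ * Φ ω θ = 1) ∧
      ∀ r, 0 ≤ r → r ≤ ρ →
        (∀ n, (⨆ θ, lipNorm γ S (opNorm r) (fun ω => kamPhi N₀ H P n ω θ)) < ⊤) ∧
        Filter.Tendsto
          (fun n => ⨆ θ, lipNorm γ S (opNorm r) (fun ω => kamPhi N₀ H P n ω θ - Φ ω θ))
          Filter.atTop (nhds 0) ∧
        (⨆ θ, lipNorm γ S (opNorm r) (fun ω => Φ ω θ - 1)) ≤ ENNReal.ofReal (24 * X) ∧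
        (⨆ θ, lipNorm γ S (opNorm r) (fun ω => Ψ ω θ - 1)) ≤ ENNReal.ofReal (24 * X) := by
  obtain ⟨Φ, Ψ, hinv, hbd⟩ := exists_kamPhi_limit hρ hX0 hX hu
  refine ⟨Φ, Ψ, hinv, fun r hr hrs => ⟨fun n => ?_, ?_, ?_, ?_⟩⟩
  · refine (iSup_le fun θ => ?_).trans_lt (ENNReal.ofReal_lt_top (r := 2))
    have e : (fun ω => kamPhi N₀ H P n ω θ) = fun ω => (kamPhi N₀ H P n ω θ - 1) + 1 := by
      funext ω; exact (sub_add_cancel _ _).symm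
    rw [e]
    have h1 := (kamPhi_bounds hr hX0 hX θ (fun n => hu r hr hrs n θ) n).1
    refine (lipNorm_add_le (isExtNorm_opNorm r) _ _).trans
      ((add_le_add h1 (lipNorm_one_le r)).trans ?_)
    rw [← ENNReal.ofReal_one, ← ENNReal.ofReal_add ?_ zero_le_one]
    · refine ENNReal.ofReal_le_ofReal ?_
      have hp : (0 : ℝ) < 2⁻¹ ^ n := by positivity
      nlinarith
    · have hp : (2⁻¹ : ℝ) ^ n ≤ 1 := pow_le_one₀ (by norm_num) (by norm_num)
      have : 0 ≤ 1 - (2⁻¹ : ℝ) ^ n := by linarith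
      positivity
  · have h1 : Filter.Tendsto (fun n : ℕ => ENNReal.ofReal (12 * X * (2⁻¹ : ℝ) ^ n)) Filter.atTop
        (nhds 0) := by
      rw [← ENNReal.ofReal_zero]
      refine ENNReal.tendsto_ofReal ?_
      have := (tendsto_pow_atTop_nhds_zero_of_lt_one (r := (2⁻¹ : ℝ)) (by norm_num)
        (by norm_num)).const_mul (12 * X)
      simpa using this
    exact tendsto_of_tendsto_of_tendsto_of_le_of_le tendsto_const_nhds h1 (fun n => zero_le)
      fun n => iSup_le fun θ => (hbd r hr hrs θ).1 n
  · exact iSup_le fun θ => (hbd r hr hrs θ).2.1.trans (ENNReal.ofReal_le_ofReal (by linarith))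
  · exact iSup_le fun θ => (hbd r hr hrs θ).2.2

/-- The factor `2^r` is replaced by `2^s` so that the constant is the same for all admissible `r`.
-/
theorem lipNorm_toOp_le_of_arrLip {d : ℕ} {γ : ℝ} {S : Set (EuclideanSpace ℝ (Fin d))} {ζ : ℝ}
    (hζ0 : 0 ≤ ζ)
    (hζ : ∀ p : Idx d, ell2 (fun q => wt (-sZero d) p q) ≤ ENNReal.ofReal ζ) {r t s c : ℝ}
    (hr : 0 ≤ r) (hrt : r + sZero d ≤ t) (hts : t ≤ s)
    {A : EuclideanSpace ℝ (Fin d) → OpArr d (ℤ ⊕ ℤ)}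
    (hA : arrLip γ S t A ≤ ENNReal.ofReal c) (θ : Fin d → Circ) :
    lipNorm γ S (opNorm r) (fun ω => toOp (evalAt (A ω) θ)) ≤
      ENNReal.ofReal (2 ^ s * ζ * c) := by
  have hσ := sZero_pos d
  have hfin : ∀ ω ∈ S, colNorm (sZero d) (toep (A ω)) < ⊤ := fun ω hω =>
    (colNorm_mono (by linarith) _).trans_lt ((colNorm_le_arrLip (γ := γ) hω t).trans_lt
      (hA.trans_lt ENNReal.ofReal_lt_top))
  refine (lipNorm_toOp_le hζ hr hfin θ).trans ?_
  rw [ENNReal.ofReal_mul (p := 2 ^ s * ζ) (by positivity), ENNReal.ofReal_mul (by positivity)]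
  gcongr
  · norm_num
  · linarith
  · exact (arrLip_mono hrt).trans hA

end WaveKAM

theorem corollary5p1 (d : ℕ) (hd : 0 < d) (τ₀ τ m C₀ s s' b : ℝ)
    (hτ₀ : (d : ℝ) < τ₀) (hτ : 0 < τ) (hm : 0 < m)
    (hb : b = (6 * τ + 4) + 1) (hs₁ : s' = s - τ₀ - 11) (hs : sZero d + b < s') :
    ∃ Nmin : ℕ, ∀ N₀ : ℕ, Nmin ≤ N₀ →
    ∃ δ₀ : ℝ, 0 < δ₀ ∧ δ₀ < 1 ∧ ∃ C : ℝ, 0 < C ∧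
    ∀ (γ ε : ℝ), 0 < γ → γ < 1 → 0 < ε → ε * γ⁻¹ ≤ δ₀ →
    ∀ (κ : EuclideanSpace ℝ (Fin d) → ℤ → ℝ)
      (P : EuclideanSpace ℝ (Fin d) → OpArr d (ℤ ⊕ ℤ)),
    (∀ j : ℤ, lipNorm γ (diophSet d γ τ₀) (fun x : ℝ => ENNReal.ofReal |x|) (fun ω => κ ω j)
      ≤ ENNReal.ofReal (C₀ * ε)) →
    (∀ ω ∈ diophSet d γ τ₀, HasHamForm (P ω)) →
    lipNorm γ (diophSet d γ τ₀) (hamNorm s' 1 0) P ≤ ENNReal.ofReal ε →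
    ∀ H : EuclideanSpace ℝ (Fin d) → OpArr d (ℤ ⊕ ℤ), H = (fun ω => initialH d m (κ ω)) →
    ∀ S : Set (EuclideanSpace ℝ (Fin d)), S = ⋂ n : ℕ, kamSet γ τ₀ τ N₀ H P n →
      -- the transformations are well defined on `S`
      (∀ ω ∈ S, ∀ n : ℕ,
        IsHomSol ω (scaleN N₀ n) (kamState N₀ ω (H ω) (P ω) n).1 (kamState N₀ ω (H ω) (P ω) n).2
          (kamU N₀ ω (H ω) (P ω) n) ∧
        ∀ θ, HasMatrix (kamOpU N₀ H P n ω θ) (evalAt (kamU N₀ ω (H ω) (P ω) n) θ)) ∧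
      ∃ Φ Ψ : EuclideanSpace ℝ (Fin d) → (Fin d → Circ) → BPair,
        (∀ ω ∈ S, ∀ θ, Φ ω θ * Ψ ω θ = 1 ∧ Ψ ω θ * Φ ω θ = 1) ∧
        ∀ r : ℝ, 0 ≤ r → r ≤ s' - b - sZero d →
          (∀ n : ℕ, (⨆ θ, lipNorm γ S (opNorm r) (fun ω => kamPhi N₀ H P n ω θ)) < ⊤) ∧
          Filter.Tendsto
            (fun n : ℕ => ⨆ θ, lipNorm γ S (opNorm r) (fun ω => kamPhi N₀ H P n ω θ - Φ ω θ))
            Filter.atTop (nhds 0) ∧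
          (⨆ θ, lipNorm γ S (opNorm r) (fun ω => Φ ω θ - 1)) ≤ ENNReal.ofReal (C * ε * γ⁻¹) ∧
          (⨆ θ, lipNorm γ S (opNorm r) (fun ω => Ψ ω θ - 1)) ≤ ENNReal.ofReal (C * ε * γ⁻¹) := by
  obtain ⟨ζ, hζ1, hζ⟩ := exists_ell2_wt_le d
  -- The threshold only has to ensure that every scale `M` is at least 4.
  refine ⟨8, fun N₀ hN₀ => ?_⟩
  obtain ⟨δ₁, hδ₁, hδ₁1, C₁, hC₁, hkam⟩ :=
    exists_kamU_bound (τ₀ := τ₀) (C₀ := C₀) hτ hm hb hs hN₀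
  set A := 2 ^ s' * ζ * C₁ with hA
  have hA0 : 0 < A := by positivity
  -- The second bound gives `X = A ε γ⁻¹ ≤ 1/64`, as the convergence argument requires; `24 A` comes
  -- from the Neumann series for the inverse.
  refine ⟨min δ₁ (1 / (64 * A)), lt_min hδ₁ (by positivity), (min_le_left _ _).trans_lt hδ₁1,
    24 * A, by positivity, ?_⟩
  intro γ ε hγ hγ1 hε hδ κ P hκ hP hPε H hH S hS
  have hall := hkam γ ε hγ hγ1 hε (hδ.trans (min_le_left _ _)) κ P hκ hP hPε S fun n => by
    rw [hS, hH]; exact Set.iInter_subset _ n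
  have hH' : ∀ ω, initialH d m (κ ω) = H ω := fun ω => by rw [hH]
  simp only [hH'] at hall
  have hεγ : 0 < ε * γ⁻¹ := by positivity
  have hσ := sZero_pos d
  have hb0 : 0 < b := by rw [hb]; linarith
  have hX1 : A * (ε * γ⁻¹) ≤ 1 / 64 := by
    have h1 := mul_le_mul_of_nonneg_left (hδ.trans (min_le_right _ _)) hA0.le
    have h2 : A * (1 / (64 * A)) = 1 / 64 := by field_simp
    rwa [h2] at h1
  obtain ⟨Φ, Ψ, hinv, hbd⟩ := exists_transformations (γ := γ) (S := S) (N₀ := N₀) (H := H) (P := P)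
    (ρ := s' - b - sZero d) (by linarith) (by positivity) hX1 fun r hr hrs n θ => by
      refine (lipNorm_toOp_le_of_arrLip (s := s') (by linarith) hζ hr (by linarith) (by linarith)
        (hall n).2 θ).trans_eq ?_
      rw [hA]; congr 1; ring
  have hC : 24 * (A * (ε * γ⁻¹)) = 24 * A * ε * γ⁻¹ := by ring
  rw [hC] at hbd
  refine ⟨fun ω hω n => ⟨(hall n).1 ω hω, fun θ => hasMatrix_toOp ?_ θ⟩, Φ, Ψ, hinv, hbd⟩
  exact (colNorm_mono (by linarith) _).trans_lt
    ((colNorm_le_arrLip (γ := γ) (A := fun ω => kamU N₀ ω (H ω) (P ω) n) hω (s' - b)).trans_lt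
      ((hall n).2.trans_lt ENNReal.ofReal_lt_top))
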